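/- Let $p\in\mathbb{C}$ with $|p|<1$ and let $q,a,b,c,d\in\mathbb{C}^{*}$. For $x\in\mathbb{C}^*$ put \[ \theta(x)=\prod_{k=0}^{\infty}(1-xp^k)(1-x^{-1}p^{k+1}), \] and for integers $n\ge 0$ put \[ (x)_n=\prod_{k=0}^{n-1}\theta(xq^k),\qquad (x)_{-n}=\frac{1}{(xq^{-n})_n},\qquad (x_1,\dots,x_r)_n=(x_1)_n\cdots(x_r)_n . \] For $m=(m_1,\dots,m_N)$ with nonnegative integers $m_i$ and $t=(t_1,\dots,t_N)\in(\mathbb{C}^*)^N$ define, with $|k|=k_1+\dots+k_N$, \begin{align*} V_m(a;b,c,d;t)={}&\sum_{k_1=0}^{m_1}\cdots\sum_{k_N=0}^{m_N}\; \prod_{i=1}^N\biggl(\frac{\theta(at_iq^{k_i+|k|})}{\theta(at_i)}\, \frac{(abt_i/c,abt_i/d)_{k_i}}{(aqt_i/c,aqt_i/d)_{k_i}}\, \frac{(at_i,abq^{m_i}t_i)_{|k|}}{(aqt_i/b,aq^{m_i+1}t_i)_{|k|}}\, \frac{(aqt_i/b)_{k_i+|k|}}{(abt_i)_{k_i+|k|}}\biggr)\\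 &\times\frac{(c,d)_{|k|}}{(cq/b,dq/b)_{|k|}}\Bigl(\frac{q}{b}\Bigr)^{(N+1)|k|} \prod_{i,j=1}^N\frac{(q^{-m_j}t_i/t_j,bt_i/t_j)_{k_i}}{(q^{1-m_j}t_i/bt_j,qt_i/t_j)_{k_i}}\, \frac{(qt_i/t_j)_{k_i-k_j}}{(bt_i/t_j)_{k_i-k_j}} . \end{align*} Let $\hat a=cd/ab$ and $s_it_i=q^{-m_i}$ for all $i\in\{1,\dots,N\}$. Then, whenever both sides are well defined (i.e. no theta function in a denominator of a term or of the prefactor vanishes), \[ V_m(a;b,c,d;t)=V_m(\hat a;b,c,d;s)\prod_{i=1}^N \frac{(aqt_i,\hat aqs_i/c,\hat aqs_i/d,aqt_i/cd)_{m_i}}{(\hat aqs_i,aqt_i/c,aqt_i/d,\hat aqs_i/cd)_{m_i}} . \] In particular, for $N=1$: let $n$ be a nonnegative integer and now let $\hat a=q^{-n}cd/ab$. Then, whenever both sides are well defined in the same sense, \begin{align*} &\sum_{k=0}^n\frac{\theta(aq^{2k})}{\theta(a)}\, \frac{(a,b,c,d,ab/c,ab/d,abq^n,q^{-n})_k}{(q,aq/b,aq/c,aq/d,cq/b,dq/b,q^{1-n}/b,aq^{n+1})_k}\,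 \frac{(aq/b)_{2k}}{(ab)_{2k}}\Bigl(\frac{q}{b}\Bigr)^{2k}\\ &\quad=\frac{(aq,\hat aq/c,\hat aq/d,aq/cd)_n}{(\hat aq,aq/c,aq/d,\hat aq/cd)_n} \sum_{k=0}^n\frac{\theta(\hat aq^{2k})}{\theta(\hat a)}\, \frac{(\hat a,b,c,d,\hat ab/c,\hat ab/d,\hat abq^n,q^{-n})_k}{(q,\hat aq/b,\hat aq/c,\hat aq/d,cq/b,dq/b,q^{1-n}/b,\hat aq^{n+1})_k}\, \frac{(\hat aq/b)_{2k}}{(\hat ab)_{2k}}\Bigl(\frac{q}{b}\Bigr)^{2k}. \end{align*} -/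

import Mathlib

open scoped BigOperators

noncomputable section

/-- The normalised theta function
`θ(x;p) = ∏_{k ≥ 0} (1 - x p^k) (1 - x⁻¹ p^(k+1))`, for `|p| < 1` and `x ≠ 0`. -/
def ellTheta (p x : ℂ) : ℂ :=
  ∏' k : ℕ, (1 - x * p ^ k) * (1 - x⁻¹ * p ^ (k + 1))

/-- The infinite product defining the theta function converges (unconditionally). -/
theorem ellTheta_multipliable (p x : ℂ) (hp : ‖p‖ < 1) :
    Multipliable fun k : ℕ => (1 - x * p ^ k) * (1 - x⁻¹ * p ^ (k + 1)) := by
  have hs : Summable fun k : ℕ => ‖p ^ k‖ := by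
    simpa [norm_pow] using summable_geometric_of_lt_one (norm_nonneg p) hp
  have h1 : Multipliable fun k : ℕ => 1 + -(x * p ^ k) := by
    refine multipliable_one_add_of_summable ?_
    simpa [norm_mul] using hs.mul_left ‖x‖
  have h2 : Multipliable fun k : ℕ => 1 + -(x⁻¹ * p ^ (k + 1)) := by
    refine multipliable_one_add_of_summable ?_
    have h := hs.mul_left (‖x⁻¹‖ * ‖p‖)
    refine h.congr fun k => ?_
    simp [pow_succ]
    ring
  simpa [sub_eq_add_neg] using h1.mul h2

/-- The theta shifted factorial `(x)_n = (x;q,p)_n` for an arbitrary integer `n`: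
`(x)_n = ∏_{j=0}^{n-1} θ(x q^j)` for `n ≥ 0`, and
`(x)_{-n} = 1 / (x q^{-n})_n = 1 / ∏_{j=1}^{n} θ(x q^{-j})` for `n ≥ 0`. -/
def thetaFact (p q x : ℂ) (n : ℤ) : ℂ :=
  (∏ j ∈ Finset.range n.toNat, ellTheta p (x * q ^ j)) /
    ∏ j ∈ Finset.range (-n).toNat, ellTheta p (x * q ^ (-((j : ℤ) + 1)))

/-- The summand of the `A_{N-1}` elliptic hypergeometric series `V_m(a;b,c,d;t)` with summation
index `k = (k_1,…,k_N)`; here `|k| = k_1 + ⋯ + k_N`. -/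
def ellVTerm (p q : ℂ) {N : ℕ} (m : Fin N → ℕ) (a b c d : ℂ) (t : Fin N → ℂ)
    (k : Fin N → ℕ) : ℂ :=
  (∏ i,
    (ellTheta p (a * t i * q ^ (k i + ∑ l, k l)) / ellTheta p (a * t i) *
      ((thetaFact p q (a * b * t i / c) (k i) * thetaFact p q (a * b * t i / d) (k i)) /
        (thetaFact p q (a * q * t i / c) (k i) * thetaFact p q (a * q * t i / d) (k i))) *
      ((thetaFact p q (a * t i) (∑ l, k l : ℕ) *
          thetaFact p q (a * b * q ^ m i * t i) (∑ l, k l : ℕ)) /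
        (thetaFact p q (a * q * t i / b) (∑ l, k l : ℕ) *
          thetaFact p q (a * q ^ (m i + 1) * t i) (∑ l, k l : ℕ))) *
      (thetaFact p q (a * q * t i / b) (k i + ∑ l, k l : ℕ) /
        thetaFact p q (a * b * t i) (k i + ∑ l, k l : ℕ)))) *
  ((thetaFact p q c (∑ l, k l : ℕ) * thetaFact p q d (∑ l, k l : ℕ)) /
    (thetaFact p q (c * q / b) (∑ l, k l : ℕ) * thetaFact p q (d * q / b) (∑ l, k l : ℕ))) *
  (q / b) ^ ((N + 1) * ∑ l, k l) *
  ∏ i, ∏ j,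
    ((thetaFact p q (q ^ (-(m j : ℤ)) * t i / t j) (k i) * thetaFact p q (b * t i / t j) (k i)) /
        (thetaFact p q (q ^ (1 - (m j : ℤ)) * t i / (b * t j)) (k i) *
          thetaFact p q (q * t i / t j) (k i)) *
      (thetaFact p q (q * t i / t j) ((k i : ℤ) - k j) /
        thetaFact p q (b * t i / t j) ((k i : ℤ) - k j)))

/-- The `A_{N-1}` elliptic hypergeometric series
`V_m(a;b,c,d;t) = ∑_{k_1=0}^{m_1} ⋯ ∑_{k_N=0}^{m_N} (⋯)`. -/
def ellV (p q : ℂ) {N : ℕ} (m : Fin N → ℕ) (a b c d : ℂ) (t : Fin N → ℂ) : ℂ :=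
  ∑ k ∈ Fintype.piFinset fun i => Finset.range (m i + 1), ellVTerm p q m a b c d t k

/-- The series `V_m(a;b,c,d;t)` is well defined: no theta function in a denominator of any of
its terms vanishes. For `k_i < k_j` the factorial `(q t_i/t_j)_{k_i-k_j}` is the reciprocal of a
product of theta functions, and `≠ 0` says in Lean that this product does not vanish; in the same
case `1/(b t_i/t_j)_{k_i-k_j}` is a product of theta functions, which needs no condition. -/
def EllVWellDefined (p q : ℂ) {N : ℕ} (m : Fin N → ℕ) (a b c d : ℂ) (t : Fin N → ℂ) : Prop :=
  ∀ k : Fin N → ℕ, (∀ i, k i ≤ m i) →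
    (∀ i,
      ellTheta p (a * t i) ≠ 0 ∧
      thetaFact p q (a * q * t i / c) (k i) ≠ 0 ∧
      thetaFact p q (a * q * t i / d) (k i) ≠ 0 ∧
      thetaFact p q (a * q * t i / b) (∑ l, k l : ℕ) ≠ 0 ∧
      thetaFact p q (a * q ^ (m i + 1) * t i) (∑ l, k l : ℕ) ≠ 0 ∧
      thetaFact p q (a * b * t i) (k i + ∑ l, k l : ℕ) ≠ 0) ∧
    thetaFact p q (c * q / b) (∑ l, k l : ℕ) ≠ 0 ∧
    thetaFact p q (d * q / b) (∑ l, k l : ℕ) ≠ 0 ∧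
    ∀ i j,
      thetaFact p q (q ^ (1 - (m j : ℤ)) * t i / (b * t j)) (k i) ≠ 0 ∧
      thetaFact p q (q * t i / t j) (k i) ≠ 0 ∧
      (k i < k j → thetaFact p q (q * t i / t j) ((k i : ℤ) - k j) ≠ 0) ∧
      (k j ≤ k i → thetaFact p q (b * t i / t j) ((k i : ℤ) - k j) ≠ 0)

/-- The one-variable series
`∑_{k=0}^n θ(a q^{2k})/θ(a)
  (a,b,c,d,ab/c,ab/d,abq^n,q^{-n})_k / (q,aq/b,aq/c,aq/d,cq/b,dq/b,q^{1-n}/b,aq^{n+1})_k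
  (aq/b)_{2k}/(ab)_{2k} (q/b)^{2k}`. -/
def ellV1 (p q : ℂ) (n : ℕ) (a b c d : ℂ) : ℂ :=
  ∑ k ∈ Finset.range (n + 1),
    ellTheta p (a * q ^ (2 * k)) / ellTheta p a *
    ((thetaFact p q a k * thetaFact p q b k * thetaFact p q c k * thetaFact p q d k *
        thetaFact p q (a * b / c) k * thetaFact p q (a * b / d) k *
        thetaFact p q (a * b * q ^ n) k * thetaFact p q (q ^ (-(n : ℤ))) k) /
      (thetaFact p q q k * thetaFact p q (a * q / b) k * thetaFact p q (a * q / c) k *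
        thetaFact p q (a * q / d) k * thetaFact p q (c * q / b) k * thetaFact p q (d * q / b) k *
        thetaFact p q (q ^ (1 - (n : ℤ)) / b) k * thetaFact p q (a * q ^ (n + 1)) k)) *
    (thetaFact p q (a * q / b) (2 * k : ℕ) / thetaFact p q (a * b) (2 * k : ℕ)) *
    (q / b) ^ (2 * k)

/-- No denominator in the one-variable series vanishes. -/
def EllV1WellDefined (p q : ℂ) (n : ℕ) (a b c d : ℂ) : Prop :=
  ellTheta p a ≠ 0 ∧ ∀ k : ℕ, k ≤ n →
    thetaFact p q q k ≠ 0 ∧ thetaFact p q (a * q / b) k ≠ 0 ∧ thetaFact p q (a * q / c) k ≠ 0 ∧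
    thetaFact p q (a * q / d) k ≠ 0 ∧ thetaFact p q (c * q / b) k ≠ 0 ∧
    thetaFact p q (d * q / b) k ≠ 0 ∧ thetaFact p q (q ^ (1 - (n : ℤ)) / b) k ≠ 0 ∧
    thetaFact p q (a * q ^ (n + 1)) k ≠ 0 ∧ thetaFact p q (a * b) (2 * k : ℕ) ≠ 0

end

/-! Up to a product of shifted factorials, the series V_m is a sum over all subsets I of the points
x = a t_i q^α, 0 ≤ α < m_i (`ellV_mul`). In such a `subsetSum` each point carries a weight depending
on |I| and on whether it is chosen, and each chosen point interacts with each unchosen one through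
`pairFac`. A subset containing qx but not x, for neighbours x, qx in a progression, has weight zero,
so only initial segments of the progressions survive, and these are indexed by k. The substitution
s_i t_i = q^(-m_i), â = cd/(ab) becomes the reflection x ↦ κ/x with κ = cd/(qb), up to reversing
each progression. The theorem is thus a case of a reflection formula for subset sums at arbitrary
points (`subsetDual`), where every point is a free variable.

That formula is proved by induction on the number of points (`subsetDual_insert`). Let one point X
vary and let n be the number of the others. The poles at q^(-k) and at the other points x_l cancel
between terms (`clearedSum_eval_qpow`, `clearedSum_eval_self`); only simple poles at b x_l and x_l/b
remain, where the residues are subset sums on n-1 points with c, d and the points multiplied by q.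
After multiplication by the factors of these poles, both sides are theta functions in X of degree
2n+2 with the same norm. They agree at the 2n points b x_l, x_l/b by induction, and also at c/b and
d/b, where one kind of weight vanishes and the sum collapses to n points
(`subsetSum_dual_of_eq_div`). Dividing the difference by the thetas of these 2n+2 zeros leaves
degree zero and norm b/q, which is not a power of p; such a function is zero
(`IsTheta.eq_zero_of_degree_zero`).

All of this needs generic parameters. Generic points are dense on a suitable exponential curve
through any given parameters (`eventually_genericV`), and the cross-multiplied identity is
continuous wherever both series are well defined, which gives the general case. The value p = 0 is
kept throughout by letting theta functions degenerate to polynomials. -/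

/-! ### The theta function: symmetries, zeros, differentiability. -/

/-- The infinite shifted factorial `∏ (1 - x p^k)`. -/
noncomputable def infFact (p x : ℂ) : ℂ := ∏' k : ℕ, (1 + -(x * p ^ k))

theorem summable_norm_mul_pow {p : ℂ} (hp : ‖p‖ < 1) (x : ℂ) :
    Summable fun k : ℕ => ‖-(x * p ^ k)‖ := by
  simpa [norm_mul, norm_pow] using
    (summable_geometric_of_lt_one (norm_nonneg p) hp).mul_left ‖x‖

theorem infFact_succ {p : ℂ} (hp : ‖p‖ < 1) (x : ℂ) :
    infFact p x = (1 - x) * infFact p (x * p) := by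
  have hm : Multipliable fun k : ℕ => 1 + -(x * p ^ (k + 1)) := by
    refine multipliable_one_add_of_summable ?_
    simpa [pow_succ', mul_assoc] using summable_norm_mul_pow hp (x * p)
  have h := tprod_eq_zero_mul' (f := fun k : ℕ => 1 + -(x * p ^ k)) hm
  have h' : infFact p (x * p) = ∏' k : ℕ, (1 + -(x * p ^ (k + 1))) :=
    tprod_congr fun k => by rw [pow_succ', mul_assoc]
  rw [h', sub_eq_add_neg, infFact, h, pow_zero, mul_one]

theorem infFact_ne_zero {p : ℂ} (hp : ‖p‖ < 1) {x : ℂ} (h : ∀ k : ℕ, x * p ^ k ≠ 1) :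
    infFact p x ≠ 0 := by
  refine tprod_one_add_ne_zero_of_summable (fun k hk => h k ?_) (summable_norm_mul_pow hp x)
  linear_combination -hk

/-- The product converges locally uniformly: on a ball of radius R its k-th term is bounded by
R|p|^k. -/
theorem differentiable_infFact {p : ℂ} (hp : ‖p‖ < 1) : Differentiable ℂ (infFact p) := by
  intro x
  have key : DifferentiableOn ℂ (infFact p) (Metric.ball 0 (‖x‖ + 1)) := by
    have hs : Summable fun k : ℕ => (‖x‖ + 1) * ‖p‖ ^ k :=
      (summable_geometric_of_lt_one (norm_nonneg p) hp).mul_left _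
    have := Summable.hasProdLocallyUniformlyOn_nat_one_add (f := fun (k : ℕ) (y : ℂ) => -(y * p ^ k))
      (K := Metric.ball 0 (‖x‖ + 1)) Metric.isOpen_ball hs
      (.of_forall fun k y hy => by
        have hy' : ‖y‖ < ‖x‖ + 1 := by simpa using hy
        simp only [norm_neg, norm_mul, norm_pow]
        gcongr) (fun k => by fun_prop)
    exact this.differentiableOn (.of_forall fun _ => by
      simpa [Finset.prod_fn] using DifferentiableOn.finsetProd (fun _ _ => by fun_prop))
      Metric.isOpen_ball
  exact (key.differentiableAt (Metric.isOpen_ball.mem_nhds (by simp)))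

theorem ellTheta_eq_infFact {p : ℂ} (hp : ‖p‖ < 1) (x : ℂ) :
    ellTheta p x = infFact p x * infFact p (x⁻¹ * p) := by
  have h1 : Multipliable fun k : ℕ => 1 + -(x * p ^ k) :=
    multipliable_one_add_of_summable (summable_norm_mul_pow hp x)
  have h2 : Multipliable fun k : ℕ => 1 + -(x⁻¹ * p * p ^ k) :=
    multipliable_one_add_of_summable (summable_norm_mul_pow hp (x⁻¹ * p))
  unfold ellTheta infFact
  rw [← h1.tprod_mul h2]
  refine tprod_congr fun k => ?_
  ring

/-- `θ(x) / (1 - x)`. -/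
noncomputable def redTheta (p x : ℂ) : ℂ := infFact p (x * p) * infFact p (x⁻¹ * p)

theorem ellTheta_eq_redTheta {p : ℂ} (hp : ‖p‖ < 1) (x : ℂ) :
    ellTheta p x = (1 - x) * redTheta p x := by
  rw [ellTheta_eq_infFact hp, infFact_succ hp, redTheta, mul_assoc]

/-- `redTheta` is symmetric under inversion, so only the factor 1 - x changes. -/
theorem ellTheta_inv {p : ℂ} (hp : ‖p‖ < 1) {x : ℂ} (hx : x ≠ 0) :
    ellTheta p x⁻¹ = -x⁻¹ * ellTheta p x := by
  rw [ellTheta_eq_redTheta hp, ellTheta_eq_redTheta hp, redTheta, redTheta, inv_inv]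
  field_simp
  ring

theorem ellTheta_p_mul {p : ℂ} (hp : ‖p‖ < 1) (hp0 : p ≠ 0) {x : ℂ} (hx : x ≠ 0) :
    ellTheta p (p * x) = -x⁻¹ * ellTheta p x := by
  rw [ellTheta_eq_infFact hp, ellTheta_eq_redTheta hp, redTheta]
  have : (p * x)⁻¹ * p = x⁻¹ := by field_simp
  rw [this, infFact_succ hp x⁻¹, mul_comm p x]
  field_simp
  ring

theorem ellTheta_zero_left (x : ℂ) : ellTheta 0 x = 1 - x := by
  have h : ‖(0 : ℂ)‖ < 1 := by simp
  have h0 : infFact 0 0 = 1 := by simp [infFact]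
  rw [ellTheta_eq_redTheta h, redTheta]
  simp [h0]

theorem ellTheta_one {p : ℂ} (hp : ‖p‖ < 1) : ellTheta p 1 = 0 := by
  simp [ellTheta_eq_redTheta hp]

theorem redTheta_one_ne_zero {p : ℂ} (hp : ‖p‖ < 1) : redTheta p 1 ≠ 0 := by
  have : infFact p p ≠ 0 := by
    refine infFact_ne_zero hp fun k hk => ?_
    have h1 : ‖p ^ (k + 1)‖ = 1 := by rw [pow_succ', hk]; simp
    rw [norm_pow] at h1
    exact absurd h1 (pow_lt_one₀ (norm_nonneg p) hp (by simp)).ne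
  simp [redTheta, this]

theorem differentiableAt_redTheta {p : ℂ} (hp : ‖p‖ < 1) {x : ℂ} (hx : x ≠ 0) :
    DifferentiableAt ℂ (redTheta p) x := by
  have h := differentiable_infFact hp
  unfold redTheta
  refine DifferentiableAt.mul ?_ ?_
  · exact (h _).comp x (by fun_prop)
  · exact (h _).comp x ((differentiableAt_inv hx).mul_const p)

theorem differentiableAt_ellTheta {p : ℂ} (hp : ‖p‖ < 1) {x : ℂ} (hx : x ≠ 0) :
    DifferentiableAt ℂ (ellTheta p) x := by
  have : ellTheta p = fun x => (1 - x) * redTheta p x := funext (ellTheta_eq_redTheta hp)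
  rw [this]
  exact (by fun_prop : DifferentiableAt ℂ (fun x : ℂ => 1 - x) x).mul
    (differentiableAt_redTheta hp hx)

/-- The zeros of the theta function are the powers of `p`. -/
theorem ellTheta_eq_zero {p : ℂ} (hp : ‖p‖ < 1) {x : ℂ} (hx : x ≠ 0) (h : ellTheta p x = 0) :
    x = 1 ∨ p ≠ 0 ∧ ∃ k : ℤ, x = p ^ k := by
  by_cases hp0 : p = 0
  · subst hp0
    rw [ellTheta_zero_left] at h
    left; linear_combination -h
  right
  refine ⟨hp0, ?_⟩
  by_contra! hne
  rw [ellTheta_eq_infFact hp] at h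
  rcases mul_eq_zero.1 h with h | h
  · refine infFact_ne_zero hp (fun k hk => hne (-k) ?_) h
    rw [zpow_neg, zpow_natCast]
    exact eq_inv_of_mul_eq_one_left hk
  · refine infFact_ne_zero hp (fun k hk => hne (k + 1) ?_) h
    have : x * (x⁻¹ * p * p ^ k) = p ^ (k + 1) := by field_simp; ring
    rw [hk, mul_one] at this
    exact_mod_cast this

/-- Iterated quasi-periodicity, in both directions. Only the monomial shape with nonzero constant is
used later, so the constants stay implicit. -/
theorem ellTheta_zpow_mul_eq {p : ℂ} (hp : ‖p‖ < 1) (hp0 : p ≠ 0) (k : ℤ) :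
    ∃ (c : ℂ) (l : ℤ), c ≠ 0 ∧ ∀ x : ℂ, x ≠ 0 → ellTheta p (p ^ k * x) = c * x ^ l * ellTheta p x := by
  induction k with
  | zero => exact ⟨1, 0, one_ne_zero, by simp⟩
  | succ k ih =>
    obtain ⟨c, l, hc, h⟩ := ih
    refine ⟨-(c * p ^ l), l - 1, by simp [hc, zpow_ne_zero, hp0], fun x hx => ?_⟩
    have := h (p * x) (mul_ne_zero hp0 hx)
    rw [zpow_add_one₀ hp0, mul_assoc, this, ellTheta_p_mul hp hp0 hx, mul_zpow, zpow_sub_one₀ hx]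
    ring
  | pred k ih =>
    obtain ⟨c, l, hc, h⟩ := ih
    refine ⟨-(c * p ^ (-l) * p⁻¹), l + 1, by simp [hc, zpow_ne_zero, hp0], fun x hx => ?_⟩
    have h1 := h (p⁻¹ * x) (mul_ne_zero (inv_ne_zero hp0) hx)
    have h2 := ellTheta_p_mul hp hp0 (mul_ne_zero (inv_ne_zero hp0) hx)
    rw [mul_inv_cancel_left₀ hp0] at h2
    have h3 : ellTheta p (p⁻¹ * x) = -(p⁻¹ * x) * ellTheta p x := by
      rw [h2]; field_simp
    rw [zpow_sub_one₀ hp0, mul_assoc, h1, h3, mul_zpow, zpow_add_one₀ hx, inv_zpow, zpow_neg]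
    ring

/-- Near a zero the theta function is a nonvanishing multiple of `θ(·/w)`. -/
theorem ellTheta_eq_mul_of_eq_zero {p : ℂ} (hp : ‖p‖ < 1) {w : ℂ} (hw : w ≠ 0)
    (h : ellTheta p w = 0) :
    ∃ (c : ℂ) (l : ℤ), c ≠ 0 ∧ ∀ x : ℂ, x ≠ 0 → ellTheta p x = c * x ^ l * ellTheta p (x / w) := by
  rcases ellTheta_eq_zero hp hw h with rfl | ⟨hp0, k, rfl⟩
  · exact ⟨1, 0, one_ne_zero, by simp⟩
  · obtain ⟨c, l, hc, h⟩ := ellTheta_zpow_mul_eq hp hp0 k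
    refine ⟨c * (p ^ k)⁻¹ ^ l, l, mul_ne_zero hc (zpow_ne_zero _ (inv_ne_zero hw)), fun x hx => ?_⟩
    have := h (x / p ^ k) (div_ne_zero hx hw)
    rw [mul_div_cancel₀ _ hw] at this
    rw [this, div_eq_mul_inv, mul_zpow]
    ring

/-- All zeros are simple: quasi-periodicity moves a zero to 1, where θ is 1 - x times a function not
vanishing there. -/
theorem deriv_ellTheta_ne_zero {p : ℂ} (hp : ‖p‖ < 1) {w : ℂ} (hw : w ≠ 0)
    (h : ellTheta p w = 0) : deriv (ellTheta p) w ≠ 0 := by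
  obtain ⟨c, l, hc, hcl⟩ := ellTheta_eq_mul_of_eq_zero hp hw h
  have hev : ellTheta p =ᶠ[nhds w] fun x => (1 - x / w) * (c * x ^ l * redTheta p (x / w)) := by
    filter_upwards [isOpen_ne.mem_nhds hw] with x hx
    rw [hcl x hx, ellTheta_eq_redTheta hp]
    ring
  have hd : DifferentiableAt ℂ (fun x => c * x ^ l * redTheta p (x / w)) w := by
    refine DifferentiableAt.mul ?_ ?_
    · exact (differentiableAt_zpow.2 (Or.inl hw)).const_mul c
    · refine DifferentiableAt.fun_comp' w (g := redTheta p) ?_ (by fun_prop)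
      exact differentiableAt_redTheta hp (div_ne_zero hw hw)
  have h1 : HasDerivAt (fun x : ℂ => 1 - x / w) (-(1 / w)) w := by
    simpa using ((hasDerivAt_id w).div_const w).const_sub 1
  rw [hev.deriv_eq, (h1.fun_mul hd.hasDerivAt).deriv]
  simp [hw, hc, zpow_ne_zero, redTheta_one_ne_zero hp]

theorem countable_ellTheta_eq_zero {p : ℂ} (hp : ‖p‖ < 1) :
    {x : ℂ | x ≠ 0 ∧ ellTheta p x = 0}.Countable := by
  refine Set.Countable.mono (s₂ := {1} ∪ Set.range fun k : ℤ => p ^ k) ?_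
    ((Set.countable_singleton _).union (Set.countable_range _))
  rintro x ⟨hx, h⟩
  rcases ellTheta_eq_zero hp hx h with rfl | ⟨-, k, rfl⟩
  · simp
  · exact Or.inr ⟨k, rfl⟩

/-! ### Theta functions of given degree and norm. -/

theorem natDegree_C_mul_X_le (a : ℂ) :
    (Polynomial.C a * Polynomial.X : Polynomial ℂ).natDegree ≤ 1 :=
  (Polynomial.natDegree_C_mul_le _ _).trans Polynomial.natDegree_X_le

/-- Theta functions of degree `M` and norm `t`: holomorphic functions on `ℂ*` with
`f (p x) = (-1)^M t x^(-M) f x`; for `p = 0` these degenerate to polynomials of degree at most `M`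
whose extreme coefficients have a prescribed ratio. -/
def IsTheta (p : ℂ) (M : ℕ) (t : ℂ) (f : ℂ → ℂ) : Prop :=
  (p ≠ 0 → DifferentiableOn ℂ f {0}ᶜ ∧ ∀ x, x ≠ 0 → f (p * x) = (-1) ^ M * t * x⁻¹ ^ M * f x) ∧
  (p = 0 → ∃ P : Polynomial ℂ, P.natDegree ≤ M ∧ P.coeff M * t = (-1) ^ M * P.coeff 0 ∧
    ∀ x, x ≠ 0 → f x = P.eval x)

namespace IsTheta

variable {p t t' : ℂ} {M M' : ℕ} {f g : ℂ → ℂ}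

theorem congr (hf : IsTheta p M t f) (h : ∀ x, x ≠ 0 → g x = f x) : IsTheta p M t g := by
  refine ⟨fun hp => ⟨(hf.1 hp).1.congr fun x hx => h x hx, fun x hx => ?_⟩, fun hp => ?_⟩
  · rw [h x hx, h _ (mul_ne_zero hp hx), (hf.1 hp).2 x hx]
  · obtain ⟨P, h1, h2, h3⟩ := hf.2 hp
    exact ⟨P, h1, h2, fun x hx => (h x hx).trans (h3 x hx)⟩

theorem zero : IsTheta p M t fun _ => 0 :=
  ⟨fun _ => ⟨differentiableOn_const _, by simp⟩, fun _ => ⟨0, by simp, by simp, by simp⟩⟩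

theorem one : IsTheta p 0 1 fun _ => 1 :=
  ⟨fun _ => ⟨differentiableOn_const _, by simp⟩, fun _ => ⟨1, by simp, by simp, by simp⟩⟩

theorem add (hf : IsTheta p M t f) (hg : IsTheta p M t g) : IsTheta p M t fun x => f x + g x := by
  refine ⟨fun hp => ⟨(hf.1 hp).1.add (hg.1 hp).1, fun x hx => ?_⟩, fun hp => ?_⟩
  · beta_reduce
    rw [(hf.1 hp).2 x hx, (hg.1 hp).2 x hx]; ring
  · obtain ⟨P, h1, h2, h3⟩ := hf.2 hp
    obtain ⟨Q, k1, k2, k3⟩ := hg.2 hp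
    refine ⟨P + Q, Polynomial.natDegree_add_le_of_degree_le h1 k1, ?_, fun x hx => ?_⟩
    · rw [Polynomial.coeff_add, Polynomial.coeff_add]; linear_combination h2 + k2
    · simp [h3 x hx, k3 x hx]

theorem const_mul (c : ℂ) (hf : IsTheta p M t f) : IsTheta p M t fun x => c * f x := by
  refine ⟨fun hp => ⟨(hf.1 hp).1.const_mul c, fun x hx => ?_⟩, fun hp => ?_⟩
  · beta_reduce
    rw [(hf.1 hp).2 x hx]; ring
  · obtain ⟨P, h1, h2, h3⟩ := hf.2 hp
    refine ⟨Polynomial.C c * P, (Polynomial.natDegree_C_mul_le _ _).trans h1, ?_, fun x hx => ?_⟩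
    · rw [Polynomial.coeff_C_mul, Polynomial.coeff_C_mul]; linear_combination c * h2
    · simp [h3 x hx]

theorem sub (hf : IsTheta p M t f) (hg : IsTheta p M t g) : IsTheta p M t fun x => f x - g x :=
  (hf.add (hg.const_mul (-1))).congr fun x _ => by ring

theorem sum {ι : Type*} (s : Finset ι) {f : ι → ℂ → ℂ} (h : ∀ i ∈ s, IsTheta p M t (f i)) :
    IsTheta p M t fun x => ∑ i ∈ s, f i x := by
  classical
  induction s using Finset.induction_on with
  | empty => simpa using zero
  | insert a s ha ih =>
    simp only [Finset.sum_insert ha]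
    exact (h a (by simp)).add (ih fun i hi => h i (by simp [hi]))

theorem mul (hf : IsTheta p M t f) (hg : IsTheta p M' t' g) :
    IsTheta p (M + M') (t * t') fun x => f x * g x := by
  refine ⟨fun hp => ⟨(hf.1 hp).1.mul (hg.1 hp).1, fun x hx => ?_⟩, fun hp => ?_⟩
  · beta_reduce
    rw [(hf.1 hp).2 x hx, (hg.1 hp).2 x hx]; ring
  · obtain ⟨P, h1, h2, h3⟩ := hf.2 hp
    obtain ⟨Q, k1, k2, k3⟩ := hg.2 hp
    refine ⟨P * Q, Polynomial.natDegree_mul_le_of_le h1 k1, ?_, fun x hx => ?_⟩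
    · rw [Polynomial.coeff_mul_add_eq_of_natDegree_le h1 k1, Polynomial.mul_coeff_zero, pow_add]
      linear_combination (Q.coeff M' * t') * h2 + (-1) ^ M * P.coeff 0 * k2
    · simp [h3 x hx, k3 x hx]

theorem cast (hf : IsTheta p M t f) (hM : M = M') (ht : t = t') : IsTheta p M' t' f := by
  subst hM ht; exact hf

theorem prod {ι : Type*} (s : Finset ι) {f : ι → ℂ → ℂ} {M : ι → ℕ} {t : ι → ℂ}
    (h : ∀ i ∈ s, IsTheta p (M i) (t i) (f i)) :
    IsTheta p (∑ i ∈ s, M i) (∏ i ∈ s, t i) fun x => ∏ i ∈ s, f i x := by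
  classical
  induction s using Finset.induction_on with
  | empty => simpa using one
  | insert a s ha ih =>
    simp only [Finset.prod_insert ha, Finset.sum_insert ha]
    exact (h a (by simp)).mul (ih fun i hi => h i (by simp [hi]))

theorem theta (hp : ‖p‖ < 1) {a : ℂ} (ha : a ≠ 0) : IsTheta p 1 a⁻¹ fun x => ellTheta p (a * x) := by
  refine ⟨fun hp0 => ⟨fun x hx => ?_, fun x hx => ?_⟩, fun hp0 => ?_⟩
  · refine (DifferentiableAt.fun_comp' x (g := ellTheta p) ?_ (by fun_prop)).differentiableWithinAt
    exact differentiableAt_ellTheta hp (mul_ne_zero ha hx)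
  · beta_reduce
    rw [mul_left_comm, ellTheta_p_mul hp hp0 (mul_ne_zero ha hx), mul_inv]
    ring
  · subst hp0
    refine ⟨1 - Polynomial.C a * Polynomial.X, ?_, ?_, fun x _ => ?_⟩
    · exact Polynomial.natDegree_sub_le_of_le (Polynomial.natDegree_one.le.trans zero_le_one) (natDegree_C_mul_X_le a)
    · simp [Polynomial.coeff_one, ha]
    · simp [ellTheta_zero_left]

theorem theta_div (hp : ‖p‖ < 1) {a : ℂ} (ha : a ≠ 0) : IsTheta p 1 a fun x => ellTheta p (x / a) :=
  ((theta hp (inv_ne_zero ha)).cast rfl (inv_inv a)).congr fun x _ => by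
    rw [div_eq_mul_inv, mul_comm]

/-- Inversion of the argument. -/
theorem inversion {κ : ℂ} (hκ : κ ≠ 0) (ht : t ≠ 0) (hf : IsTheta p M t f) :
    IsTheta p M (κ ^ M / t) fun x => x ^ M * f (κ / x) := by
  refine ⟨fun hp0 => ⟨?_, fun x hx => ?_⟩, fun hp0 => ?_⟩
  · refine DifferentiableOn.mul (by fun_prop) ?_
    refine (hf.1 hp0).1.fun_comp (g := f) (f := fun x => κ / x) ?_ ?_
    · intro x hx
      exact ((differentiableAt_const κ).div differentiableAt_id hx).differentiableWithinAt
    · intro x hx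
      exact div_ne_zero hκ hx
  · have h := (hf.1 hp0).2 (κ / (p * x)) (div_ne_zero hκ (mul_ne_zero hp0 hx))
    have h1 : p * (κ / (p * x)) = κ / x := by field_simp
    rw [h1] at h
    beta_reduce
    rw [h, mul_pow, inv_div, div_pow, mul_pow, inv_pow]
    have h2 : ((-1 : ℂ) ^ M) * (-1) ^ M = 1 := by rw [← mul_pow]; simp
    field_simp
    linear_combination (-f (κ / (p * x))) * h2
  · obtain ⟨P, h1, h2, h3⟩ := hf.2 hp0
    -- For p = 0, inversion reverses the coefficients of P(κX), which exchanges the two extreme ones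
    -- and so inverts their ratio.
    refine ⟨Polynomial.reflect M (P.comp (Polynomial.C κ * Polynomial.X)), ?_, ?_, fun x hx => ?_⟩
    · rw [Polynomial.natDegree_le_iff_coeff_eq_zero]
      intro N hN
      rw [Polynomial.coeff_reflect, Polynomial.revAt_eq_self_of_lt hN, Polynomial.comp_C_mul_X_coeff,
        Polynomial.coeff_eq_zero_of_natDegree_lt (h1.trans_lt hN), zero_mul]
    · rw [Polynomial.coeff_reflect, Polynomial.coeff_reflect, Polynomial.revAt_le le_rfl,
        Polynomial.revAt_le (Nat.zero_le M), Polynomial.comp_C_mul_X_coeff,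
        Polynomial.comp_C_mul_X_coeff]
      have h4 : ((-1 : ℂ) ^ M) * (-1) ^ M = 1 := by rw [← mul_pow]; simp
      simp only [Nat.sub_self, pow_zero, mul_one, Nat.sub_zero]
      field_simp
      linear_combination -(-1) ^ M * h2 - P.coeff 0 * h4
    · have hd : (P.comp (Polynomial.C κ * Polynomial.X)).natDegree ≤ M :=
        Polynomial.natDegree_comp_le.trans ((Nat.mul_le_mul h1
          (natDegree_C_mul_X_le κ)).trans (by simp))
      have : Invertible x⁻¹ := invertibleOfNonzero (inv_ne_zero hx)
      have := Polynomial.eval₂_reflect_mul_pow (RingHom.id ℂ) x⁻¹ M _ hd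
      rw [invOf_eq_inv, inv_inv, Polynomial.eval₂_id, Polynomial.eval₂_id, Polynomial.eval_comp,
        Polynomial.eval_mul, Polynomial.eval_C, Polynomial.eval_X, ← div_eq_mul_inv] at this
      beta_reduce
      rw [h3 _ (div_ne_zero hκ hx), ← this, inv_pow]
      field_simp

/-- A theta function vanishing at `y` is divisible by `θ(x / y)`. -/
theorem exists_eq_mul (hp : ‖p‖ < 1) {y : ℂ} (hy : y ≠ 0) (hf : IsTheta p (M + 1) t f)
    (h : f y = 0) :
    ∃ g, IsTheta p M (t / y) g ∧ ∀ x, x ≠ 0 → f x = ellTheta p (x / y) * g x := by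
  by_cases hp0 : p = 0
  · obtain ⟨P, h1, h2, h3⟩ := hf.2 hp0
    subst hp0
    have hroot : P.IsRoot y := by rw [Polynomial.IsRoot, ← h3 y hy, h]
    have hP := Polynomial.mul_divByMonic_eq_iff_isRoot.2 hroot
    set Q := P /ₘ (Polynomial.X - Polynomial.C y) with hQ
    have hc : P.coeff (M + 1) = Q.coeff M := by
      have hd : Q.natDegree ≤ M := by
        rw [hQ, Polynomial.natDegree_divByMonic _ (Polynomial.monic_X_sub_C y)]
        simp; omega
      rw [← hP, sub_mul, Polynomial.coeff_sub, Polynomial.coeff_X_mul, Polynomial.coeff_C_mul,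
        Polynomial.coeff_eq_zero_of_natDegree_lt (Nat.lt_succ_of_le hd)]
      simp
    have hc0 : P.coeff 0 = -y * Q.coeff 0 := by
      rw [← hP, Polynomial.mul_coeff_zero]; simp
    have hev : ∀ x, P.eval x = (x - y) * Q.eval x := fun x => by
      conv_lhs => rw [← hP]
      simp
    -- Here θ(x/y) = 1 - x/y, so P = (X - y)Q forces the factor -y.
    refine ⟨fun x => -y * Q.eval x, ⟨fun h => absurd rfl h, fun _ =>
      ⟨Polynomial.C (-y) * Q, ?_, ?_, fun x _ => by simp⟩⟩, fun x hx => ?_⟩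
    · refine (Polynomial.natDegree_C_mul_le _ _).trans ?_
      rw [hQ, Polynomial.natDegree_divByMonic _ (Polynomial.monic_X_sub_C y)]
      simp; omega
    · rw [hc, hc0, pow_succ] at h2
      rw [Polynomial.coeff_C_mul, Polynomial.coeff_C_mul]
      field_simp
      linear_combination -h2
    · rw [h3 x hx, hev, ellTheta_zero_left]
      field_simp
      ring
  · obtain ⟨hd, hper⟩ := hf.1 hp0
    set e : ℂ → ℂ := fun x => ellTheta p (x / y) with he
    have het : IsTheta p 1 y e := theta_div hp hy
    obtain ⟨hed, heper⟩ := het.1 hp0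
    have hne : ∀ {x : ℂ}, x ≠ 0 → ({0}ᶜ : Set ℂ) ∈ nhds x := fun hx => isOpen_ne.mem_nhds hx
    have hder : ∀ w, w ≠ 0 → e w = 0 → deriv e w ≠ 0 := by
      intro w hw hw0
      have h1 : deriv e w = deriv (ellTheta p) (w / y) * (1 / y) := by
        have h2 := (differentiableAt_ellTheta hp (div_ne_zero hw hy)).hasDerivAt
        exact (h2.comp w ((hasDerivAt_id w).div_const y)).deriv
      rw [h1]
      exact mul_ne_zero (deriv_ellTheta_ne_zero hp (div_ne_zero hw hy) hw0) (by simp [hy])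
    -- By quasi-periodicity a zero of f spreads along its whole p-orbit, so f vanishes at every zero
    -- of θ(x/y), not only at y.
    have hzpow : ∀ (k : ℤ) (x : ℂ), x ≠ 0 → f x = 0 → f (p ^ k * x) = 0 := by
      intro k x hx hfx
      induction k with
      | zero => simpa using hfx
      | succ k ih =>
        rw [zpow_add_one₀ hp0, mul_comm (p ^ (k : ℤ)), mul_assoc,
          hper _ (mul_ne_zero (zpow_ne_zero _ hp0) hx), ih, mul_zero]
      | pred k ih =>
        have h1 := hper (p ^ (-(k : ℤ) - 1) * x) (mul_ne_zero (zpow_ne_zero _ hp0) hx)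
        have h2 : p * (p ^ (-(k : ℤ) - 1) * x) = p ^ (-(k : ℤ)) * x := by
          rw [zpow_sub_one₀ hp0]; field_simp
        rw [h2, ih] at h1
        have h3 := hper y hy
        -- If the norm is zero, then f(px) = 0 for all x, so f vanishes off 0.
        by_cases ht : t = 0
        · have h4 := hper (p⁻¹ * (p ^ (-(k : ℤ) - 1) * x))
            (mul_ne_zero (inv_ne_zero hp0) (mul_ne_zero (zpow_ne_zero _ hp0) hx))
          rw [mul_inv_cancel_left₀ hp0, ht] at h4
          simpa using h4
        · rcases mul_eq_zero.1 h1.symm with h5 | h5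
          · exfalso
            have : p ^ (-(k : ℤ) - 1) * x ≠ 0 := mul_ne_zero (zpow_ne_zero _ hp0) hx
            exact mul_ne_zero (mul_ne_zero (by simp) ht) (pow_ne_zero _ (inv_ne_zero this)) h5
          · exact h5
    have hzero : ∀ w, w ≠ 0 → e w = 0 → f w = 0 := by
      intro w hw hw0
      rcases ellTheta_eq_zero hp (div_ne_zero hw hy) hw0 with h1 | ⟨-, k, h1⟩
      · rw [div_eq_one_iff_eq hy] at h1
        rw [h1, h]
      · rw [div_eq_iff hy] at h1
        rw [h1]; exact hzpow k y hy h
    classical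
    -- The quotient, filled in at the simple zeros of e by its limit f'/e'.
    let g : ℂ → ℂ := fun x => if e x = 0 then deriv f x / deriv e x else f x / e x
    have hfg : ∀ x, x ≠ 0 → f x = e x * g x := by
      intro x hx
      by_cases hex : e x = 0
      · rw [hex, zero_mul, hzero x hx hex]
      · simp only [g, hex, if_false]; field_simp
    have hpunct : ∀ w, w ≠ 0 → ∀ᶠ x in nhdsWithin w {w}ᶜ, e x ≠ 0 := by
      intro w hw
      have hdw : DifferentiableAt ℂ e w := hed.differentiableAt (hne hw)
      by_cases hw0 : e w = 0
      · exact hdw.hasDerivAt.eventually_ne (hder w hw hw0)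
      · exact (hdw.continuousAt.eventually_ne hw0).filter_mono nhdsWithin_le_nhds
    have hgd : ∀ w, w ≠ 0 → DifferentiableAt ℂ g w := by
      intro w hw
      have hdf : DifferentiableAt ℂ f w := hd.differentiableAt (hne hw)
      have hde : DifferentiableAt ℂ e w := hed.differentiableAt (hne hw)
      by_cases hw0 : e w = 0
      -- Near a zero w of e the quotient f/e equals the quotient of the divided differences at w,
      -- both holomorphic, the lower one nonzero at w.
      · have h1 : DifferentiableAt ℂ (dslope f w) w :=
          ((Complex.differentiableOn_dslope (hne hw)).2 hd).differentiableAt (hne hw)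
        have h2 : DifferentiableAt ℂ (dslope e w) w :=
          ((Complex.differentiableOn_dslope (hne hw)).2 hed).differentiableAt (hne hw)
        have h3 : dslope e w w ≠ 0 := by rw [dslope_same]; exact hder w hw hw0
        refine (h1.div h2 h3).congr_of_eventuallyEq ?_
        have hp' := eventually_nhdsWithin_iff.1 (hpunct w hw)
        filter_upwards [hp'] with x hx
        by_cases hxw : x = w
        · subst hxw
          simp [g, hw0, dslope_same]
        · have hex := hx hxw
          have hsub : x - w ≠ 0 := sub_ne_zero.2 hxw
          simp only [g, hex, if_false, Pi.div_apply, dslope_of_ne _ hxw, slope_def_field,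
            hw0, hzero w hw hw0, sub_zero]
          field_simp
      · refine (hdf.div hde hw0).congr_of_eventuallyEq ?_
        filter_upwards [hde.continuousAt.eventually_ne hw0] with x hx
        simp [g, hx]
    refine ⟨g, ⟨fun _ => ⟨fun w hw => (hgd w hw).differentiableWithinAt, fun w hw => ?_⟩,
      fun h => absurd h hp0⟩, hfg⟩
    -- The functional equation is immediate away from the zeros of e and extends to them by
    -- continuity.
    have hc1 : ContinuousAt (fun x => g (p * x)) w :=
      ContinuousAt.comp' (g := g) (hgd _ (mul_ne_zero hp0 hw)).continuousAt (by fun_prop)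
    have hc2 : ContinuousAt (fun x => (-1) ^ M * (t / y) * x⁻¹ ^ M * g x) w := by
      have := (hgd w hw).continuousAt
      have h2 : ContinuousAt (fun x : ℂ => x⁻¹) w := continuousAt_inv₀ hw
      fun_prop
    have heq : (fun x => g (p * x)) =ᶠ[nhdsWithin w {w}ᶜ]
        fun x => (-1) ^ M * (t / y) * x⁻¹ ^ M * g x := by
      filter_upwards [hpunct w hw, nhdsWithin_le_nhds (hne hw)] with x hex hx
      have hx : x ≠ 0 := hx
      have h1 := hper x hx
      have h2 := heper x hx
      have h3 : e (p * x) ≠ 0 := by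
        rw [h2]; simp [hy, hx, hex]
      have hgx : g x = f x / e x := by simp only [g, hex, if_false]
      have hgpx : g (p * x) = f (p * x) / e (p * x) := by simp only [g, h3, if_false]
      rw [hgx, hgpx, h1, h2, pow_succ, pow_succ]
      field_simp
    exact tendsto_nhds_unique_of_eventuallyEq (hc1.tendsto.mono_left nhdsWithin_le_nhds)
      (hc2.tendsto.mono_left nhdsWithin_le_nhds) heq

/-- A theta function of degree zero and nontrivial norm vanishes. -/
theorem eq_zero_of_degree_zero (hp : ‖p‖ < 1) (ht0 : t ≠ 0) (ht : ellTheta p t ≠ 0)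
    (hf : IsTheta p 0 t f) {x : ℂ} (hx : x ≠ 0) : f x = 0 := by
  by_cases hp0 : p = 0
  · obtain ⟨P, h1, h2, h3⟩ := hf.2 hp0
    subst hp0
    rw [ellTheta_zero_left] at ht
    -- In degree zero the two extreme coefficients coincide, so the norm condition reads P(0) t =
    -- P(0) with t ≠ 1.
    have h4 : P.coeff 0 = 0 := by
      have : P.coeff 0 * (1 - t) = 0 := by linear_combination -h2
      exact (mul_eq_zero.1 this).resolve_right ht
    rw [h3 x hx, Polynomial.eq_C_of_natDegree_le_zero h1, h4]; simp
  obtain ⟨hd, hper⟩ := hf.1 hp0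
  simp only [pow_zero, one_mul, mul_one] at hper
  have hpn : 0 < ‖p‖ := norm_pos_iff.2 hp0
  have hlog : Real.log ‖p‖ < 0 := Real.log_neg hpn hp
  -- The real exponent with |t||p|^s = 1, chosen so that |f(x)||x|^s is invariant under x ↦ px.
  set s : ℝ := -Real.log ‖t‖ / Real.log ‖p‖ with hs
  set H : ℂ → ℝ := fun x => ‖f x‖ * ‖x‖ ^ s with hH
  have hts : ‖t‖ * ‖p‖ ^ s = 1 := by
    rw [Real.rpow_def_of_pos hpn, hs, mul_div_cancel₀ _ hlog.ne, Real.exp_neg,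
      Real.exp_log (norm_pos_iff.2 ht0)]
    exact mul_inv_cancel₀ (norm_ne_zero_iff.2 ht0)
  have hHp : ∀ x, x ≠ 0 → H (p * x) = H x := by
    intro x hx
    simp only [hH]
    rw [hper x hx, norm_mul, norm_mul, Real.mul_rpow (norm_nonneg _) (norm_nonneg _)]
    linear_combination (‖f x‖ * ‖x‖ ^ s) * hts
  have hHz : ∀ (k : ℤ) (x : ℂ), x ≠ 0 → H (p ^ k * x) = H x := by
    intro k x hx
    induction k with
    | zero => simp
    | succ k ih =>
      rw [zpow_add_one₀ hp0, mul_comm (p ^ (k : ℤ)), mul_assoc,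
        hHp _ (mul_ne_zero (zpow_ne_zero _ hp0) hx), ih]
    | pred k ih =>
      rw [← hHp _ (mul_ne_zero (zpow_ne_zero _ hp0) hx), ← ih, zpow_sub_one₀ hp0]
      congr 1; field_simp
  obtain ⟨B, hB⟩ : ∃ B, ∀ x, x ≠ 0 → H x ≤ B := by
    have hK : IsCompact (Metric.closedBall (0 : ℂ) 1 ∩ {x | ‖p‖ ≤ ‖x‖}) :=
      (isCompact_closedBall _ _).inter_right (isClosed_le continuous_const continuous_norm)
    have hcont : ContinuousOn H (Metric.closedBall (0 : ℂ) 1 ∩ {x | ‖p‖ ≤ ‖x‖}) := by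
      intro x hx
      have hx0 : x ≠ 0 := by
        have : ‖p‖ ≤ ‖x‖ := hx.2
        exact norm_pos_iff.1 (hpn.trans_le this)
      have hc : ContinuousAt f x := (hd.differentiableAt (isOpen_ne.mem_nhds hx0)).continuousAt
      have hc2 : ContinuousAt (fun x : ℂ => ‖x‖ ^ s) x :=
        continuous_norm.continuousAt.rpow_const (Or.inl (norm_ne_zero_iff.2 hx0))
      exact (hc.norm.mul hc2).continuousWithinAt
    obtain ⟨B, hB⟩ := hK.bddAbove_image hcont
    refine ⟨B, fun x hx => ?_⟩
    -- Multiplication by p^(k+1) brings x into the closed annulus |p| ≤ |x| ≤ 1.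
    obtain ⟨k, hk1, hk2⟩ := exists_mem_Ioc_zpow (norm_pos_iff.2 hx) ((one_lt_inv₀ hpn).2 hp)
    rw [← hHz (k + 1) x hx]
    refine hB ⟨_, ⟨?_, ?_⟩, rfl⟩
    · rw [inv_zpow] at hk2
      rw [mem_closedBall_zero_iff, norm_mul, norm_zpow]
      calc _ ≤ ‖p‖ ^ (k + 1) * (‖p‖ ^ (k + 1))⁻¹ := by gcongr
        _ = 1 := mul_inv_cancel₀ (zpow_ne_zero _ hpn.ne')
    · rw [inv_zpow] at hk1
      change ‖p‖ ≤ _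
      rw [norm_mul, norm_zpow]
      calc ‖p‖ = ‖p‖ ^ (k + 1) * (‖p‖ ^ k)⁻¹ := by rw [zpow_add_one₀ hpn.ne']; field_simp
        _ ≤ _ := by gcongr
  -- The lift of f(x)x^s to the logarithm of x is entire and bounded, hence constant by Liouville.
  set G : ℂ → ℂ := fun u => f (Complex.exp u) * Complex.exp (s * u) with hG
  have hGd : Differentiable ℂ G := by
    intro u
    refine DifferentiableAt.mul ?_ (by fun_prop)
    exact DifferentiableAt.fun_comp' u (g := f)
      (hd.differentiableAt (isOpen_ne.mem_nhds (Complex.exp_ne_zero u))) (by fun_prop)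
  have hGn : ∀ u, ‖G u‖ = H (Complex.exp u) := by
    intro u
    simp only [hG, hH]
    rw [norm_mul, Complex.norm_exp, Complex.norm_exp, ← Real.exp_mul]
    congr 2
    simp [mul_comm]
  have hGb : Bornology.IsBounded (Set.range G) := by
    rw [isBounded_iff_forall_norm_le]
    refine ⟨B, ?_⟩
    rintro _ ⟨u, rfl⟩
    rw [hGn]; exact hB _ (Complex.exp_ne_zero u)
  have hconst : ∀ u, G u = f 1 := fun u => by
    rw [hGd.apply_eq_apply_of_bounded hGb u 0]; simp [hG]
  suffices hf1 : f 1 = 0 by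
    have h1 := hconst (Complex.log x)
    simp only [hG, hf1, Complex.exp_log hx, mul_eq_zero, Complex.exp_ne_zero, or_false] at h1
    exact h1
  -- If the constant is nonzero, the period 2πi forces s to be an integer n, and the point log p
  -- gives t p^n = 1, so that θ(t) = 0.
  by_contra hf1
  have h1 := hconst (2 * Real.pi * Complex.I)
  simp only [hG, Complex.exp_two_pi_mul_I] at h1
  have h2 : Complex.exp (s * (2 * Real.pi * Complex.I)) = 1 := by
    have : f 1 * (Complex.exp (s * (2 * Real.pi * Complex.I)) - 1) = 0 := by
      linear_combination h1
    linear_combination (mul_eq_zero.1 this).resolve_left hf1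
  obtain ⟨n, hn⟩ := Complex.exp_eq_one_iff.1 h2
  have hsn : (s : ℂ) = n := by
    exact mul_right_cancel₀ Complex.two_pi_I_ne_zero hn
  have h3 := hconst (Complex.log p)
  simp only [hG, Complex.exp_log hp0, hsn, Complex.exp_int_mul] at h3
  have h4 := hper 1 one_ne_zero
  rw [mul_one] at h4
  have h5 : t * p ^ n = 1 := by
    have : f 1 * (t * p ^ n - 1) = 0 := by rw [h4] at h3; linear_combination h3
    linear_combination (mul_eq_zero.1 this).resolve_left hf1
  apply ht
  obtain ⟨c, l, hc, h6⟩ := ellTheta_zpow_mul_eq hp hp0 n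
  have h7 := h6 t ht0
  rw [mul_comm, h5, ellTheta_one hp] at h7
  simpa [hc, zpow_ne_zero, ht0] using h7.symm

/-- A theta function is divisible by `θ(x / y)` for several distinct zeros `y` at once. -/
theorem exists_eq_prod_mul (hp : ‖p‖ < 1) {ι : Type*} (s : Finset ι) (y : ι → ℂ)
    (hy : ∀ i ∈ s, y i ≠ 0) (hdist : ∀ i ∈ s, ∀ j ∈ s, i ≠ j → ellTheta p (y i / y j) ≠ 0)
    (hf : IsTheta p (M + s.card) t f) (h : ∀ i ∈ s, f (y i) = 0) :
    ∃ g, IsTheta p M (t / ∏ i ∈ s, y i) g ∧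
      ∀ x, x ≠ 0 → f x = (∏ i ∈ s, ellTheta p (x / y i)) * g x := by
  classical
  induction s using Finset.induction_on generalizing M t f with
  | empty => exact ⟨f, by simpa using hf, by simp⟩
  | insert a s ha ih =>
    rw [Finset.card_insert_of_notMem ha, ← add_assoc, add_right_comm] at hf
    obtain ⟨g, hg, hfg⟩ := ih (fun i hi => hy i (by simp [hi]))
      (fun i hi j hj => hdist i (by simp [hi]) j (by simp [hj])) hf (fun i hi => h i (by simp [hi]))
    have hya := hy a (by simp)
    have hga : g (y a) = 0 := by
      have h1 := hfg (y a) hya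
      rw [h a (by simp)] at h1
      refine (mul_eq_zero.1 h1.symm).resolve_left (Finset.prod_ne_zero_iff.2 fun i hi => ?_)
      exact hdist a (by simp) i (by simp [hi]) (fun hai => ha (hai ▸ hi))
    obtain ⟨g', hg', hgg'⟩ := hg.exists_eq_mul hp hya hga
    refine ⟨g', hg'.cast rfl ?_, fun x hx => ?_⟩
    · rw [Finset.prod_insert ha, div_div, mul_comm]
    · rw [hfg x hx, hgg' x hx, Finset.prod_insert ha]; ring

end IsTheta

/-! ### Weights of the subset sum and generic parameters. -/

/-- Inversion stated so that two monomials x and y can be supplied in any form; only their product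
being 1 has to be checked. -/
theorem ellTheta_of_mul_eq_one {p : ℂ} (hp : ‖p‖ < 1) {x y : ℂ} (h : x * y = 1) :
    ellTheta p x = -x * ellTheta p y := by
  have hx : x ≠ 0 := left_ne_zero_of_mul_eq_one h
  have hy : y = x⁻¹ := eq_inv_of_mul_eq_one_right h
  rw [hy, ellTheta_inv hp hx]
  field_simp

/-- The interaction factor of two variables with ratio `y`. -/
noncomputable def pairFac (p q b y : ℂ) : ℂ :=
  ellTheta p (q * y) * ellTheta p (b * y / q) / (ellTheta p y * ellTheta p (b * y))

/-- The weight of a variable in the chosen subset of cardinality `r`. -/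
noncomputable def gIn (p q b c d : ℂ) (r : ℕ) (y : ℂ) : ℂ :=
  ellTheta p (b * y / c) * ellTheta p (b * y / d) * ellTheta p (q ^ (r + 1) * y / b) /
    ellTheta p (q ^ r * y)

/-- The weight of a variable outside the chosen subset of cardinality `r`. -/
noncomputable def gOut (p q b c d : ℂ) (r : ℕ) (y : ℂ) : ℂ :=
  ellTheta p (q * y / c) * ellTheta p (q * y / d) * ellTheta p (b * q ^ r * y) /
    ellTheta p (q ^ (r + 1) * y)

/-- The coefficient of the subsets of cardinality `r`. -/
noncomputable def coefA (p q b c d : ℂ) (r : ℕ) : ℂ :=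
  (q / b) ^ r * ∏ k ∈ Finset.range r, (ellTheta p (c * q ^ k) * ellTheta p (d * q ^ k) /
    (ellTheta p (c * q ^ (k + 1) / b) * ellTheta p (d * q ^ (k + 1) / b)))

section GenericParameters

variable {ι : Type*} {p q b c d : ℂ} {x : ι → ℂ} {S : Finset ι}

/-- Genericity of the parameters. -/
structure Generic (p q b c d : ℂ) (x : ι → ℂ) (S : Finset ι) : Prop where
  q0 : q ≠ 0
  b0 : b ≠ 0
  c0 : c ≠ 0
  d0 : d ≠ 0
  x0 : ∀ s ∈ S, x s ≠ 0
  params : ∀ i j k l : ℤ, i ≠ 0 ∨ j ≠ 0 ∨ k ≠ 0 ∨ l ≠ 0 →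
    ellTheta p (q ^ i * b ^ j * c ^ k * d ^ l) ≠ 0
  single : ∀ s ∈ S, ∀ i j k l : ℤ, ellTheta p (q ^ i * b ^ j * c ^ k * d ^ l * x s) ≠ 0
  pair : ∀ s ∈ S, ∀ t ∈ S, ∀ i j : ℤ, j ≠ 0 → ellTheta p (q ^ i * b ^ j * (x s / x t)) ≠ 0
  distinct : ∀ s ∈ S, ∀ t ∈ S, s ≠ t → ellTheta p (x s / x t) ≠ 0

namespace Generic

/-- With its companions, this reduces each nonvanishing claim to displaying the argument as a
monomial with explicit exponents. -/
theorem ne0 (g : Generic p q b c d x S) (i j k l : ℤ) {z : ℂ}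
    (hz : z = q ^ i * b ^ j * c ^ k * d ^ l)
    (h : i ≠ 0 ∨ j ≠ 0 ∨ k ≠ 0 ∨ l ≠ 0 := by simp) : ellTheta p z ≠ 0 := by
  rw [hz]; exact g.params i j k l h

theorem ne1 (g : Generic p q b c d x S) {s : ι} (hs : s ∈ S) (i j k l : ℤ) {z : ℂ}
    (hz : z = q ^ i * b ^ j * c ^ k * d ^ l * x s) : ellTheta p z ≠ 0 := by
  rw [hz]; exact g.single s hs i j k l

theorem ne2 (g : Generic p q b c d x S) {s t : ι} (hs : s ∈ S) (ht : t ∈ S) (i j : ℤ) {z : ℂ}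
    (hz : z = q ^ i * b ^ j * (x s / x t)) (hj : j ≠ 0 := by simp) : ellTheta p z ≠ 0 := by
  rw [hz]; exact g.pair s hs t ht i j hj

theorem ne0_nat (g : Generic p q b c d x S) (n : ℕ) (j k l : ℤ) {z : ℂ}
    (hz : z = q ^ n * (b ^ j * c ^ k * d ^ l))
    (h : j ≠ 0 ∨ k ≠ 0 ∨ l ≠ 0 := by simp) : ellTheta p z ≠ 0 :=
  g.ne0 n j k l (by rw [hz, zpow_natCast]; ring) (Or.inr h)

theorem ne1_nat (g : Generic p q b c d x S) {s : ι} (hs : s ∈ S) (n : ℕ) (j k l : ℤ) {z : ℂ}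
    (hz : z = q ^ n * (b ^ j * c ^ k * d ^ l) * x s) : ellTheta p z ≠ 0 :=
  g.ne1 hs n j k l (by rw [hz, zpow_natCast]; ring)

theorem mono {T : Finset ι} (g : Generic p q b c d x S) (h : T ⊆ S) : Generic p q b c d x T :=
  ⟨g.q0, g.b0, g.c0, g.d0, fun s hs => g.x0 s (h hs), g.params, fun s hs => g.single s (h hs),
    fun s hs t ht => g.pair s (h hs) t (h ht), fun s hs t ht => g.distinct s (h hs) t (h ht)⟩

theorem comm (g : Generic p q b c d x S) : Generic p q b d c x S := by
  refine ⟨g.q0, g.b0, g.d0, g.c0, g.x0, fun i j k l h => ?_, fun s hs i j k l => ?_, g.pair,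
    g.distinct⟩
  · exact g.ne0 i j l k (by ring) (by tauto)
  · exact g.ne1 hs i j l k (by ring)

theorem congr {y : ι → ℂ} (g : Generic p q b c d x S) (h : ∀ i ∈ S, y i = x i) :
    Generic p q b c d y S := by
  refine ⟨g.q0, g.b0, g.c0, g.d0, fun s hs => ?_, g.params, fun s hs => ?_, fun s hs t ht => ?_,
    fun s hs t ht => ?_⟩
  · rw [h s hs]; exact g.x0 s hs
  · rw [h s hs]; exact g.single s hs
  · rw [h s hs, h t ht]; exact g.pair s hs t ht
  · rw [h s hs, h t ht]; exact g.distinct s hs t ht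

/-- Shifting `c` and `d` by powers of `q` and scaling the variables by a power of `q`. -/
theorem shift (g : Generic p q b c d x S) (m n l : ℤ) :
    Generic p q b (q ^ m * c) (q ^ n * d) (fun i => q ^ l * x i) S := by
  have hq := g.q0
  refine ⟨g.q0, g.b0, mul_ne_zero (zpow_ne_zero _ hq) g.c0, mul_ne_zero (zpow_ne_zero _ hq) g.d0,
    fun s hs => mul_ne_zero (zpow_ne_zero _ hq) (g.x0 s hs), fun i j k r h => ?_,
    fun s hs i j k r => ?_, fun s hs t ht i j hj => ?_, fun s hs t ht hst => ?_⟩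
  · refine g.ne0 (i + m * k + n * r) j k r ?_ ?_
    · rw [mul_zpow, mul_zpow, zpow_add₀ hq, zpow_add₀ hq, zpow_mul, zpow_mul]; ring
    · by_contra! hcon
      obtain ⟨h1, rfl, rfl, rfl⟩ := hcon
      simp at h1 h
      exact h h1
  · refine g.ne1 hs (i + m * k + n * r + l) j k r ?_
    rw [mul_zpow, mul_zpow, zpow_add₀ hq, zpow_add₀ hq, zpow_add₀ hq, zpow_mul, zpow_mul]; ring
  · rw [mul_div_mul_left _ _ (zpow_ne_zero l hq)]
    exact g.pair s hs t ht i j hj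
  · rw [mul_div_mul_left _ _ (zpow_ne_zero l hq)]
    exact g.distinct s hs t ht hst

/-- Inverting the variables. -/
theorem dual (hp : ‖p‖ < 1) (g : Generic p q b c d x S) :
    Generic p q b c d (fun i => c * d / (q * b) / x i) S := by
  obtain ⟨hq, hb, hc, hd, hx, -, -, -, -⟩ := id g
  have hκ : c * d / (q * b) ≠ 0 := by simp [hq, hb, hc, hd]
  refine ⟨hq, hb, hc, hd, fun s hs => div_ne_zero hκ (hx s hs), g.params,
    fun s hs i j k l => ?_, fun s hs t ht i j hj => ?_, fun s hs t ht hst => ?_⟩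
  · have h := hx s hs
    rw [ellTheta_of_mul_eq_one hp
      (y := q ^ (1 - i) * b ^ (1 - j) * c ^ (-1 - k) * d ^ (-1 - l) * x s)]
    · refine mul_ne_zero (neg_ne_zero.2 ?_) (g.single s hs _ _ _ _)
      simp [hq, hb, hc, hd, h, zpow_ne_zero]
    · rw [zpow_sub₀ hq, zpow_sub₀ hb, zpow_sub₀ hc, zpow_sub₀ hd]
      field_simp
  · refine g.ne2 ht hs i j ?_ hj
    have h := hx s hs
    have h' := hx t ht
    field_simp
  · have h := hx s hs
    have h' := hx t ht
    have e : c * d / (q * b) / x s / (c * d / (q * b) / x t) = x t / x s := by field_simp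
    rw [e]
    exact g.distinct t ht s hs (Ne.symm hst)

end Generic

end GenericParameters

/-! ### Sums over subsets. -/

section Subsets

variable {ι : Type*} [DecidableEq ι]

/-- The weight of a subset `I` of `S`. -/
noncomputable def subsetWt (p q b : ℂ) (gi go : ℂ → ℂ) (x : ι → ℂ) (S I : Finset ι) : ℂ :=
  (∏ i ∈ I, gi (x i)) * (∏ j ∈ S \ I, go (x j)) *
    ∏ i ∈ I, ∏ j ∈ S \ I, pairFac p q b (x j / x i)

/-- The sum over all subsets of `S`. -/
noncomputable def subsetSum (p q b c d : ℂ) (x : ι → ℂ) (S : Finset ι) : ℂ :=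
  ∑ I ∈ S.powerset, coefA p q b c d I.card *
    subsetWt p q b (gIn p q b c d I.card) (gOut p q b c d I.card) x S I

variable {p q b c d : ℂ} {x : ι → ℂ} {S : Finset ι} {u : ι}

theorem subsetWt_congr {gi go : ℂ → ℂ} {y : ι → ℂ} {I : Finset ι} (hI : I ⊆ S)
    (h : ∀ i ∈ S, x i = y i) : subsetWt p q b gi go x S I = subsetWt p q b gi go y S I := by
  unfold subsetWt
  have h1 : ∀ j ∈ S \ I, x j = y j := fun j hj => h j (Finset.mem_sdiff.1 hj).1
  have h2 : ∀ i ∈ I, x i = y i := fun i hi => h i (hI hi)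
  congr 1
  · congr 1
    · exact Finset.prod_congr rfl fun i hi => by rw [h2 i hi]
    · exact Finset.prod_congr rfl fun i hi => by rw [h1 i hi]
  · exact Finset.prod_congr rfl fun i hi => Finset.prod_congr rfl fun j hj => by
      rw [h1 j hj, h2 i hi]

theorem subsetSum_congr {y : ι → ℂ} (h : ∀ i ∈ S, x i = y i) :
    subsetSum p q b c d x S = subsetSum p q b c d y S :=
  Finset.sum_congr rfl fun I hI => by rw [subsetWt_congr (Finset.mem_powerset.1 hI) h]

theorem subsetWt_insert_out {gi go : ℂ → ℂ} {I : Finset ι} (hu : u ∉ S) (hI : I ⊆ S) :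
    subsetWt p q b gi go x (insert u S) I =
      go (x u) * (∏ i ∈ I, pairFac p q b (x u / x i)) * subsetWt p q b gi go x S I := by
  have huI : u ∉ I := fun h => hu (hI h)
  have huS : u ∉ S \ I := fun h => hu (Finset.mem_sdiff.1 h).1
  unfold subsetWt
  rw [Finset.insert_sdiff_of_notMem _ huI]
  simp only [Finset.prod_insert huS, Finset.prod_mul_distrib]
  ring

theorem subsetWt_insert_in {gi go : ℂ → ℂ} {I : Finset ι} (hu : u ∉ S) (hI : I ⊆ S) :
    subsetWt p q b gi go x (insert u S) (insert u I) =
      gi (x u) * (∏ j ∈ S \ I, pairFac p q b (x j / x u)) * subsetWt p q b gi go x S I := by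
  have huI : u ∉ I := fun h => hu (hI h)
  have h : insert u S \ insert u I = S \ I := by
    ext j
    simp only [Finset.mem_sdiff, Finset.mem_insert, not_or]
    constructor
    · rintro ⟨h1 | h1, h2, h3⟩
      · exact absurd h1 h2
      · exact ⟨h1, h3⟩
    · rintro ⟨h1, h2⟩
      exact ⟨Or.inr h1, fun h => hu (h ▸ h1), h2⟩
  unfold subsetWt
  rw [h]
  simp only [Finset.prod_insert huI]
  ring

/-- Multiplying the single-variable weights by the same function on both sides. -/
theorem subsetWt_mul {gi go gi' go' : ℂ → ℂ} {e : ℂ → ℂ} {I : Finset ι} (hI : I ⊆ S)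
    {f : ι → ℂ} {f' : ι → ℂ}
    (h1 : ∀ i ∈ I, gi (x i) * f i = e (x i) * gi' (x i))
    (h2 : ∀ i ∈ S \ I, go (x i) * f' i = e (x i) * go' (x i)) :
    (∏ i ∈ I, f i) * (∏ i ∈ S \ I, f' i) * subsetWt p q b gi go x S I =
      (∏ i ∈ S, e (x i)) * subsetWt p q b gi' go' x S I := by
  unfold subsetWt
  rw [← Finset.prod_sdiff hI (f := fun i => e (x i))]
  have e1 := Finset.prod_congr rfl h1
  have e2 := Finset.prod_congr rfl h2
  simp only [Finset.prod_mul_distrib] at e1 e2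
  linear_combination (∏ i ∈ I, ∏ j ∈ S \ I, pairFac p q b (x j / x i)) *
    ((∏ i ∈ S \ I, go (x i)) * (∏ i ∈ S \ I, f' i) * e1 +
      (∏ i ∈ I, e (x i)) * (∏ i ∈ I, gi' (x i)) * e2)

/-- Pairing J with J ∪ {u} is what makes the poles manageable: in both terms the single-variable
weight of x u has the same denominator θ(q^(|J|+1) x u). -/
theorem subsetSum_insert (hu : u ∉ S) :
    subsetSum p q b c d x (insert u S) = ∑ J ∈ S.powerset,
      (coefA p q b c d J.card * (gOut p q b c d J.card (x u) *
          (∏ i ∈ J, pairFac p q b (x u / x i)) *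
          subsetWt p q b (gIn p q b c d J.card) (gOut p q b c d J.card) x S J) +
        coefA p q b c d (J.card + 1) * (gIn p q b c d (J.card + 1) (x u) *
          (∏ j ∈ S \ J, pairFac p q b (x j / x u)) *
          subsetWt p q b (gIn p q b c d (J.card + 1)) (gOut p q b c d (J.card + 1)) x S J)) := by
  unfold subsetSum
  rw [Finset.sum_powerset_insert hu, ← Finset.sum_add_distrib]
  refine Finset.sum_congr rfl fun J hJ => ?_
  have hJ' := Finset.mem_powerset.1 hJ
  rw [Finset.card_insert_of_notMem fun h => hu (hJ' h), subsetWt_insert_out hu hJ',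
    subsetWt_insert_in hu hJ']

theorem coefA_succ (r : ℕ) : coefA p q b c d (r + 1) = coefA p q b c d r * ((q / b) *
    (ellTheta p (c * q ^ r) * ellTheta p (d * q ^ r) /
    (ellTheta p (c * q ^ (r + 1) / b) * ellTheta p (d * q ^ (r + 1) / b)))) := by
  unfold coefA
  rw [Finset.prod_range_succ, pow_succ]
  ring

theorem coefA_comm (r : ℕ) : coefA p q b c d r = coefA p q b d c r := by
  unfold coefA
  congr 1
  exact Finset.prod_congr rfl fun k _ => by ring

theorem gIn_comm (r : ℕ) : gIn p q b c d r = gIn p q b d c r := by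
  funext y; unfold gIn; ring

theorem gOut_comm (r : ℕ) : gOut p q b c d r = gOut p q b d c r := by
  funext y; unfold gOut; ring

theorem subsetSum_comm : subsetSum p q b c d x S = subsetSum p q b d c x S := by
  unfold subsetSum
  exact Finset.sum_congr rfl fun I _ => by rw [coefA_comm, gIn_comm, gOut_comm]

end Subsets

/-! ### Special values of the subset sum and shifts of its parameters. -/

section Subsets

variable {ι : Type*} [DecidableEq ι] {p q b c d : ℂ} {x : ι → ℂ} {S : Finset ι} {u : ι}

/-- The interaction is invariant under y ↦ 1/(by): inversion swaps the two thetas in the numerator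
and the two in the denominator, and the monomial factors cancel. -/
theorem pairFac_flip (hp : ‖p‖ < 1) (hq : q ≠ 0) (hb : b ≠ 0) {y z : ℂ} (h : b * y * z = 1) :
    pairFac p q b y = pairFac p q b z := by
  have hy : y ≠ 0 := by rintro rfl; simp at h
  have hz : z ≠ 0 := by rintro rfl; simp at h
  unfold pairFac
  rw [ellTheta_of_mul_eq_one hp (x := q * y) (y := b * z / q) (by field_simp; linear_combination h),
    ellTheta_of_mul_eq_one hp (x := b * y / q) (y := q * z) (by field_simp; linear_combination h),
    ellTheta_of_mul_eq_one hp (x := y) (y := b * z) (by linear_combination h),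
    ellTheta_of_mul_eq_one hp (x := b * y) (y := z) h]
  field_simp

/-- Evaluation at the zero `c / b` of the weights of the chosen variables. -/
theorem subsetSum_insert_eval_div (hp : ‖p‖ < 1) (g : Generic p q b c d x S) (hu : u ∉ S)
    (hxu : x u = c / b) :
    subsetSum p q b c d x (insert u S) =
      ellTheta p (q / b) * ellTheta p (q * c / (b * d)) * (ellTheta p c / ellTheta p (q * c / b)) *
        (∏ i ∈ S, ellTheta p (q * x i / c) / ellTheta p (x i / c)) *
        subsetSum p q b (q * c) d x S := by
  obtain ⟨hq, hb, hc, hd, hx, -, -, -, -⟩ := id g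
  rw [subsetSum_insert hu]
  unfold subsetSum
  rw [Finset.mul_sum]
  refine Finset.sum_congr rfl fun J hJ => ?_
  have hJS := Finset.mem_powerset.1 hJ
  set r := J.card
  -- A chosen x u would contribute the factor θ(b x u/c) = θ(1) = 0, so only subsets avoiding u
  -- remain.
  have hzero : gIn p q b c d (r + 1) (x u) = 0 := by
    have : b * x u / c = 1 := by rw [hxu]; field_simp
    simp [gIn, this, ellTheta_one hp]
  rw [hzero]
  -- The interaction of x u with chosen points turns their weights into those for qc; unchosen
  -- weights change by the same function e, which therefore factors out of the sum.
  have hw := subsetWt_mul (p := p) (q := q) (b := b) (x := x) (S := S) (I := J)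
    (gi := gIn p q b c d r) (go := gOut p q b c d r)
    (gi' := gIn p q b (q * c) d r) (go' := gOut p q b (q * c) d r)
    (e := fun y => ellTheta p (q * y / c) / ellTheta p (y / c)) hJS
    (f := fun i => pairFac p q b (x u / x i)) (f' := fun _ => 1) ?_ ?_
  · simp only [Finset.prod_const_one, mul_one] at hw
    -- The scalar factor relating the coefficients for c and qc must not depend on r; the quotient
    -- of thetas at level r is absorbed by the telescoping in `hprod`.
    have hcoef : coefA p q b c d r * gOut p q b c d r (x u) =
        ellTheta p (q / b) * ellTheta p (q * c / (b * d)) *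
          (ellTheta p c / ellTheta p (q * c / b)) * coefA p q b (q * c) d r := by
      have h1 : ellTheta p (q * c / b) ≠ 0 :=
        g.ne0 1 (-1) 1 0 (by field_simp)
      have hk : ∀ k : ℕ, ellTheta p (c * q ^ k / b) ≠ 0 := fun k =>
        g.ne0 k (-1) 1 0 (by field_simp; simp)
      have hk' : ∀ k : ℕ, ellTheta p (d * q ^ k / b) ≠ 0 := fun k =>
        g.ne0 k (-1) 0 1 (by field_simp; simp)
      have hk'' : ellTheta p c ≠ 0 := g.ne0 0 0 1 0 (by simp)
      have hg : gOut p q b c d r (x u) = ellTheta p (q / b) * ellTheta p (q * c / (b * d)) *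
          (ellTheta p (c * q ^ r) / ellTheta p (c * q ^ (r + 1) / b)) := by
        unfold gOut
        rw [hxu, show q * (c / b) / c = q / b by field_simp,
          show q * (c / b) / d = q * c / (b * d) by field_simp,
          show b * q ^ r * (c / b) = c * q ^ r by field_simp,
          show q ^ (r + 1) * (c / b) = c * q ^ (r + 1) / b by field_simp]
        ring
      rw [hg]
      have hprod : ∀ r : ℕ, coefA p q b c d r *
          (ellTheta p (c * q ^ r) / ellTheta p (c * q ^ (r + 1) / b)) =
          (ellTheta p c / ellTheta p (q * c / b)) * coefA p q b (q * c) d r := by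
        intro r
        induction r with
        | zero => simp [coefA, mul_comm]
        | succ r ih =>
          rw [coefA_succ, coefA_succ, show q * c * q ^ r = c * q ^ (r + 1) by ring,
            show q * c * q ^ (r + 1) = c * q ^ (r + 1 + 1) by ring]
          linear_combination (q / b * (ellTheta p (d * q ^ r) / ellTheta p (d * q ^ (r + 1) / b)) *
            (ellTheta p (c * q ^ (r + 1)) / ellTheta p (c * q ^ (r + 1 + 1) / b))) * ih
      linear_combination ellTheta p (q / b) * ellTheta p (q * c / (b * d)) * hprod r
    linear_combination (∏ i ∈ J, pairFac p q b (x u / x i)) *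
      subsetWt p q b (gIn p q b c d r) (gOut p q b c d r) x S J * hcoef +
      ellTheta p (q / b) * ellTheta p (q * c / (b * d)) *
          (ellTheta p c / ellTheta p (q * c / b)) * coefA p q b (q * c) d r * hw
  · intro i hi
    have hi' := hJS hi
    have hxi := hx i hi'
    have h1 : ellTheta p (x i / c) ≠ 0 := g.ne1 hi' 0 0 (-1) 0 (by field_simp)
    have h2 : ellTheta p (b * x i / c) ≠ 0 := g.ne1 hi' 0 1 (-1) 0 (by field_simp)
    rw [hxu, pairFac_flip hp hq hb (z := x i / c) (by field_simp)]
    unfold gIn pairFac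
    rw [show q * (x i / c) = q * x i / c by ring, show b * (x i / c) / q = b * x i / (q * c) by
      field_simp, show b * (x i / c) = b * x i / c by ring]
    field_simp
  · intro i hi
    have hi' := (Finset.mem_sdiff.1 hi).1
    have h1 : ellTheta p (x i / c) ≠ 0 := g.ne1 hi' 0 0 (-1) 0 (by field_simp)
    unfold gOut
    rw [show q * x i / (q * c) = x i / c by field_simp]
    field_simp

/-- Evaluation at the zero `c / q` of the weights of the other variables. -/
theorem subsetSum_insert_eval_div' (hp : ‖p‖ < 1) (g : Generic p q b c d x S) (hu : u ∉ S)
    (hxu : x u = c / q) :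
    subsetSum p q b c d x (insert u S) =
      q / b * ellTheta p (b / q) * ellTheta p (b * c / (q * d)) *
        (ellTheta p d / ellTheta p (q * d / b)) *
        (∏ i ∈ S, ellTheta p (b * x i / c) / ellTheta p (b * q * x i / c)) *
        subsetSum p q b c (q * d) (fun i => q * x i) S := by
  obtain ⟨hq, hb, hc, hd, hx, -, -, -, -⟩ := id g
  rw [subsetSum_insert hu]
  unfold subsetSum
  rw [Finset.mul_sum]
  refine Finset.sum_congr rfl fun J hJ => ?_
  have hJS := Finset.mem_powerset.1 hJ
  set r := J.card
  -- An unchosen x u would contribute θ(q x u/c) = θ(1) = 0, so u must be chosen and the index of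
  -- every weight rises to r + 1.
  have hzero : gOut p q b c d r (x u) = 0 := by
    have : q * x u / c = 1 := by rw [hxu]; field_simp
    simp [gOut, this, ellTheta_one hp]
  rw [hzero]
  -- Interactions depend only on ratios, so scaling all points by q affects the single-variable
  -- weights alone.
  have hscale : subsetWt p q b (gIn p q b c (q * d) r) (gOut p q b c (q * d) r) (fun i => q * x i) S J =
      subsetWt p q b (fun y => gIn p q b c (q * d) r (q * y)) (fun y => gOut p q b c (q * d) r (q * y))
        x S J := by
    unfold subsetWt
    simp only [mul_div_mul_left _ _ hq]
  have hw := subsetWt_mul (p := p) (q := q) (b := b) (x := x) (S := S) (I := J)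
    (gi := gIn p q b c d (r + 1)) (go := gOut p q b c d (r + 1))
    (gi' := fun y => gIn p q b c (q * d) r (q * y)) (go' := fun y => gOut p q b c (q * d) r (q * y))
    (e := fun y => ellTheta p (b * y / c) / ellTheta p (b * q * y / c)) hJS
    (f := fun _ => 1) (f' := fun i => pairFac p q b (x i / x u)) ?_ ?_
  · simp only [Finset.prod_const_one, one_mul] at hw
    have hcoef : coefA p q b c d (r + 1) * gIn p q b c d (r + 1) (x u) =
        q / b * ellTheta p (b / q) * ellTheta p (b * c / (q * d)) *
          (ellTheta p d / ellTheta p (q * d / b)) * coefA p q b c (q * d) r := by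
      have hk : ∀ k : ℕ, ellTheta p (c * q ^ k / b) ≠ 0 := fun k =>
        g.ne0 k (-1) 1 0 (by field_simp; simp)
      have hk'' : ∀ k : ℕ, ellTheta p (c * q ^ k) ≠ 0 := fun k => g.ne0 k 0 1 0 (by simp; ring)
      have hg : gIn p q b c d (r + 1) (x u) = ellTheta p (b / q) * ellTheta p (b * c / (q * d)) *
          (ellTheta p (c * q ^ (r + 1) / b) / ellTheta p (c * q ^ r)) := by
        unfold gIn
        rw [hxu, show b * (c / q) / c = b / q by field_simp,
          show b * (c / q) / d = b * c / (q * d) by field_simp,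
          show q ^ (r + 1 + 1) * (c / q) / b = c * q ^ (r + 1) / b by field_simp; ring,
          show q ^ (r + 1) * (c / q) = c * q ^ r by field_simp; ring]
        ring
      rw [hg]
      have hprod : ∀ r : ℕ, coefA p q b c d r *
          (ellTheta p (d * q ^ r) / ellTheta p (d * q ^ (r + 1) / b)) =
          (ellTheta p d / ellTheta p (q * d / b)) * coefA p q b c (q * d) r := by
        intro r
        induction r with
        | zero => simp [coefA, mul_comm]
        | succ r ih =>
          rw [coefA_succ, coefA_succ, show q * d * q ^ r = d * q ^ (r + 1) by ring,
            show q * d * q ^ (r + 1) = d * q ^ (r + 1 + 1) by ring]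
          linear_combination (q / b * (ellTheta p (c * q ^ r) / ellTheta p (c * q ^ (r + 1) / b)) *
            (ellTheta p (d * q ^ (r + 1)) / ellTheta p (d * q ^ (r + 1 + 1) / b))) * ih
      have e1 : ellTheta p (c * q ^ (r + 1) / b) / ellTheta p (c * q ^ r) *
          (ellTheta p (c * q ^ r) / ellTheta p (c * q ^ (r + 1) / b)) = 1 := by
        have := hk (r + 1)
        have := hk'' r
        field_simp
      rw [coefA_succ]
      linear_combination q / b * ellTheta p (b / q) * ellTheta p (b * c / (q * d)) * hprod r +
        coefA p q b c d r * (ellTheta p (d * q ^ r) / ellTheta p (d * q ^ (r + 1) / b)) *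
        (q / b * ellTheta p (b / q) * ellTheta p (b * c / (q * d))) * e1
    rw [hscale]
    linear_combination (∏ i ∈ S \ J, pairFac p q b (x i / x u)) *
      subsetWt p q b (gIn p q b c d (r + 1)) (gOut p q b c d (r + 1)) x S J * hcoef +
      q / b * ellTheta p (b / q) * ellTheta p (b * c / (q * d)) *
          (ellTheta p d / ellTheta p (q * d / b)) * coefA p q b c (q * d) r * hw
  · intro i hi
    have hi' := hJS hi
    have h2 : ellTheta p (b * q * x i / c) ≠ 0 := g.ne1 hi' 1 1 (-1) 0 (by field_simp)
    unfold gIn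
    rw [show b * (q * x i) / c = b * q * x i / c by ring,
      show b * (q * x i) / (q * d) = b * x i / d by field_simp,
      show q ^ (r + 1) * (q * x i) = q ^ (r + 1 + 1) * x i by ring,
      show q ^ r * (q * x i) = q ^ (r + 1) * x i by ring]
    generalize ellTheta p (b * q * x i / c) = T at h2 ⊢
    field_simp
  · intro i hi
    have hi' := (Finset.mem_sdiff.1 hi).1
    have h1 : ellTheta p (q * x i / c) ≠ 0 := g.ne1 hi' 1 0 (-1) 0 (by field_simp)
    have h2 : ellTheta p (b * q * x i / c) ≠ 0 := g.ne1 hi' 1 1 (-1) 0 (by field_simp)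
    rw [hxu]
    unfold gOut pairFac
    rw [show q * (x i / (c / q)) = q * (q * x i) / c by field_simp,
      show b * (x i / (c / q)) / q = b * x i / c by field_simp,
      show x i / (c / q) = q * x i / c by field_simp,
      show b * (q * x i / c) = b * q * x i / c by field_simp,
      show q * (q * x i) / (q * d) = q * x i / d by field_simp,
      show b * q ^ r * (q * x i) = b * q ^ (r + 1) * x i by ring,
      show q ^ (r + 1) * (q * x i) = q ^ (r + 1 + 1) * x i by ring]
    field_simp

/-- Raising the index of the weights amounts to shifting the parameters. -/
theorem subsetWt_succ (hq : q ≠ 0) (hc : c ≠ 0) (hd : d ≠ 0) (r : ℕ) (J : Finset ι) :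
    subsetWt p q b (gIn p q b c d (r + 1)) (gOut p q b c d (r + 1)) x S J =
      subsetWt p q b (gIn p q b (q * c) (q * d) r) (gOut p q b (q * c) (q * d) r)
        (fun i => q * x i) S J := by
  have h1 : ∀ y, gIn p q b (q * c) (q * d) r (q * y) = gIn p q b c d (r + 1) y := by
    intro y
    unfold gIn
    rw [show b * (q * y) / (q * c) = b * y / c by field_simp,
      show b * (q * y) / (q * d) = b * y / d by field_simp,
      show q ^ (r + 1) * (q * y) = q ^ (r + 1 + 1) * y by ring,
      show q ^ r * (q * y) = q ^ (r + 1) * y by ring]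
  have h2 : ∀ y, gOut p q b (q * c) (q * d) r (q * y) = gOut p q b c d (r + 1) y := by
    intro y
    unfold gOut
    rw [show q * (q * y) / (q * c) = q * y / c by field_simp,
      show q * (q * y) / (q * d) = q * y / d by field_simp,
      show q ^ (r + 1) * (q * y) = q ^ (r + 1 + 1) * y by ring,
      show b * q ^ r * (q * y) = b * q ^ (r + 1) * y by ring]
  unfold subsetWt
  simp only [mul_div_mul_left _ _ hq, h1, h2]

/-- Splitting off the first factor of the product instead of the last leaves the coefficient for qc,
qd, to match `subsetWt_succ`. -/
theorem coefA_succ' (r : ℕ) :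
    coefA p q b c d (r + 1) = q / b * (ellTheta p c * ellTheta p d /
      (ellTheta p (q * c / b) * ellTheta p (q * d / b))) * coefA p q b (q * c) (q * d) r := by
  induction r with
  | zero => rw [coefA_succ]; simp [coefA, mul_comm]
  | succ r ih =>
    rw [coefA_succ, ih, coefA_succ, show q * d * q ^ r = d * q ^ (r + 1) by ring,
            show q * d * q ^ (r + 1) = d * q ^ (r + 1 + 1) by ring,
            show q * c * q ^ r = c * q ^ (r + 1) by ring,
            show q * c * q ^ (r + 1) = c * q ^ (r + 1 + 1) by ring]
    ring

/-- This is the sum left over at a simple pole: one of the two variables that collide up to a factor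
b is chosen, which raises the index by one. -/
theorem sum_coefA_succ (hq : q ≠ 0) (hc : c ≠ 0) (hd : d ≠ 0) :
    ∑ J ∈ S.powerset, coefA p q b c d (J.card + 1) *
        subsetWt p q b (gIn p q b c d (J.card + 1)) (gOut p q b c d (J.card + 1)) x S J =
      q / b * (ellTheta p c * ellTheta p d / (ellTheta p (q * c / b) * ellTheta p (q * d / b))) *
        subsetSum p q b (q * c) (q * d) (fun i => q * x i) S := by
  unfold subsetSum
  rw [Finset.mul_sum]
  refine Finset.sum_congr rfl fun J _ => ?_
  rw [coefA_succ', subsetWt_succ hq hc hd]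
  ring

end Subsets

/-! ### Clearing denominators in one variable. -/

/-- The common denominator of the interaction of `X` and `y`. -/
noncomputable def denPair (p b X y : ℂ) : ℂ :=
  ellTheta p (X / y) * (ellTheta p (X / (b * y)) * ellTheta p (b * X / y))

/-- The numerator over `denPair` of the interaction of a chosen `X` with another `y`. -/
noncomputable def numIn (p q b X y : ℂ) : ℂ :=
  ellTheta p (X / (q * y)) * (ellTheta p (q * X / (b * y)) * ellTheta p (b * X / y))

/-- The numerator over `denPair` of the interaction of an `X` with a chosen `y`. -/
noncomputable def numOut (p q b X y : ℂ) : ℂ :=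
  ellTheta p (q * X / y) * (ellTheta p (b * X / (q * y)) * ellTheta p (X / (b * y)))

/-- After `pairFac_flip` the interaction is a function of X/(by) with denominator θ(X/(by))θ(X/y),
which divides `denPair`. -/
theorem numIn_eq {p q b X y : ℂ} (hp : ‖p‖ < 1) (hq : q ≠ 0) (hb : b ≠ 0) (hX : X ≠ 0) (hy : y ≠ 0)
    (h1 : ellTheta p (X / y) ≠ 0) (h2 : ellTheta p (X / (b * y)) ≠ 0) :
    numIn p q b X y = pairFac p q b (y / X) * denPair p b X y := by
  have h3 : pairFac p q b (y / X) = pairFac p q b (X / (b * y)) :=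
    pairFac_flip hp hq hb (by field_simp)
  rw [h3]
  unfold numIn pairFac denPair
  rw [show q * (X / (b * y)) = q * X / (b * y) by ring,
    show b * (X / (b * y)) / q = X / (q * y) by field_simp,
    show b * (X / (b * y)) = X / y by field_simp]
  generalize ellTheta p (X / y) = T1 at h1 ⊢
  generalize ellTheta p (X / (b * y)) = T2 at h2 ⊢
  field_simp

theorem numOut_eq {p q b X y : ℂ}
    (h1 : ellTheta p (X / y) ≠ 0) (h2 : ellTheta p (b * X / y) ≠ 0) :
    numOut p q b X y = pairFac p q b (X / y) * denPair p b X y := by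
  unfold numOut pairFac denPair
  rw [show q * (X / y) = q * X / y by ring, show b * (X / y) / q = b * X / (q * y) by field_simp,
    show b * (X / y) = b * X / y by ring]
  generalize ellTheta p (X / y) = T1 at h1 ⊢
  generalize ellTheta p (b * X / y) = T2 at h2 ⊢
  field_simp

section Cleared

variable {ι : Type*} [DecidableEq ι]

/-- The product of the denominators `θ(q^k X)`, `1 ≤ k ≤ n`, `k ≠ s`. -/
noncomputable def polesExcept (p q : ℂ) (n s : ℕ) (X : ℂ) : ℂ :=
  ∏ k ∈ (Finset.Icc 1 n).erase s, ellTheta p (q ^ k * X)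

/-- The terms of `subsetSum` with `X` chosen, without denominators depending on `X`. -/
noncomputable def clearedIn (p q b c d : ℂ) (x : ι → ℂ) (S J : Finset ι) (X : ℂ) : ℂ :=
  coefA p q b c d (J.card + 1) *
    subsetWt p q b (gIn p q b c d (J.card + 1)) (gOut p q b c d (J.card + 1)) x S J *
    (polesExcept p q (S.card + 1) (J.card + 1) X *
    (ellTheta p (b * X / c) * (ellTheta p (b * X / d) * ellTheta p (q ^ (J.card + 1 + 1) * X / b))) *
    ((∏ l ∈ S \ J, numIn p q b X (x l)) * ∏ l ∈ J, denPair p b X (x l)))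

/-- The terms of `subsetSum` with `X` not chosen, without denominators depending on `X`. -/
noncomputable def clearedOut (p q b c d : ℂ) (x : ι → ℂ) (S J : Finset ι) (X : ℂ) : ℂ :=
  coefA p q b c d J.card *
    subsetWt p q b (gIn p q b c d J.card) (gOut p q b c d J.card) x S J *
    (polesExcept p q (S.card + 1) (J.card + 1) X *
    (ellTheta p (q * X / c) * (ellTheta p (q * X / d) * ellTheta p (b * q ^ J.card * X))) *
    ((∏ l ∈ S \ J, denPair p b X (x l)) * ∏ l ∈ J, numOut p q b X (x l)))

/-- The variable point is replaced by a free argument X and every denominator involving X is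
removed, so the result is holomorphic off 0 even at the former poles. -/
noncomputable def clearedSum (p q b c d : ℂ) (x : ι → ℂ) (S : Finset ι) (X : ℂ) : ℂ :=
  ∑ J ∈ S.powerset, (clearedOut p q b c d x S J X + clearedIn p q b c d x S J X)

variable {p q b c d : ℂ} {x : ι → ℂ} {S : Finset ι} {u : ι}

theorem polesExcept_mul {n s : ℕ} (hs : s ∈ Finset.Icc 1 n) (X : ℂ) :
    polesExcept p q n s X * ellTheta p (q ^ s * X) =
      ∏ k ∈ Finset.Icc 1 n, ellTheta p (q ^ k * X) := by
  unfold polesExcept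
  exact Finset.prod_erase_mul _ _ hs

theorem isTheta_mul_div (hp : ‖p‖ < 1) {a e : ℂ} (ha : a ≠ 0) (he : e ≠ 0) :
    IsTheta p 1 (e / a) fun X => ellTheta p (a * X / e) :=
  ((IsTheta.theta hp (div_ne_zero ha he)).cast rfl (inv_div a e)).congr fun x _ => by
    rw [div_mul_eq_mul_div]

theorem isTheta_denPair (hp : ‖p‖ < 1) (hb : b ≠ 0) {y : ℂ} (hy : y ≠ 0) :
    IsTheta p 3 (y ^ 3) fun X => denPair p b X y :=
  ((IsTheta.theta_div hp hy).mul ((IsTheta.theta_div hp (mul_ne_zero hb hy)).mul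
    (isTheta_mul_div hp hb hy))).cast rfl (by field_simp)

theorem isTheta_numIn (hp : ‖p‖ < 1) (hq : q ≠ 0) (hb : b ≠ 0) {y : ℂ} (hy : y ≠ 0) :
    IsTheta p 3 (y ^ 3) fun X => numIn p q b X y :=
  ((IsTheta.theta_div hp (mul_ne_zero hq hy)).mul ((isTheta_mul_div hp hq (mul_ne_zero hb hy)).mul
    (isTheta_mul_div hp hb hy))).cast rfl (by field_simp)

theorem isTheta_numOut (hp : ‖p‖ < 1) (hq : q ≠ 0) (hb : b ≠ 0) {y : ℂ} (hy : y ≠ 0) :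
    IsTheta p 3 (y ^ 3) fun X => numOut p q b X y :=
  ((isTheta_mul_div hp hq hy).mul ((isTheta_mul_div hp hb (mul_ne_zero hq hy)).mul
    (IsTheta.theta_div hp (mul_ne_zero hb hy)))).cast rfl (by field_simp)

theorem isTheta_polesExcept (hp : ‖p‖ < 1) (hq : q ≠ 0) {n s : ℕ} (hs : s ∈ Finset.Icc 1 n) :
    IsTheta p (n - 1) ((∏ k ∈ Finset.Icc 1 n, (q ^ k)⁻¹) * q ^ s) (polesExcept p q n s) := by
  refine (IsTheta.prod ((Finset.Icc 1 n).erase s) (M := fun _ => 1) (t := fun k => (q ^ k)⁻¹)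
    (f := fun k X => ellTheta p (q ^ k * X)) fun k _ =>
    IsTheta.theta hp (pow_ne_zero _ hq)).cast ?_ ?_
  · simp [Finset.card_erase_of_mem hs]
  · rw [← Finset.prod_erase_mul _ _ hs, mul_assoc, inv_mul_cancel₀ (pow_ne_zero _ hq), mul_one]

theorem card_succ_mem_Icc {J : Finset ι} (hJ : J ⊆ S) : J.card + 1 ∈ Finset.Icc 1 (S.card + 1) := by
  have := Finset.card_le_card hJ
  simp [this]

/-- With n = |S|, each term has n thetas from `polesExcept`, three from the weight of X and three
per interaction, so degree 4n + 3. The powers of q depending on |J| cancel between the omitted pole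
and the weight of X, so all terms share one norm. -/
theorem isTheta_clearedSum (hp : ‖p‖ < 1) (g : Generic p q b c d x S) :
    IsTheta p (4 * S.card + 3)
      (c * d / (q * b) * (∏ l ∈ S, x l ^ 3) * ∏ k ∈ Finset.Icc 1 (S.card + 1), (q ^ k)⁻¹)
      (clearedSum p q b c d x S) := by
  obtain ⟨hq, hb, hc, hd, hx, -, -, -, -⟩ := id g
  refine IsTheta.sum _ fun J hJ => ?_
  have hJS := Finset.mem_powerset.1 hJ
  have hcard : ∑ l ∈ S \ J, 3 + ∑ l ∈ J, 3 = 3 * S.card := by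
    rw [Finset.sum_sdiff hJS]; simp [mul_comm]
  have hprod := Finset.prod_sdiff hJS (f := fun l => x l ^ 3)
  refine IsTheta.add ?_ ?_
  · refine (IsTheta.const_mul _ (((isTheta_polesExcept hp hq (card_succ_mem_Icc hJS)).mul
      ((isTheta_mul_div hp hq hc).mul ((isTheta_mul_div hp hq hd).mul
        (IsTheta.theta hp (mul_ne_zero hb (pow_ne_zero _ hq)))))).mul
      ((IsTheta.prod _ fun l hl => isTheta_denPair hp hb (hx l (Finset.mem_sdiff.1 hl).1)).mul
      (IsTheta.prod _ fun l hl => isTheta_numOut hp hq hb (hx l (hJS hl)))))).cast ?_ ?_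
    · rw [hcard]; omega
    · rw [hprod]; field_simp; ring
  · refine (IsTheta.const_mul _ (((isTheta_polesExcept hp hq (card_succ_mem_Icc hJS)).mul
      ((isTheta_mul_div hp hb hc).mul ((isTheta_mul_div hp hb hd).mul
        (isTheta_mul_div hp (pow_ne_zero _ hq) hb)))).mul
      ((IsTheta.prod _ fun l hl => isTheta_numIn hp hq hb (hx l (Finset.mem_sdiff.1 hl).1)).mul
      (IsTheta.prod _ fun l hl => isTheta_denPair hp hb (hx l (hJS hl)))))).cast ?_ ?_
    · rw [hcard]; omega
    · rw [hprod]; field_simp; ring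

theorem prod_numIn (hp : ‖p‖ < 1) (hq : q ≠ 0) (hb : b ≠ 0) {X : ℂ} (hX : X ≠ 0) {T : Finset ι}
    (hx : ∀ l ∈ T, x l ≠ 0)
    (h1 : ∀ l ∈ T, ellTheta p (X / x l) ≠ 0) (h2 : ∀ l ∈ T, ellTheta p (X / (b * x l)) ≠ 0) :
    ∏ l ∈ T, numIn p q b X (x l) =
      (∏ l ∈ T, pairFac p q b (x l / X)) * ∏ l ∈ T, denPair p b X (x l) := by
  rw [← Finset.prod_mul_distrib]
  exact Finset.prod_congr rfl fun l hl => numIn_eq hp hq hb hX (hx l hl) (h1 l hl) (h2 l hl)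

theorem prod_numOut {X : ℂ} {T : Finset ι}
    (h1 : ∀ l ∈ T, ellTheta p (X / x l) ≠ 0) (h2 : ∀ l ∈ T, ellTheta p (b * X / x l) ≠ 0) :
    ∏ l ∈ T, numOut p q b X (x l) =
      (∏ l ∈ T, pairFac p q b (X / x l)) * ∏ l ∈ T, denPair p b X (x l) := by
  rw [← Finset.prod_mul_distrib]
  exact Finset.prod_congr rfl fun l hl => numOut_eq (h1 l hl) (h2 l hl)

/-- The cleared sum is the sum over all subsets times its denominators. -/
theorem clearedSum_eq (hp : ‖p‖ < 1) (hq : q ≠ 0) (hb : b ≠ 0) (hu : u ∉ S) (hxu : x u ≠ 0)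
    (hx : ∀ l ∈ S, x l ≠ 0)
    (h1 : ∀ l ∈ S, ellTheta p (x u / x l) ≠ 0) (h2 : ∀ l ∈ S, ellTheta p (x u / (b * x l)) ≠ 0)
    (h3 : ∀ l ∈ S, ellTheta p (b * x u / x l) ≠ 0)
    (h4 : ∀ k ∈ Finset.Icc 1 (S.card + 1), ellTheta p (q ^ k * x u) ≠ 0) :
    clearedSum p q b c d x S (x u) = subsetSum p q b c d x (insert u S) *
      ((∏ l ∈ S, denPair p b (x u) (x l)) *
        ∏ k ∈ Finset.Icc 1 (S.card + 1), ellTheta p (q ^ k * x u)) := by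
  rw [subsetSum_insert hu, clearedSum, Finset.sum_mul]
  refine Finset.sum_congr rfl fun J hJ => ?_
  have hJS := Finset.mem_powerset.1 hJ
  have hs : ∀ l ∈ S \ J, l ∈ S := fun l hl => (Finset.mem_sdiff.1 hl).1
  have hmem := card_succ_mem_Icc hJS
  have hne := h4 _ hmem
  rw [← Finset.prod_sdiff hJS, ← polesExcept_mul hmem, clearedIn, clearedOut,
    prod_numIn hp hq hb hxu (fun l hl => hx l (hs l hl)) (fun l hl => h1 l (hs l hl))
      (fun l hl => h2 l (hs l hl)),
    prod_numOut (fun l hl => h1 l (hJS hl)) (fun l hl => h3 l (hJS hl))]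
  rw [gIn, gOut]
  generalize ellTheta p (q ^ (J.card + 1) * x u) = T at hne ⊢
  field_simp

theorem clearedSum_congr {y : ι → ℂ} (h : ∀ i ∈ S, x i = y i) (X : ℂ) :
    clearedSum p q b c d x S X = clearedSum p q b c d y S X := by
  refine Finset.sum_congr rfl fun J hJ => ?_
  have hJS := Finset.mem_powerset.1 hJ
  have hs : ∀ l ∈ S \ J, x l = y l := fun l hl => h l (Finset.mem_sdiff.1 hl).1
  have e1 : ∀ f : ℂ → ℂ, ∏ l ∈ S \ J, f (x l) = ∏ l ∈ S \ J, f (y l) := fun f =>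
    Finset.prod_congr rfl fun l hl => by rw [hs l hl]
  have e2 : ∀ f : ℂ → ℂ, ∏ l ∈ J, f (x l) = ∏ l ∈ J, f (y l) := fun f =>
    Finset.prod_congr rfl fun l hl => by rw [h l (hJS hl)]
  unfold clearedIn clearedOut
  rw [subsetWt_congr hJS h, subsetWt_congr hJS h, e1, e1, e2 (numOut p q b X), e2 (denPair p b X)]

/-- The cleared sum vanishes at the points `q^(-s)`. -/
theorem clearedSum_eval_qpow (hp : ‖p‖ < 1) (g : Generic p q b c d x S) {s : ℕ}
    (hs : s ∈ Finset.Icc 1 (S.card + 1)) : clearedSum p q b c d x S (q ^ s)⁻¹ = 0 := by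
  obtain ⟨hq, hb, hc, hd, hx, -, -, -, -⟩ := id g
  set X := (q ^ s)⁻¹ with hX
  have hX0 : X ≠ 0 := inv_ne_zero (pow_ne_zero _ hq)
  refine Finset.sum_eq_zero fun J hJ => ?_
  have hJS := Finset.mem_powerset.1 hJ
  have hsd : ∀ l ∈ S \ J, l ∈ S := fun l hl => (Finset.mem_sdiff.1 hl).1
  -- At X = q^(-s) the factor `polesExcept` kills every J except those of cardinality s - 1. For
  -- these, the terms with X chosen and with X unchosen cancel.
  by_cases hJs : s = J.card + 1
  · have h1 : ∀ l ∈ S, ellTheta p (X / x l) ≠ 0 := fun l hl => by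
      have := hx l hl
      rw [ellTheta_of_mul_eq_one hp (y := q ^ s * x l) (by rw [hX]; field_simp)]
      exact mul_ne_zero (by simp [hX0, this]) (g.ne1 hl s 0 0 0 (by simp))
    have h2 : ∀ l ∈ S, ellTheta p (X / (b * x l)) ≠ 0 := fun l hl => by
      have := hx l hl
      rw [ellTheta_of_mul_eq_one hp (y := b * q ^ s * x l) (by rw [hX]; field_simp)]
      exact mul_ne_zero (by simp [hX0, this, hb]) (g.ne1_nat hl s 1 0 0 (by simp only [zpow_one, zpow_zero]; ring))
    have h3 : ∀ l ∈ S, ellTheta p (b * X / x l) ≠ 0 := fun l hl => by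
      have := hx l hl
      rw [ellTheta_of_mul_eq_one hp (y := q ^ s * x l / b) (by rw [hX]; field_simp)]
      exact mul_ne_zero (by simp [hX0, this, hb]) (g.ne1 hl s (-1) 0 0 (by field_simp <;> try simp))
    rw [clearedIn, clearedOut,
      prod_numIn hp hq hb hX0 (fun l hl => hx l (hsd l hl)) (fun l hl => h1 l (hsd l hl))
        (fun l hl => h2 l (hsd l hl)),
      prod_numOut (fun l hl => h1 l (hJS hl)) (fun l hl => h3 l (hJS hl))]
    set r := J.card
    -- At this X, the interaction with X moves each weight between the indices r and r + 1.
    have hw : (∏ l ∈ J, pairFac p q b (X / x l)) *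
        subsetWt p q b (gIn p q b c d r) (gOut p q b c d r) x S J =
        (∏ l ∈ S \ J, pairFac p q b (x l / X)) *
        subsetWt p q b (gIn p q b c d (r + 1)) (gOut p q b c d (r + 1)) x S J := by
      have hA := subsetWt_mul (p := p) (q := q) (b := b) (x := x) (S := S) (I := J)
        (gi := gIn p q b c d r) (go := gOut p q b c d r)
        (gi' := gIn p q b c d (r + 1)) (go' := fun y => gOut p q b c d (r + 1) y *
          pairFac p q b (y / X)) (e := fun y => 1) hJS
        (f := fun i => pairFac p q b (X / x i)) (f' := fun _ => 1) ?_ ?_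
      · rw [Finset.prod_const_one, Finset.prod_const_one, mul_one, one_mul] at hA
        rw [hA]
        unfold subsetWt
        rw [Finset.prod_mul_distrib]
        ring
      · intro i hi
        have hi' := hJS hi
        have hxi := hx i hi'
        have e1 : ellTheta p (q ^ r * x i) ≠ 0 := g.ne1 hi' r 0 0 0 (by simp)
        have e2 : ellTheta p (q ^ (r + 1) * x i) ≠ 0 := g.ne1_nat hi' (r + 1) 0 0 0 (by simp)
        have e3 : ellTheta p (q ^ (r + 1) * x i / b) ≠ 0 :=
          g.ne1_nat hi' (r + 1) (-1) 0 0 (by simp only [zpow_neg, zpow_one, zpow_zero]; field_simp)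
        rw [pairFac_flip hp hq hb (z := x i * q ^ s / b) (by rw [hX]; field_simp)]
        unfold gIn pairFac
        rw [hJs, show q * (x i * q ^ (r + 1) / b) = q ^ (r + 1 + 1) * x i / b by ring,
          show b * (x i * q ^ (r + 1) / b) / q = q ^ r * x i by field_simp; ring,
          show x i * q ^ (r + 1) / b = q ^ (r + 1) * x i / b by ring,
          show b * (q ^ (r + 1) * x i / b) = q ^ (r + 1) * x i by field_simp]
        generalize ellTheta p (q ^ r * x i) = T1 at e1 ⊢
        generalize ellTheta p (q ^ (r + 1) * x i) = T2 at e2 ⊢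
        generalize ellTheta p (q ^ (r + 1) * x i / b) = T3 at e3 ⊢
        field_simp
      · intro i hi
        have hi' := (Finset.mem_sdiff.1 hi).1
        have e2 : ellTheta p (q ^ (r + 1) * x i) ≠ 0 := g.ne1_nat hi' (r + 1) 0 0 0 (by simp)
        have e4 : ellTheta p (q ^ (r + 1 + 1) * x i) ≠ 0 :=
          g.ne1_nat hi' (r + 1 + 1) 0 0 0 (by simp)
        have e3 : ellTheta p (b * q ^ (r + 1) * x i) ≠ 0 :=
          g.ne1_nat hi' (r + 1) 1 0 0 (by simp only [zpow_one, zpow_zero]; ring)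
        unfold gOut pairFac
        rw [hX, hJs, show x i / (q ^ (r + 1))⁻¹ = q ^ (r + 1) * x i by field_simp,
          show q * (q ^ (r + 1) * x i) = q ^ (r + 1 + 1) * x i by ring,
          show b * (q ^ (r + 1) * x i) / q = b * q ^ r * x i by field_simp; ring,
          show b * (q ^ (r + 1) * x i) = b * q ^ (r + 1) * x i by ring]
        generalize ellTheta p (q ^ (r + 1 + 1) * x i) = T1 at e4 ⊢
        generalize ellTheta p (q ^ (r + 1) * x i) = T2 at e2 ⊢
        generalize ellTheta p (b * q ^ (r + 1) * x i) = T3 at e3 ⊢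
        field_simp
    -- The remaining scalars are opposite: inverting the five thetas that do not match produces an
    -- overall minus sign.
    have hsc : coefA p q b c d (r + 1) * (ellTheta p (b * X / c) * (ellTheta p (b * X / d) *
          ellTheta p (q ^ (r + 1 + 1) * X / b))) =
        -(coefA p q b c d r * (ellTheta p (q * X / c) * (ellTheta p (q * X / d) *
          ellTheta p (b * q ^ r * X)))) := by
      have e1 : ellTheta p (c * q ^ (r + 1) / b) ≠ 0 :=
        g.ne0_nat (r + 1) (-1) 1 0 (by simp only [zpow_neg, zpow_one, zpow_zero]; field_simp)
      have e2 : ellTheta p (d * q ^ (r + 1) / b) ≠ 0 :=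
        g.ne0_nat (r + 1) (-1) 0 1 (by simp only [zpow_neg, zpow_one, zpow_zero]; field_simp)
      rw [coefA_succ, ellTheta_of_mul_eq_one hp (x := b * X / c) (y := c * q ^ (r + 1) / b)
          (by rw [hX, hJs]; field_simp),
        ellTheta_of_mul_eq_one hp (x := b * X / d) (y := d * q ^ (r + 1) / b)
          (by rw [hX, hJs]; field_simp),
        ellTheta_of_mul_eq_one hp (x := q * X / c) (y := c * q ^ r)
          (by rw [hX, hJs]; field_simp; ring),
        ellTheta_of_mul_eq_one hp (x := q * X / d) (y := d * q ^ r)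
          (by rw [hX, hJs]; field_simp; ring),
        ellTheta_of_mul_eq_one hp (x := b * q ^ r * X) (y := q ^ (r + 1 + 1) * X / b)
          (by rw [hX, hJs]; field_simp; ring)]
      generalize ellTheta p (c * q ^ (r + 1) / b) = T1 at e1 ⊢
      generalize ellTheta p (d * q ^ (r + 1) / b) = T2 at e2 ⊢
      generalize ellTheta p (q ^ (r + 1 + 1) * X / b) = T3
      rw [hX, hJs]
      field_simp
      ring
    linear_combination (∏ l ∈ S \ J, pairFac p q b (x l / X)) *
      subsetWt p q b (gIn p q b c d (r + 1)) (gOut p q b c d (r + 1)) x S J *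
      (∏ l ∈ S \ J, denPair p b X (x l)) * (∏ l ∈ J, denPair p b X (x l)) *
      polesExcept p q (S.card + 1) (r + 1) X * hsc +
      coefA p q b c d r * (ellTheta p (q * X / c) * (ellTheta p (q * X / d) *
          ellTheta p (b * q ^ r * X))) *
      (∏ l ∈ S \ J, denPair p b X (x l)) * (∏ l ∈ J, denPair p b X (x l)) *
      polesExcept p q (S.card + 1) (r + 1) X * hw
  · have h0 : polesExcept p q (S.card + 1) (J.card + 1) X = 0 := by
      refine Finset.prod_eq_zero (Finset.mem_erase.2 ⟨hJs, hs⟩) ?_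
      rw [hX, mul_inv_cancel₀ (pow_ne_zero _ hq), ellTheta_one hp]
    simp [clearedIn, clearedOut, h0]

end Cleared

/-! ### Removable and simple poles of the subset sum. -/

section Residues

variable {ι : Type*} [DecidableEq ι] {p q b c d : ℂ} {x : ι → ℂ} {S : Finset ι} {u : ι}

theorem denPair_self (hp : ‖p‖ < 1) {y : ℂ} (hy : y ≠ 0) : denPair p b y y = 0 := by
  simp [denPair, div_self hy, ellTheta_one hp]

/-- The cleared sum vanishes at the other variables. -/
theorem clearedSum_eval_self (hp : ‖p‖ < 1) (g : Generic p q b c d x (insert u S)) (hu : u ∉ S) :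
    clearedSum p q b c d x (insert u S) (x u) = 0 := by
  obtain ⟨hq, hb, hc, hd, hx, -, -, -, -⟩ := id g
  have huS : u ∈ insert u S := by simp
  have hS : ∀ l ∈ S, l ∈ insert u S := fun l hl => by simp [hl]
  have hX0 := hx u huS
  unfold clearedSum
  rw [Finset.sum_powerset_insert hu, ← Finset.sum_add_distrib]
  refine Finset.sum_eq_zero fun K hK => ?_
  have hKS := Finset.mem_powerset.1 hK
  have huK : u ∉ K := fun h => hu (hKS h)
  have hsd : ∀ l ∈ S \ K, l ∈ S := fun l hl => (Finset.mem_sdiff.1 hl).1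
  have huSK : u ∉ S \ K := fun h => hu (hsd u h)
  have hins : insert u S \ insert u K = S \ K := by
    rw [Finset.insert_sdiff_insert]
    exact Finset.sdiff_insert_of_notMem hu K
  have h1 : ∀ l ∈ S, ellTheta p (x u / x l) ≠ 0 := fun l hl =>
    g.distinct u huS l (hS l hl) fun h => hu (h ▸ hl)
  have h2 : ∀ l ∈ S, ellTheta p (x u / (b * x l)) ≠ 0 := fun l hl =>
    g.ne2 huS (hS l hl) 0 (-1) (by
      have := hx l (hS l hl)
      simp only [zpow_neg, zpow_one, zpow_zero]; field_simp)
  have h3 : ∀ l ∈ S, ellTheta p (b * x u / x l) ≠ 0 := fun l hl =>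
    g.ne2 huS (hS l hl) 0 1 (by simp only [zpow_one, zpow_zero]; ring)
  -- At X = x u the factor θ(X/x u) in `denPair` removes the terms where both or neither of the
  -- equal points are chosen.
  have e1 : clearedOut p q b c d x (insert u S) K (x u) = 0 := by
    unfold clearedOut
    rw [Finset.insert_sdiff_of_notMem _ huK, Finset.prod_insert huSK, denPair_self hp hX0]
    ring
  have e2 : clearedIn p q b c d x (insert u S) (insert u K) (x u) = 0 := by
    unfold clearedIn
    rw [Finset.prod_insert huK, denPair_self hp hX0]
    ring
  -- The remaining two terms choose exactly one of the equal points. Exchanging these points maps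
  -- one term to the other with the opposite sign.
  have e3 : clearedIn p q b c d x (insert u S) K (x u) +
      clearedOut p q b c d x (insert u S) (insert u K) (x u) = 0 := by
    unfold clearedIn clearedOut
    rw [subsetWt_insert_out hu hKS, subsetWt_insert_in hu hKS, hins,
      Finset.insert_sdiff_of_notMem _ huK, Finset.prod_insert huSK, Finset.prod_insert huK,
      Finset.card_insert_of_notMem huK, Finset.card_insert_of_notMem hu,
      prod_numIn hp hq hb hX0 (fun l hl => hx l (hS l (hsd l hl))) (fun l hl => h1 l (hsd l hl))
        (fun l hl => h2 l (hsd l hl)),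
      prod_numOut (fun l hl => h1 l (hKS hl)) (fun l hl => h3 l (hKS hl))]
    set s := K.card + 1
    have hs1 : s ∈ Finset.Icc 1 (S.card + 1 + 1) := by
      have := Finset.card_le_card hKS
      simp only [Finset.mem_Icc]; omega
    have hs2 : s + 1 ∈ Finset.Icc 1 (S.card + 1 + 1) := by
      have := Finset.card_le_card hKS
      simp only [Finset.mem_Icc]; omega
    have f1 := polesExcept_mul (p := p) (q := q) hs1 (x u)
    have f2 := polesExcept_mul (p := p) (q := q) hs2 (x u)
    have g1 : ellTheta p (q ^ s * x u) ≠ 0 := g.ne1_nat huS s 0 0 0 (by simp)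
    have g2 : ellTheta p (q ^ (s + 1) * x u) ≠ 0 := g.ne1_nat huS (s + 1) 0 0 0 (by simp)
    -- The sign comes from inverting three thetas whose monomial prefactors multiply to -1.
    have hnum : numIn p q b (x u) (x u) = -numOut p q b (x u) (x u) := by
      unfold numIn numOut
      rw [ellTheta_of_mul_eq_one hp (x := x u / (q * x u)) (y := q * x u / x u) (by field_simp),
        ellTheta_of_mul_eq_one hp (x := q * x u / (b * x u)) (y := b * x u / (q * x u))
          (by field_simp),
        ellTheta_of_mul_eq_one hp (x := b * x u / x u) (y := x u / (b * x u)) (by field_simp)]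
      field_simp
    rw [gIn, gOut, hnum]
    have f3 : polesExcept p q (S.card + 1 + 1) s (x u) / ellTheta p (q ^ (s + 1) * x u) =
        polesExcept p q (S.card + 1 + 1) (s + 1) (x u) / ellTheta p (q ^ s * x u) := by
      rw [div_eq_div_iff g2 g1, f1, f2]
    rw [div_eq_mul_inv] at f3
    rw [div_eq_mul_inv] at f3
    linear_combination -(coefA p q b c d s * (ellTheta p (q * x u / c) * ellTheta p (q * x u / d) *
      ellTheta p (b * q ^ s * x u)) * (∏ i ∈ K, pairFac p q b (x u / x i)) *
      subsetWt p q b (gIn p q b c d s) (gOut p q b c d s) x S K *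
      (ellTheta p (b * x u / c) * ellTheta p (b * x u / d) * ellTheta p (q ^ (s + 1) * x u / b)) *
      numOut p q b (x u) (x u) * (∏ l ∈ S \ K, pairFac p q b (x l / x u)) *
      (∏ l ∈ S \ K, denPair p b (x u) (x l)) * (∏ l ∈ K, denPair p b (x u) (x l))) * f3
  linear_combination e1 + e2 + e3

/-- The sum over all subsets with its removable denominators cancelled. -/
theorem exists_reducedSum (hp : ‖p‖ < 1) (g : Generic p q b c d x S) :
    ∃ h, IsTheta p (2 * S.card + 2) (c * d / (q * b) * ∏ l ∈ S, x l ^ 2) h ∧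
      ∀ X, X ≠ 0 → clearedSum p q b c d x S X = (∏ l ∈ S, ellTheta p (X / x l)) *
        ((∏ k ∈ Finset.Icc 1 (S.card + 1), ellTheta p (q ^ k * X)) * h X) := by
  obtain ⟨hq, hb, hc, hd, hx, -, -, -, -⟩ := id g
  -- Division by n thetas for the x l and then n + 1 thetas for the q^(-k) lowers the degree from 4n
  -- + 3 to 2n + 2.
  obtain ⟨h1, ht1, he1⟩ := ((isTheta_clearedSum hp g).cast
    (show _ = (3 * S.card + 3) + S.card by ring) rfl).exists_eq_prod_mul hp S x hx g.distinct
      (fun i hi => by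
        obtain ⟨T, hT, rfl⟩ : ∃ T, i ∉ T ∧ insert i T = S :=
          ⟨S.erase i, by simp, Finset.insert_erase hi⟩
        exact clearedSum_eval_self hp g hT)
  have hcard : (Finset.Icc 1 (S.card + 1)).card = S.card + 1 := by simp
  obtain ⟨h2, ht2, he2⟩ := (ht1.cast
    (show _ = (2 * S.card + 2) + (Finset.Icc 1 (S.card + 1)).card by rw [hcard]; ring)
    rfl).exists_eq_prod_mul hp (Finset.Icc 1 (S.card + 1)) (fun k => (q ^ k)⁻¹)
      (fun k _ => inv_ne_zero (pow_ne_zero _ hq))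
      (fun i _ j _ hij => g.ne0 (j - i) 0 0 0 (by
          rw [zpow_sub₀ hq]; simp only [zpow_natCast, zpow_zero]; field_simp)
          (Or.inl (by simpa [sub_eq_zero] using fun h => hij h.symm)))
      (fun k hk => by
        have hX0 : (q ^ k)⁻¹ ≠ 0 := inv_ne_zero (pow_ne_zero _ hq)
        have := he1 _ hX0
        rw [clearedSum_eval_qpow hp g hk] at this
        refine (mul_eq_zero.1 this.symm).resolve_left (Finset.prod_ne_zero_iff.2 fun l hl => ?_)
        have := hx l hl
        rw [ellTheta_of_mul_eq_one hp (y := q ^ k * x l) (by field_simp)]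
        exact mul_ne_zero (by simp [this, hq]) (g.ne1_nat hl k 0 0 0 (by simp)))
  refine ⟨h2, ht2.cast rfl ?_, fun X hX => ?_⟩
  · have : ∏ l ∈ S, x l ^ 3 = (∏ l ∈ S, x l ^ 2) * ∏ l ∈ S, x l := by
      rw [← Finset.prod_mul_distrib]; exact Finset.prod_congr rfl fun l _ => by ring
    have hx0 : ∏ l ∈ S, x l ≠ 0 := Finset.prod_ne_zero_iff.2 hx
    have hq0 : ∏ k ∈ Finset.Icc 1 (S.card + 1), (q ^ k)⁻¹ ≠ 0 :=
      Finset.prod_ne_zero_iff.2 fun k _ => inv_ne_zero (pow_ne_zero _ hq)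
    rw [this]
    generalize ∏ k ∈ Finset.Icc 1 (S.card + 1), (q ^ k)⁻¹ = T at hq0 ⊢
    field_simp
  · rw [he1 X hX, he2 X hX]
    congr 2
    refine Finset.prod_congr rfl fun k _ => ?_
    rw [div_inv_eq_mul, mul_comm]

/-- The residue factor common to both kinds of simple poles. -/
noncomputable def resFac (p q b c d : ℂ) (X : ℂ) : ℂ :=
  ellTheta p (b ^ 2 * X / c) * ellTheta p (b ^ 2 * X / d) *
    (ellTheta p (q * X / c) * ellTheta p (q * X / d))

/-- When a chosen and an unchosen point have ratio b, the factors depending on r cancel in the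
product of their weights. Hence the residue at a simple pole factors out of the sum over subsets. -/
theorem gIn_mul_gOut {r : ℕ} {X : ℂ} (hb : b ≠ 0) (h1 : ellTheta p (b * q ^ r * X) ≠ 0)
    (h2 : ellTheta p (q ^ (r + 1) * X) ≠ 0) :
    gIn p q b c d r (b * X) * gOut p q b c d r X = resFac p q b c d X := by
  unfold gIn gOut resFac
  rw [show q ^ (r + 1) * (b * X) / b = q ^ (r + 1) * X by field_simp,
    show q ^ r * (b * X) = b * q ^ r * X by ring, show b * (b * X) / c = b ^ 2 * X / c by ring,
    show b * (b * X) / d = b ^ 2 * X / d by ring]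
  generalize ellTheta p (b * q ^ r * X) = T1 at h1 ⊢
  generalize ellTheta p (q ^ (r + 1) * X) = T2 at h2 ⊢
  field_simp

/-- The value of the cleared sum at `b` times another variable. -/
theorem clearedSum_eval_mul (hp : ‖p‖ < 1) (g : Generic p q b c d x (insert u S)) (hu : u ∉ S) :
    clearedSum p q b c d x (insert u S) (b * x u) =
      (∏ k ∈ Finset.Icc 1 (S.card + 1 + 1), ellTheta p (q ^ k * (b * x u))) *
      (numIn p q b (b * x u) (x u) * resFac p q b c d (x u) *
      ((∏ l ∈ S, pairFac p q b (x u / x l)) * ∏ l ∈ S, denPair p b (b * x u) (x l)) *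
      (q / b * (ellTheta p c * ellTheta p d / (ellTheta p (q * c / b) * ellTheta p (q * d / b))) *
        subsetSum p q b (q * c) (q * d) (fun i => q * x i) S)) := by
  obtain ⟨hq, hb, hc, hd, hx, -, -, -, -⟩ := id g
  have huS : u ∈ insert u S := by simp
  have hS : ∀ l ∈ S, l ∈ insert u S := fun l hl => by simp [hl]
  have hx0 := hx u huS
  have hX0 : b * x u ≠ 0 := mul_ne_zero hb hx0
  rw [← sum_coefA_succ hq hc hd]
  unfold clearedSum
  rw [Finset.sum_powerset_insert hu, ← Finset.sum_add_distrib, Finset.mul_sum, Finset.mul_sum]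
  refine Finset.sum_congr rfl fun K hK => ?_
  have hKS := Finset.mem_powerset.1 hK
  have huK : u ∉ K := fun h => hu (hKS h)
  have hsd : ∀ l ∈ S \ K, l ∈ S := fun l hl => (Finset.mem_sdiff.1 hl).1
  have huSK : u ∉ S \ K := fun h => hu (hsd u h)
  have h1 : ∀ l ∈ S, ellTheta p (b * x u / x l) ≠ 0 := fun l hl =>
    g.ne2 huS (hS l hl) 0 1 (by simp only [zpow_one, zpow_zero]; ring)
  have h2 : ∀ l ∈ S, ellTheta p (b * x u / (b * x l)) ≠ 0 := fun l hl => by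
    rw [mul_div_mul_left _ _ hb]
    exact g.distinct u huS l (hS l hl) fun h => hu (h ▸ hl)
  have hone : b * x u / (b * x u) = 1 := div_self hX0
  have hden : denPair p b (b * x u) (x u) = 0 := by
    simp [denPair, hone, ellTheta_one hp]
  have hnum : numOut p q b (b * x u) (x u) = 0 := by
    simp [numOut, hone, ellTheta_one hp]
  -- At X = b x u only terms with X chosen and x u unchosen survive: `denPair` kills equal status
  -- and `numOut` kills the opposite one.
  have e1 : clearedOut p q b c d x (insert u S) K (b * x u) = 0 := by
    unfold clearedOut
    rw [Finset.insert_sdiff_of_notMem _ huK, Finset.prod_insert huSK, hden]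
    ring
  have e2 : clearedIn p q b c d x (insert u S) (insert u K) (b * x u) = 0 := by
    unfold clearedIn
    rw [Finset.prod_insert huK, hden]
    ring
  have e3 : clearedOut p q b c d x (insert u S) (insert u K) (b * x u) = 0 := by
    unfold clearedOut
    rw [Finset.prod_insert huK, hnum]
    ring
  have hs1 : K.card + 1 ∈ Finset.Icc 1 (S.card + 1 + 1) := by
    have := Finset.card_le_card hKS
    simp only [Finset.mem_Icc]; omega
  have f1 := polesExcept_mul (p := p) (q := q) hs1 (b * x u)
  -- By the flip, every remaining point interacts with the pair through the same factor whether
  -- chosen or not, so these interactions also leave the sum.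
  have hflip : ∀ l ∈ S, pairFac p q b (x l / (b * x u)) = pairFac p q b (x u / x l) :=
    fun l hl => by
      have := hx l (hS l hl)
      exact pairFac_flip hp hq hb (by field_simp)
  have g1 : ellTheta p (q ^ (K.card + 1) * (b * x u)) ≠ 0 :=
    g.ne1_nat huS (K.card + 1) 1 0 0 (by simp only [zpow_one, zpow_zero]; ring)
  have g2 := gIn_mul_gOut (p := p) (q := q) (b := b) (c := c) (d := d) (r := K.card + 1)
    (X := x u) hb (g.ne1_nat huS (K.card + 1) 1 0 0 (by simp only [zpow_one, zpow_zero]; ring))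
      (g.ne1_nat huS (K.card + 1 + 1) 0 0 0 (by simp))
  have g3 : gIn p q b c d (K.card + 1) (b * x u) * ellTheta p (q ^ (K.card + 1) * (b * x u)) =
      ellTheta p (b * (b * x u) / c) * (ellTheta p (b * (b * x u) / d) *
        ellTheta p (q ^ (K.card + 1 + 1) * (b * x u) / b)) := by
    rw [gIn, div_mul_cancel₀ _ g1]; ring
  rw [e1, e2, e3]
  unfold clearedIn
  rw [subsetWt_insert_out hu hKS, Finset.insert_sdiff_of_notMem _ huK, Finset.prod_insert huSK,
    Finset.card_insert_of_notMem hu,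
    prod_numIn hp hq hb hX0 (fun l hl => hx l (hS l (hsd l hl))) (fun l hl => h1 l (hsd l hl))
      (fun l hl => h2 l (hsd l hl)),
    Finset.prod_congr rfl fun l hl => hflip l (hsd l hl), ← g3, ← f1, ← g2,
    ← Finset.prod_sdiff hKS, ← Finset.prod_sdiff hKS]
  ring

/-- The value of the cleared sum at another variable divided by `b`. -/
theorem clearedSum_eval_div (hp : ‖p‖ < 1) (g : Generic p q b c d x (insert u S)) (hu : u ∉ S) :
    clearedSum p q b c d x (insert u S) (x u / b) =
      (∏ k ∈ Finset.Icc 1 (S.card + 1 + 1), ellTheta p (q ^ k * (x u / b))) *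
      (numOut p q b (x u / b) (x u) * resFac p q b c d (x u / b) *
      ((∏ l ∈ S, pairFac p q b (x u / b / x l)) * ∏ l ∈ S, denPair p b (x u / b) (x l)) *
      (q / b * (ellTheta p c * ellTheta p d / (ellTheta p (q * c / b) * ellTheta p (q * d / b))) *
        subsetSum p q b (q * c) (q * d) (fun i => q * x i) S)) := by
  obtain ⟨hq, hb, hc, hd, hx, -, -, -, -⟩ := id g
  have huS : u ∈ insert u S := by simp
  have hS : ∀ l ∈ S, l ∈ insert u S := fun l hl => by simp [hl]
  have hx0 := hx u huS
  have hX0 : x u / b ≠ 0 := div_ne_zero hx0 hb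
  rw [← sum_coefA_succ hq hc hd]
  unfold clearedSum
  rw [Finset.sum_powerset_insert hu, ← Finset.sum_add_distrib, Finset.mul_sum, Finset.mul_sum]
  refine Finset.sum_congr rfl fun K hK => ?_
  have hKS := Finset.mem_powerset.1 hK
  have huK : u ∉ K := fun h => hu (hKS h)
  have hsd : ∀ l ∈ S \ K, l ∈ S := fun l hl => (Finset.mem_sdiff.1 hl).1
  have huSK : u ∉ S \ K := fun h => hu (hsd u h)
  have hins : insert u S \ insert u K = S \ K := by
    rw [Finset.insert_sdiff_insert]
    exact Finset.sdiff_insert_of_notMem hu K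
  have hbx : b * (x u / b) = x u := mul_div_cancel₀ _ hb
  have h1 : ∀ l ∈ S, ellTheta p (x u / b / x l) ≠ 0 := fun l hl =>
    g.ne2 huS (hS l hl) 0 (-1) (by
      have := hx l (hS l hl)
      simp only [zpow_neg, zpow_one, zpow_zero]; field_simp)
  have h2 : ∀ l ∈ S, ellTheta p (b * (x u / b) / x l) ≠ 0 := fun l hl => by
    rw [hbx]
    exact g.distinct u huS l (hS l hl) fun h => hu (h ▸ hl)
  have hone : b * (x u / b) / x u = 1 := by rw [hbx, div_self hx0]
  have hden : denPair p b (x u / b) (x u) = 0 := by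
    simp [denPair, hone, ellTheta_one hp]
  have hnum : numIn p q b (x u / b) (x u) = 0 := by
    simp [numIn, hone, ellTheta_one hp]
  -- At X = x u/b the roles are reversed: x u is chosen and X is not.
  have e1 : clearedOut p q b c d x (insert u S) K (x u / b) = 0 := by
    unfold clearedOut
    rw [Finset.insert_sdiff_of_notMem _ huK, Finset.prod_insert huSK, hden]
    ring
  have e2 : clearedIn p q b c d x (insert u S) (insert u K) (x u / b) = 0 := by
    unfold clearedIn
    rw [Finset.prod_insert huK, hden]
    ring
  have e3 : clearedIn p q b c d x (insert u S) K (x u / b) = 0 := by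
    unfold clearedIn
    rw [Finset.insert_sdiff_of_notMem _ huK, Finset.prod_insert huSK, hnum]
    ring
  have hs1 : K.card + 1 + 1 ∈ Finset.Icc 1 (S.card + 1 + 1) := by
    have := Finset.card_le_card hKS
    simp only [Finset.mem_Icc]; omega
  have f1 := polesExcept_mul (p := p) (q := q) hs1 (x u / b)
  have hflip : ∀ l ∈ S, pairFac p q b (x l / x u) = pairFac p q b (x u / b / x l) :=
    fun l hl => by
      have := hx l (hS l hl)
      exact pairFac_flip hp hq hb (by field_simp)
  have g1 : ellTheta p (q ^ (K.card + 1 + 1) * (x u / b)) ≠ 0 :=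
    g.ne1_nat huS (K.card + 1 + 1) (-1) 0 0
      (by simp only [zpow_neg, zpow_one, zpow_zero]; field_simp)
  have g2 := gIn_mul_gOut (p := p) (q := q) (b := b) (c := c) (d := d) (r := K.card + 1)
    (X := x u / b) hb (by
      rw [mul_right_comm, hbx, mul_comm]
      exact g.ne1_nat huS (K.card + 1) 0 0 0 (by simp)) g1
  have g3 : gOut p q b c d (K.card + 1) (x u / b) * ellTheta p (q ^ (K.card + 1 + 1) * (x u / b)) =
      ellTheta p (q * (x u / b) / c) * (ellTheta p (q * (x u / b) / d) *
        ellTheta p (b * q ^ (K.card + 1) * (x u / b))) := by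
    rw [gOut, div_mul_cancel₀ _ g1]; ring
  rw [hbx] at g2
  rw [e1, e2, e3]
  unfold clearedOut
  rw [subsetWt_insert_in hu hKS, hins, Finset.prod_insert huK,
    Finset.card_insert_of_notMem hu, Finset.card_insert_of_notMem huK,
    prod_numOut (fun l hl => h1 l (hKS hl)) (fun l hl => h2 l (hKS hl)),
    Finset.prod_congr rfl fun l hl => hflip l (hsd l hl), ← g3, ← f1, ← g2,
    ← Finset.prod_sdiff hKS, ← Finset.prod_sdiff hKS]
  ring

end Residues

/-! ### The reflection formula for subset sums. -/

section Duality

variable {ι : Type*} [DecidableEq ι] {p q b c d : ℂ} {x y : ι → ℂ} {S : Finset ι} {u : ι}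

/-- The function obtained from the sum over all subsets by clearing its poles in one variable. -/
structure IsReducedSum (p q b c d : ℂ) (x : ι → ℂ) (S : Finset ι) (h : ℂ → ℂ) : Prop where
  isTheta : IsTheta p (2 * S.card + 2) (c * d / (q * b) * ∏ l ∈ S, x l ^ 2) h
  eq : ∀ X, X ≠ 0 → clearedSum p q b c d x S X = (∏ l ∈ S, ellTheta p (X / x l)) *
        ((∏ k ∈ Finset.Icc 1 (S.card + 1), ellTheta p (q ^ k * X)) * h X)

/-- The factors of the simple poles of the sum over all subsets. -/
noncomputable def simplePoles (p b : ℂ) (x : ι → ℂ) (S : Finset ι) (X : ℂ) : ℂ :=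
  ∏ l ∈ S, (ellTheta p (X / (b * x l)) * ellTheta p (b * X / x l))

theorem prod_denPair (X : ℂ) : ∏ l ∈ S, denPair p b X (x l) =
    (∏ l ∈ S, ellTheta p (X / x l)) * simplePoles p b x S X := by
  unfold simplePoles denPair
  rw [Finset.prod_mul_distrib]

/-- Reflection inverts X/x l, so it swaps the poles at b x l with those at x l/b. -/
theorem simplePoles_dual (hp : ‖p‖ < 1) (hb : b ≠ 0) {κ X Y : ℂ} (hκ : κ ≠ 0) (hX : X ≠ 0)
    (hx : ∀ l ∈ S, x l ≠ 0) (hy : ∀ l ∈ S, y l = κ / x l) (hY : Y = κ / X) :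
    simplePoles p b y S Y = (∏ l ∈ S, x l ^ 2) / X ^ (2 * S.card) * simplePoles p b x S X := by
  unfold simplePoles
  rw [pow_mul, ← Finset.prod_const, ← Finset.prod_div_distrib, ← Finset.prod_mul_distrib]
  refine Finset.prod_congr rfl fun l hl => ?_
  have h := hx l hl
  rw [hy l hl, hY,
    ellTheta_of_mul_eq_one hp (x := κ / X / (b * (κ / x l))) (y := b * X / x l) (by field_simp),
    ellTheta_of_mul_eq_one hp (x := b * (κ / X) / (κ / x l)) (y := X / (b * x l)) (by field_simp)]
  field_simp

namespace IsReducedSum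

/-- Away from the poles the reduced sum is the subset sum times the factors of the simple poles,
since those of the removable poles cancel. -/
theorem eval {h : ℂ → ℂ} (hh : IsReducedSum p q b c d x S h) (hp : ‖p‖ < 1) (hq : q ≠ 0)
    (hb : b ≠ 0) (hu : u ∉ S) (hxu : x u ≠ 0) (hx : ∀ l ∈ S, x l ≠ 0)
    (h1 : ∀ l ∈ S, ellTheta p (x u / x l) ≠ 0) (h2 : ∀ l ∈ S, ellTheta p (x u / (b * x l)) ≠ 0)
    (h3 : ∀ l ∈ S, ellTheta p (b * x u / x l) ≠ 0)
    (h4 : ∀ k ∈ Finset.Icc 1 (S.card + 1), ellTheta p (q ^ k * x u) ≠ 0) :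
    h (x u) = subsetSum p q b c d x (insert u S) * simplePoles p b x S (x u) := by
  have e := hh.eq _ hxu
  rw [clearedSum_eq hp hq hb hu hxu hx h1 h2 h3 h4, prod_denPair] at e
  have n1 := Finset.prod_ne_zero_iff.2 h1
  have n2 := Finset.prod_ne_zero_iff.2 h4
  refine mul_left_cancel₀ (mul_ne_zero n1 n2) ?_
  linear_combination -e

theorem congr {h : ℂ → ℂ} (hh : IsReducedSum p q b c d x S h) (hxy : ∀ i ∈ S, x i = y i) :
    IsReducedSum p q b c d y S h := by
  refine ⟨hh.isTheta.cast rfl ?_, fun X hX => ?_⟩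
  · congr 1
    exact Finset.prod_congr rfl fun l hl => by rw [hxy l hl]
  · rw [← clearedSum_congr hxy, hh.eq X hX]
    congr 1
    exact Finset.prod_congr rfl fun l hl => by rw [hxy l hl]

/-- The values of the reduced sums at the two kinds of simple poles. -/
theorem eval_pole {h h' : ℂ → ℂ} (hp : ‖p‖ < 1) (g : Generic p q b c d x (insert u S)) (hu : u ∉ S)
    (hy : ∀ i ∈ insert u S, y i = c * d / (q * b) / x i)
    (hh : IsReducedSum p q b c d x (insert u S) h) (hh' : IsReducedSum p q b c d y (insert u S) h')
    (hdual : subsetSum p q b (q * c) (q * d) (fun i => q * x i) S =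
      (∏ i ∈ S, x i ^ 2 / (c * d / (q * b))) *
        subsetSum p q b (q * c) (q * d) (fun i => q * y i) S) :
    h (b * x u) = (b * x u) ^ (2 * (S.card + 2)) / (c * d / (q * b)) ^ (S.card + 2) *
      h' (y u / b) := by
  obtain ⟨hq, hb, hc, hd, hx, -, -, -, -⟩ := id g
  have g' : Generic p q b c d y (insert u S) := (g.dual hp).congr hy
  have huS : u ∈ insert u S := by simp
  have hS : ∀ l ∈ S, l ∈ insert u S := fun l hl => by simp [hl]
  have hxu := hx u huS
  have hyu := g'.x0 u huS
  set κ := c * d / (q * b) with hκ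
  have hκ0 : κ ≠ 0 := by simp [hκ, hq, hb, hc, hd]
  have a1 := clearedSum_eval_mul hp g hu
  have a2 := clearedSum_eval_div hp g' hu
  rw [hh.eq _ (mul_ne_zero hb hxu), prod_denPair, Finset.prod_insert hu,
    Finset.card_insert_of_notMem hu, mul_div_cancel_right₀ _ hxu] at a1
  rw [hh'.eq _ (div_ne_zero hyu hb), prod_denPair, Finset.prod_insert hu,
    Finset.card_insert_of_notMem hu, div_right_comm, div_self hyu] at a2
  have n1 : ∏ l ∈ S, ellTheta p (b * x u / x l) ≠ 0 := Finset.prod_ne_zero_iff.2 fun l hl =>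
    g.ne2 huS (hS l hl) 0 1 (by simp only [zpow_one, zpow_zero]; ring)
  have n2 : ∏ k ∈ Finset.Icc 1 (S.card + 1 + 1), ellTheta p (q ^ k * (b * x u)) ≠ 0 :=
    Finset.prod_ne_zero_iff.2 fun k _ =>
      g.ne1_nat huS k 1 0 0 (by simp only [zpow_one, zpow_zero]; ring)
  have n3 : ∏ l ∈ S, ellTheta p (y u / b / y l) ≠ 0 := Finset.prod_ne_zero_iff.2 fun l hl =>
    g'.ne2 huS (hS l hl) 0 (-1) (by
      have := g'.x0 l (hS l hl)
      simp only [zpow_neg, zpow_one, zpow_zero]; field_simp)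
  have n4 : ∏ k ∈ Finset.Icc 1 (S.card + 1 + 1), ellTheta p (q ^ k * (y u / b)) ≠ 0 :=
    Finset.prod_ne_zero_iff.2 fun k _ =>
      g'.ne1_nat huS k (-1) 0 0 (by simp only [zpow_neg, zpow_one, zpow_zero]; field_simp)
  have n5 : ellTheta p b ≠ 0 := g.ne0 0 1 0 0 (by simp)
  set C := q / b * (ellTheta p c * ellTheta p d /
    (ellTheta p (q * c / b) * ellTheta p (q * d / b)))
  -- The factor θ(X/x u) at X = b x u is θ(b); the others cleared earlier are nonzero and are
  -- cancelled.
  have b1 : ellTheta p b * h (b * x u) = numIn p q b (b * x u) (x u) * resFac p q b c d (x u) *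
      ((∏ l ∈ S, pairFac p q b (x u / x l)) * simplePoles p b x S (b * x u)) *
      (C * subsetSum p q b (q * c) (q * d) (fun i => q * x i) S) := by
    refine mul_left_cancel₀ (mul_ne_zero n1 n2) ?_
    linear_combination a1
  have b2 : ellTheta p (1 / b) * h' (y u / b) =
      numOut p q b (y u / b) (y u) * resFac p q b c d (y u / b) *
      ((∏ l ∈ S, pairFac p q b (y u / b / y l)) * simplePoles p b y S (y u / b)) *
      (C * subsetSum p q b (q * c) (q * d) (fun i => q * y i) S) := by
    refine mul_left_cancel₀ (mul_ne_zero n3 n4) ?_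
    linear_combination a2
  have c1 : ellTheta p (1 / b) = -(1 / b) * ellTheta p b :=
    ellTheta_of_mul_eq_one hp (by field_simp)
  have c2 : numOut p q b (y u / b) (y u) = -(1 / b ^ 3) * numIn p q b (b * x u) (x u) := by
    unfold numIn numOut
    rw [ellTheta_of_mul_eq_one hp (x := q * (y u / b) / y u) (y := b * x u / (q * x u))
        (by field_simp),
      ellTheta_of_mul_eq_one hp (x := b * (y u / b) / (q * y u)) (y := q * (b * x u) / (b * x u))
        (by field_simp),
      ellTheta_of_mul_eq_one hp (x := y u / b / (b * y u)) (y := b * (b * x u) / x u)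
        (by field_simp)]
    field_simp
  have c3 : resFac p q b c d (y u / b) = κ ^ 2 / (b ^ 2 * x u ^ 4) * resFac p q b c d (x u) := by
    unfold resFac
    rw [hy u huS, hκ,
      ellTheta_of_mul_eq_one hp (x := b ^ 2 * (c * d / (q * b) / x u / b) / c) (y := q * x u / d)
        (by field_simp),
      ellTheta_of_mul_eq_one hp (x := b ^ 2 * (c * d / (q * b) / x u / b) / d) (y := q * x u / c)
        (by field_simp),
      ellTheta_of_mul_eq_one hp (x := q * (c * d / (q * b) / x u / b) / c) (y := b ^ 2 * x u / d)
        (by field_simp),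
      ellTheta_of_mul_eq_one hp (x := q * (c * d / (q * b) / x u / b) / d) (y := b ^ 2 * x u / c)
        (by field_simp)]
    field_simp
  have c4 : ∏ l ∈ S, pairFac p q b (y u / b / y l) = ∏ l ∈ S, pairFac p q b (x u / x l) :=
    Finset.prod_congr rfl fun l hl => by
      have := hx l (hS l hl)
      refine pairFac_flip hp hq hb ?_
      rw [hy u huS, hy l (hS l hl)]
      field_simp
  have c5 := simplePoles_dual (p := p) (S := S) (y := y) (Y := y u / b) hp hb hκ0
    (mul_ne_zero hb hxu) (fun l hl => hx l (hS l hl)) (fun l hl => hy l (hS l hl))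
    (by rw [hy u huS]; field_simp)
  -- Reflection sends the pole b x u to y u/b, and all explicit residue factors match up to
  -- monomials; the remaining subset sums on S are compared by `hdual`.
  rw [Finset.prod_div_distrib, Finset.prod_const] at hdual
  rw [c1, c2, c3, c4, c5] at b2
  rw [hdual] at b1
  refine mul_left_cancel₀ n5 ?_
  rw [b1]
  have b3 : ellTheta p b * h' (y u / b) = (1 / b ^ 2) * (numIn p q b (b * x u) (x u) *
      (κ ^ 2 / (b ^ 2 * x u ^ 4) * resFac p q b c d (x u)) *
      ((∏ l ∈ S, pairFac p q b (x u / x l)) * ((∏ l ∈ S, x l ^ 2) / (b * x u) ^ (2 * S.card) *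
        simplePoles p b x S (b * x u))) *
      (C * subsetSum p q b (q * c) (q * d) (fun i => q * y i) S)) := by
    have hb2 : (-(1 / b)) ≠ 0 := by simp [hb]
    refine mul_left_cancel₀ hb2 ?_
    rw [← mul_assoc, b2]
    field_simp
  rw [mul_left_comm (ellTheta p b), b3, show 2 * (S.card + 2) = 2 * S.card + 4 by ring, pow_add, pow_add]
  field_simp

end IsReducedSum

/-- The reflection formula for the sum over all subsets of `S`. -/
def SubsetDual (p q b : ℂ) (S : Finset ι) : Prop :=
  ∀ (c d : ℂ) (x y : ι → ℂ), Generic p q b c d x S → (∀ i ∈ S, y i = c * d / (q * b) / x i) →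
    subsetSum p q b c d x S =
      (∏ i ∈ S, x i ^ 2 / (c * d / (q * b))) * subsetSum p q b c d y S

/-- The reflection formula at a special value of one variable. -/
theorem subsetSum_dual_of_eq_div (hp : ‖p‖ < 1) (hdual : SubsetDual p q b S)
    (g : Generic p q b c d x S) (hu : u ∉ S) (hxu : x u = c / b)
    (hy : ∀ i ∈ insert u S, y i = c * d / (q * b) / x i) :
    subsetSum p q b c d x (insert u S) =
      (∏ i ∈ insert u S, x i ^ 2 / (c * d / (q * b))) * subsetSum p q b c d y (insert u S) := by
  obtain ⟨hq, hb, hc, hd, hx, -, -, -, -⟩ := id g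
  have hyS : ∀ i ∈ S, y i = c * d / (q * b) / x i := fun i hi => hy i (by simp [hi])
  have g' : Generic p q b c d y S := (g.dual hp).congr hyS
  -- Reflection carries c/b, a zero of the chosen weight, to d/q, a zero of the unchosen weight with
  -- c and d interchanged. Both sides therefore collapse to S.
  have hyu : y u = d / q := by rw [hy u (by simp), hxu]; field_simp
  have e1 := subsetSum_insert_eval_div hp g hu hxu
  have e2 := subsetSum_insert_eval_div' hp g'.comm hu hyu
  rw [subsetSum_comm, subsetSum_comm (c := d) (d := q * c)] at e2
  have gs : Generic p q b (q * c) d x S := by simpa using g.shift 1 0 0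
  -- The collapsed sums are dual for qc, d: the reflection constant becomes qκ, which accounts for
  -- the points q y i.
  have e3 := hdual (q * c) d x (fun i => q * y i) gs (fun i hi => by
    rw [hyS i hi]; field_simp)
  have e4 : ∏ i ∈ S, ellTheta p (b * y i / d) / ellTheta p (b * q * y i / d) =
      ∏ i ∈ S, ((1 / q) * (ellTheta p (q * x i / c) / ellTheta p (x i / c))) :=
    Finset.prod_congr rfl fun i hi => by
      have := hx i hi
      have h1 : ellTheta p (x i / c) ≠ 0 := g.ne1 hi 0 0 (-1) 0 (by
        simp only [zpow_neg, zpow_one, zpow_zero]; field_simp)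
      rw [hyS i hi,
        ellTheta_of_mul_eq_one hp (x := b * (c * d / (q * b) / x i) / d) (y := q * x i / c)
          (by field_simp),
        ellTheta_of_mul_eq_one hp (x := b * q * (c * d / (q * b) / x i) / d) (y := x i / c)
          (by field_simp)]
      generalize ellTheta p (x i / c) = T at h1 ⊢
      field_simp
  have e5 : ∏ i ∈ S, x i ^ 2 / (q * c * d / (q * b)) =
      ∏ i ∈ S, ((1 / q) * (x i ^ 2 / (c * d / (q * b)))) :=
    Finset.prod_congr rfl fun i hi => by field_simp
  rw [Finset.prod_mul_distrib] at e4 e5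
  have e6 : ellTheta p (q / b) = -(q / b) * ellTheta p (b / q) :=
    ellTheta_of_mul_eq_one hp (by field_simp)
  have e7 : ellTheta p (q * c / (b * d)) = -(q * c / (b * d)) * ellTheta p (b * d / (q * c)) :=
    ellTheta_of_mul_eq_one hp (by field_simp)
  rw [e1, e2, e3, e4, e5, e6, e7, Finset.prod_insert hu, hxu]
  generalize ellTheta p (q * c / b) = T
  field_simp

theorem exists_isReducedSum (hp : ‖p‖ < 1) (g : Generic p q b c d x S) :
    ∃ h, IsReducedSum p q b c d x S h := by
  obtain ⟨h, h1, h2⟩ := exists_reducedSum hp g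
  exact ⟨h, h1, h2⟩

end Duality

section Duality

variable {ι : Type*} [DecidableEq ι] {p q b c d : ℂ} {x y : ι → ℂ} {S : Finset ι} {u : ι}

namespace IsReducedSum

/-- Comparison of the reduced sums of dual parameters. -/
theorem eval_dual {h h' : ℂ → ℂ} (hp : ‖p‖ < 1) (g : Generic p q b c d x S) (hu : u ∉ S)
    (hy : ∀ i ∈ insert u S, y i = c * d / (q * b) / x i) (hxu : x u ≠ 0)
    (hh : IsReducedSum p q b c d x S h) (hh' : IsReducedSum p q b c d y S h')
    (h1 : ∀ l ∈ S, ellTheta p (x u / x l) ≠ 0) (h2 : ∀ l ∈ S, ellTheta p (x u / (b * x l)) ≠ 0)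
    (h3 : ∀ l ∈ S, ellTheta p (b * x u / x l) ≠ 0)
    (h4 : ∀ k ∈ Finset.Icc 1 (S.card + 1), ellTheta p (q ^ k * x u) ≠ 0)
    (h5 : ∀ k ∈ Finset.Icc 1 (S.card + 1), ellTheta p (q ^ k * y u) ≠ 0) :
    subsetSum p q b c d x (insert u S) =
      (∏ i ∈ insert u S, x i ^ 2 / (c * d / (q * b))) * subsetSum p q b c d y (insert u S) ↔
    h (x u) = x u ^ (2 * (S.card + 1)) / (c * d / (q * b)) ^ (S.card + 1) *
      h' (c * d / (q * b) / x u) := by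
  obtain ⟨hq, hb, hc, hd, hx, -, -, -, -⟩ := id g
  have hyS : ∀ i ∈ S, y i = c * d / (q * b) / x i := fun i hi => hy i (by simp [hi])
  have g' : Generic p q b c d y S := (g.dual hp).congr hyS
  set κ := c * d / (q * b) with hκ
  have hκ0 : κ ≠ 0 := by simp [hκ, hq, hb, hc, hd]
  have hyu : y u = κ / x u := hy u (by simp)
  have hyu0 : y u ≠ 0 := by rw [hyu]; exact div_ne_zero hκ0 hxu
  have e1 := hh.eval hp hq hb hu hxu hx h1 h2 h3 h4
  have e2 := hh'.eval hp hq hb hu hyu0 g'.x0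
    (fun l hl => by
      have := hx l hl
      rw [ellTheta_of_mul_eq_one hp (y := x u / x l) (by rw [hyu, hyS l hl]; field_simp)]
      exact mul_ne_zero (neg_ne_zero.2 (div_ne_zero hyu0 (g'.x0 l hl))) (h1 l hl))
    (fun l hl => by
      have := hx l hl
      rw [ellTheta_of_mul_eq_one hp (y := b * x u / x l) (by rw [hyu, hyS l hl]; field_simp)]
      exact mul_ne_zero (neg_ne_zero.2 (div_ne_zero hyu0 (mul_ne_zero hb (g'.x0 l hl)))) (h3 l hl))
    (fun l hl => by
      have := hx l hl
      rw [ellTheta_of_mul_eq_one hp (y := x u / (b * x l)) (by rw [hyu, hyS l hl]; field_simp)]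
      exact mul_ne_zero (neg_ne_zero.2 (div_ne_zero (mul_ne_zero hb hyu0) (g'.x0 l hl))) (h2 l hl))
    h5
  rw [simplePoles_dual hp hb hκ0 hxu hx hyS hyu] at e2
  have n1 : simplePoles p b x S (x u) ≠ 0 :=
    Finset.prod_ne_zero_iff.2 fun l hl => mul_ne_zero (h2 l hl) (h3 l hl)
  rw [← hyu, e1, e2, Finset.prod_insert hu, Finset.prod_div_distrib, Finset.prod_const]
  have e3 : x u ^ (2 * (S.card + 1)) / κ ^ (S.card + 1) * (subsetSum p q b c d y (insert u S) *
      ((∏ l ∈ S, x l ^ 2) / x u ^ (2 * S.card) * simplePoles p b x S (x u))) =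
      (x u ^ 2 / κ * ((∏ l ∈ S, x l ^ 2) / κ ^ S.card) * subsetSum p q b c d y (insert u S)) *
      simplePoles p b x S (x u) := by
    rw [show 2 * (S.card + 1) = 2 * S.card + 2 by ring, pow_add, pow_add]
    field_simp
  rw [e3]
  exact ⟨fun h => by rw [h], fun h => mul_right_cancel₀ n1 h⟩

end IsReducedSum

/-- Interpolation in X = x u: the difference of the two reduced sums has too many zeros for its
degree and norm. The values at c/b and d/b use the formula for S itself, those at the simple poles
use it for S minus one point. -/
theorem subsetDual_insert (hp : ‖p‖ < 1) (hu : u ∉ S) (ih : ∀ T ⊆ S, SubsetDual p q b T) :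
    SubsetDual p q b (insert u S) := by
  intro c d x y g hy
  obtain ⟨hq, hb, hc, hd, hx, -, -, -, -⟩ := id g
  have hS : ∀ l ∈ S, l ∈ insert u S := fun l hl => by simp [hl]
  have huS : u ∈ insert u S := by simp
  have gS : Generic p q b c d x S := g.mono (Finset.subset_insert u S)
  have hyS : ∀ i ∈ S, y i = c * d / (q * b) / x i := fun i hi => hy i (hS i hi)
  have gS' : Generic p q b c d y S := (gS.dual hp).congr hyS
  have g' : Generic p q b c d y (insert u S) := (g.dual hp).congr hy
  obtain ⟨h, hh⟩ := exists_isReducedSum hp gS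
  obtain ⟨h', hh'⟩ := exists_isReducedSum hp gS'
  have hxu := hx u huS
  rw [hh.eval_dual hp gS hu hy hxu hh'
    (fun l hl => g.distinct u huS l (hS l hl) fun e => hu (e ▸ hl))
    (fun l hl => g.ne2 huS (hS l hl) 0 (-1) (by
      have := hx l (hS l hl)
      simp only [zpow_neg, zpow_one, zpow_zero]; field_simp))
    (fun l hl => g.ne2 huS (hS l hl) 0 1 (by simp only [zpow_one, zpow_zero]; ring))
    (fun k _ => g.ne1_nat huS k 0 0 0 (by simp))
    (fun k _ => g'.ne1_nat huS k 0 0 0 (by simp))]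
  set κ := c * d / (q * b) with hκ
  have hκ0 : κ ≠ 0 := by simp [hκ, hq, hb, hc, hd]
  set n := S.card
  have hprod0 : ∏ l ∈ S, x l ^ 2 ≠ 0 :=
    Finset.prod_ne_zero_iff.2 fun l hl => pow_ne_zero _ (hx l (hS l hl))
  -- By `eval_dual` the reflection formula at a regular point X is the vanishing of this difference.
  set D : ℂ → ℂ := fun X => h X - 1 / κ ^ (n + 1) * (X ^ (2 * n + 2) * h' (κ / X)) with hD
  have hprody : ∏ l ∈ S, y l ^ 2 = κ ^ (2 * n) / ∏ l ∈ S, x l ^ 2 := by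
    rw [pow_mul, ← Finset.prod_const, ← Finset.prod_div_distrib]
    exact Finset.prod_congr rfl fun l hl => by rw [hyS l hl, div_pow]
  -- Inverting the argument of the dual reduced sum turns its norm into that of h, so the difference
  -- is again a theta function; the degree is split to show the zeros to be removed.
  have hDt : IsTheta p (1 + 1 + n + n) (κ * ∏ l ∈ S, x l ^ 2) D := by
    have hinv := hh'.isTheta.inversion hκ0
      (mul_ne_zero hκ0 (by rw [hprody]; exact div_ne_zero (pow_ne_zero _ hκ0) hprod0))
    refine (hh.isTheta.sub ((hinv.const_mul (1 / κ ^ (n + 1))).cast rfl ?_)).cast (by ring) rfl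
    change κ ^ (2 * n + 2) / _ = κ * _
    rw [hprody, pow_add]
    field_simp
  -- zeros at the simple poles
  have hz1 : ∀ i ∈ S, D (b * x i) = 0 := by
    intro i hi
    obtain ⟨T, hT, hTS⟩ : ∃ T, i ∉ T ∧ insert i T = S :=
      ⟨S.erase i, by simp, Finset.insert_erase hi⟩
    have hcard : n = T.card + 1 := by rw [← Finset.card_insert_of_notMem hT, hTS]
    have hTsub : T ⊆ S := hTS ▸ Finset.subset_insert i T
    -- The residue involves qc, qd and q x, for which the reflection constant is qκ; the reflected
    -- points are then q y, and the prefactor (qx)²/(qκ) is x²/κ up to q, with κ rescaled by q as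
    -- recorded in `hd2`.
    have gT := (gS.mono hTsub).shift 1 1 1
    simp only [zpow_one] at gT
    have hd1 := ih T hTsub (q * c) (q * d) (fun i => q * x i) (fun i => q * y i) gT
      (fun l hl => by
        have := hx l (hS l (hTsub hl))
        rw [hyS l (hTsub hl), hκ]; field_simp)
    have hd2 : ∏ l ∈ T, (q * x l) ^ 2 / (q * c * (q * d) / (q * b)) = ∏ l ∈ T, x l ^ 2 / κ :=
      Finset.prod_congr rfl fun l _ => by rw [hκ]; field_simp
    rw [hd2] at hd1
    have := IsReducedSum.eval_pole hp (hTS ▸ gS) hT (fun l hl => hyS l (hTS ▸ hl)) (hTS.symm ▸ hh)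
      (hTS.symm ▸ hh') hd1
    have hxi := hx i (hS i hi)
    rw [hD]
    beta_reduce
    rw [this, hyS i hi, hcard, ← hκ, show κ / (b * x i) = κ / x i / b by field_simp]
    ring
  have hz2 : ∀ i ∈ S, D (x i / b) = 0 := by
    intro i hi
    obtain ⟨T, hT, hTS⟩ : ∃ T, i ∉ T ∧ insert i T = S :=
      ⟨S.erase i, by simp, Finset.insert_erase hi⟩
    have hcard : n = T.card + 1 := by rw [← Finset.card_insert_of_notMem hT, hTS]
    have hTsub : T ⊆ S := hTS ▸ Finset.subset_insert i T
    have gT := (gS'.mono hTsub).shift 1 1 1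
    simp only [zpow_one] at gT
    have hxy : ∀ i ∈ S, x i = κ / y i := fun l hl => by
      have := hx l (hS l hl)
      rw [hyS l hl]; field_simp
    have hd1 := ih T hTsub (q * c) (q * d) (fun i => q * y i) (fun i => q * x i) gT
      (fun l hl => by
        have := gS'.x0 l (hTsub hl)
        rw [hxy l (hTsub hl), hκ]; field_simp)
    have hd2 : ∏ l ∈ T, (q * y l) ^ 2 / (q * c * (q * d) / (q * b)) = ∏ l ∈ T, y l ^ 2 / κ :=
      Finset.prod_congr rfl fun l _ => by rw [hκ]; field_simp
    rw [hd2] at hd1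
    have := IsReducedSum.eval_pole hp (hTS ▸ gS') hT (fun l hl => hxy l (hTS ▸ hl)) (hTS.symm ▸ hh')
      (hTS.symm ▸ hh) hd1
    have hxi := hx i (hS i hi)
    rw [hD]
    beta_reduce
    rw [show κ / (x i / b) = b * y i by rw [hyS i hi]; field_simp, this, hyS i hi, hcard, ← hκ]
    have e : ∀ H : ℂ, 1 / κ ^ (T.card + 1 + 1) * ((x i / b) ^ (2 * (T.card + 1) + 2) *
        ((b * (κ / x i)) ^ (2 * (T.card + 2)) / κ ^ (T.card + 2) * H)) = H := by
      intro H
      have e1 : (x i / b) ^ (2 * (T.card + 1) + 2) * (b * (κ / x i)) ^ (2 * (T.card + 2)) =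
          κ ^ (T.card + 2) * κ ^ (T.card + 2) := by
        rw [show 2 * (T.card + 1) + 2 = 2 * (T.card + 2) by ring, ← mul_pow,
          show x i / b * (b * (κ / x i)) = κ by field_simp]
        ring
      have e2 : κ ^ (T.card + 2) ≠ 0 := pow_ne_zero _ hκ0
      rw [show T.card + 1 + 1 = T.card + 2 by ring]
      generalize (x i / b) ^ (2 * (T.card + 1) + 2) = A at e1 ⊢
      generalize (b * (κ / x i)) ^ (2 * (T.card + 2)) = B at e1 ⊢
      generalize κ ^ (T.card + 2) = K at e1 e2 ⊢
      field_simp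
      linear_combination H * e1
    rw [e]
    exact sub_self _
  -- zeros at `c / b` and `d / b`
  have hz34 : ∀ X : ℂ, X ≠ 0 → (∀ l ∈ S, ellTheta p (X / x l) ≠ 0) →
      (∀ l ∈ S, ellTheta p (X / (b * x l)) ≠ 0) → (∀ l ∈ S, ellTheta p (b * X / x l) ≠ 0) →
      (∀ k ∈ Finset.Icc 1 (n + 1), ellTheta p (q ^ k * X) ≠ 0) →
      (∀ k ∈ Finset.Icc 1 (n + 1), ellTheta p (q ^ k * (κ / X)) ≠ 0) →
      (∀ x' y' : ι → ℂ, (∀ i ∈ S, x' i = x i) → x' u = X →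
        (∀ i ∈ insert u S, y' i = κ / x' i) → subsetSum p q b c d x' (insert u S) =
        (∏ i ∈ insert u S, x' i ^ 2 / κ) * subsetSum p q b c d y' (insert u S)) → D X = 0 := by
    intro X hX h1 h2 h3 h4 h5 hs
    -- The reduced sums on S do not involve x u, so this point may be moved to X.
    set x' := Function.update x u X
    have hx'u : x' u = X := Function.update_self ..
    have hx'S : ∀ i ∈ S, x' i = x i := fun i hi =>
      Function.update_of_ne (by rintro rfl; exact hu hi) _ _
    have e := hs x' (fun i => κ / x' i) hx'S hx'u (fun i _ => rfl)
    have gx' : Generic p q b c d x' S := gS.congr hx'S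
    rw [IsReducedSum.eval_dual hp gx' hu (fun i _ => rfl) (by rw [hx'u]; exact hX)
      (hh.congr fun i hi => (hx'S i hi).symm)
      (hh'.congr fun i hi => by rw [hyS i hi, hx'S i hi])
      (fun l hl => by rw [hx'u, hx'S l hl]; exact h1 l hl)
      (fun l hl => by rw [hx'u, hx'S l hl]; exact h2 l hl)
      (fun l hl => by rw [hx'u, hx'S l hl]; exact h3 l hl)
      (fun k hk => by rw [hx'u]; exact h4 k hk) (fun k hk => by rw [hx'u]; exact h5 k hk),
      hx'u] at e
    rw [hD]
    beta_reduce
    rw [e]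
    ring
  have hz3 : D (c / b) = 0 := by
    refine hz34 _ (div_ne_zero hc hb) ?_ ?_ ?_ ?_ ?_ ?_
    · intro l hl
      exact gS'.ne1 hl 1 0 0 (-1) (by
        have := hx l (hS l hl)
        rw [hyS l hl, hκ]; simp only [zpow_neg, zpow_one, zpow_zero]; field_simp)
    · intro l hl
      exact gS'.ne1 hl 1 (-1) 0 (-1) (by
        have := hx l (hS l hl)
        rw [hyS l hl, hκ]; simp only [zpow_neg, zpow_one, zpow_zero]; field_simp)
    · intro l hl
      exact gS'.ne1 hl 1 1 0 (-1) (by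
        have := hx l (hS l hl)
        rw [hyS l hl, hκ]; simp only [zpow_neg, zpow_one, zpow_zero]; field_simp)
    · intro k _
      exact g.ne0_nat k (-1) 1 0 (by simp only [zpow_neg, zpow_one, zpow_zero]; field_simp)
    · intro k hk
      -- Since κ/(c/b) = d/q and k ≥ 1, the argument is q^(k-1) d with a natural exponent.
      obtain ⟨m, rfl⟩ : ∃ m, k = m + 1 := ⟨k - 1, by have := (Finset.mem_Icc.1 hk).1; omega⟩
      exact g.ne0_nat m 0 0 1 (by rw [hκ]; simp only [zpow_one, zpow_zero]; field_simp; ring)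
    · intro x' y' hx' hx'u hy'
      exact subsetSum_dual_of_eq_div hp (ih S le_rfl) (gS.congr hx') hu hx'u hy'
  have hz4 : D (d / b) = 0 := by
    refine hz34 _ (div_ne_zero hd hb) ?_ ?_ ?_ ?_ ?_ ?_
    · intro l hl
      exact gS'.ne1 hl 1 0 (-1) 0 (by
        have := hx l (hS l hl)
        rw [hyS l hl, hκ]; simp only [zpow_neg, zpow_one, zpow_zero]; field_simp)
    · intro l hl
      exact gS'.ne1 hl 1 (-1) (-1) 0 (by
        have := hx l (hS l hl)
        rw [hyS l hl, hκ]; simp only [zpow_neg, zpow_one, zpow_zero]; field_simp)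
    · intro l hl
      exact gS'.ne1 hl 1 1 (-1) 0 (by
        have := hx l (hS l hl)
        rw [hyS l hl, hκ]; simp only [zpow_neg, zpow_one, zpow_zero]; field_simp)
    · intro k _
      exact g.ne0_nat k (-1) 0 1 (by simp only [zpow_neg, zpow_one, zpow_zero]; field_simp)
    · intro k hk
      obtain ⟨m, rfl⟩ : ∃ m, k = m + 1 := ⟨k - 1, by have := (Finset.mem_Icc.1 hk).1; omega⟩
      exact g.ne0_nat m 0 1 0 (by rw [hκ]; simp only [zpow_one, zpow_zero]; field_simp; ring)
    · intro x' y' hx' hx'u hy'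
      -- The case d/b follows from c/b by the symmetry in c and d.
      rw [subsetSum_comm, subsetSum_comm (c := c) (d := d) (x := y')]
      rw [show κ = d * c / (q * b) by rw [hκ, mul_comm c d]] at hy' ⊢
      exact subsetSum_dual_of_eq_div hp (ih S le_rfl) (gS.congr hx').comm hu hx'u hy'
  -- too many zeros
  obtain ⟨g1, ht1, he1⟩ := hDt.exists_eq_prod_mul hp S (fun i => b * x i)
    (fun i hi => mul_ne_zero hb (hx i (hS i hi)))
    (fun i hi j hj hij => by rw [mul_div_mul_left _ _ hb]; exact gS.distinct i hi j hj hij) hz1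
  have hg1 : ∀ X, X ≠ 0 → (∀ l ∈ S, ellTheta p (X / (b * x l)) ≠ 0) → D X = 0 → g1 X = 0 :=
    fun X hX h1 h2 => by
      rw [he1 X hX] at h2
      exact (mul_eq_zero.1 h2).resolve_left (Finset.prod_ne_zero_iff.2 h1)
  obtain ⟨g2, ht2, he2⟩ := ht1.exists_eq_prod_mul hp S (fun i => x i / b)
    (fun i hi => div_ne_zero (hx i (hS i hi)) hb)
    (fun i hi j hj hij => by rw [div_div_div_cancel_right₀ hb]; exact gS.distinct i hi j hj hij)
    (fun i hi => hg1 _ (div_ne_zero (hx i (hS i hi)) hb)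
      (fun l hl => gS.ne2 hi hl 0 (-2) (by
        have := hx l (hS l hl)
        rw [zpow_neg]
        simp only [zpow_ofNat]; field_simp)) (hz2 i hi))
  have hg2 : ∀ X, X ≠ 0 → (∀ l ∈ S, ellTheta p (X / (b * x l)) ≠ 0) →
      (∀ l ∈ S, ellTheta p (X / (x l / b)) ≠ 0) → D X = 0 → g2 X = 0 :=
    fun X hX h1 h2 h3 => by
      have h4 := hg1 X hX h1 h3
      rw [he2 X hX] at h4
      exact (mul_eq_zero.1 h4).resolve_left (Finset.prod_ne_zero_iff.2 h2)
  have hg2c : g2 (c / b) = 0 := hg2 _ (div_ne_zero hc hb)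
    (fun l hl => gS'.ne1 hl 1 (-1) 0 (-1) (by
        have := hx l (hS l hl)
        rw [hyS l hl, hκ]; simp only [zpow_neg, zpow_one, zpow_zero]; field_simp))
    (fun l hl => gS'.ne1 hl 1 1 0 (-1) (by
        have := hx l (hS l hl)
        rw [hyS l hl, hκ]; simp only [zpow_neg, zpow_one, zpow_zero]; field_simp)) hz3
  have hg2d : g2 (d / b) = 0 := hg2 _ (div_ne_zero hd hb)
    (fun l hl => gS'.ne1 hl 1 (-1) (-1) 0 (by
        have := hx l (hS l hl)
        rw [hyS l hl, hκ]; simp only [zpow_neg, zpow_one, zpow_zero]; field_simp))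
    (fun l hl => gS'.ne1 hl 1 1 (-1) 0 (by
        have := hx l (hS l hl)
        rw [hyS l hl, hκ]; simp only [zpow_neg, zpow_one, zpow_zero]; field_simp)) hz4
  obtain ⟨g3, ht3, he3⟩ := ht2.exists_eq_mul hp (div_ne_zero hc hb) hg2c
  have hg3d : g3 (d / b) = 0 := by
    have h1 := he3 _ (div_ne_zero hd hb)
    rw [hg2d] at h1
    refine (mul_eq_zero.1 h1.symm).resolve_left (g.ne0 0 0 (-1) 1 ?_)
    simp only [zpow_neg, zpow_one, zpow_zero]; field_simp
  obtain ⟨g4, ht4, he4⟩ := ht3.exists_eq_mul hp (div_ne_zero hd hb) hg3d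
  -- Dividing κ ∏ x² by the product of all removed zeros leaves κb²/(cd) = b/q, whose theta is
  -- nonzero by genericity.
  have hnorm : κ * (∏ l ∈ S, x l ^ 2) / (∏ i ∈ S, b * x i) / (∏ i ∈ S, x i / b) / (c / b) / (d / b) =
      b / q := by
    have e1 : (∏ i ∈ S, b * x i) * (∏ i ∈ S, x i / b) = ∏ l ∈ S, x l ^ 2 := by
      rw [← Finset.prod_mul_distrib]
      exact Finset.prod_congr rfl fun l _ => by field_simp
    rw [div_div _ (∏ i ∈ S, b * x i), e1, mul_div_cancel_right₀ _ hprod0, hκ]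
    field_simp
  rw [hnorm] at ht4
  have hg4 := ht4.eq_zero_of_degree_zero hp (div_ne_zero hb hq)
    (g.ne0 (-1) 1 0 0 (by simp only [zpow_neg, zpow_one, zpow_zero]; field_simp)) hxu
  have hfin : D (x u) = 0 := by
    rw [he1 _ hxu, he2 _ hxu, he3 _ hxu, he4 _ hxu, hg4]; ring
  rw [hD] at hfin
  beta_reduce at hfin
  linear_combination hfin

/-- The reflection formula for generic parameters. -/
theorem subsetDual (hp : ‖p‖ < 1) (S : Finset ι) : SubsetDual p q b S := by
  induction S using Finset.strongInduction with
  | H S ih =>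
    rcases S.eq_empty_or_nonempty with rfl | ⟨u, hu⟩
    · intro c d x y _ _
      simp [subsetSum, subsetWt]
    · rw [← Finset.insert_erase hu]
      refine subsetDual_insert hp (by simp) fun T hT => ih T ?_
      exact lt_of_le_of_lt hT (Finset.erase_ssubset hu)

end Duality

/-! ### Shifted factorials and the interactions in the multivariable series. -/

/-- The theta shifted factorial with a natural number index. -/
noncomputable def thetaPoch (p q x : ℂ) (n : ℕ) : ℂ := ∏ j ∈ Finset.range n, ellTheta p (x * q ^ j)

theorem thetaFact_natCast (p q x : ℂ) (n : ℕ) : thetaFact p q x n = thetaPoch p q x n := by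
  simp [thetaFact, thetaPoch]

theorem thetaPoch_add (p q x : ℂ) (m n : ℕ) :
    thetaPoch p q x (m + n) = thetaPoch p q x m * thetaPoch p q (x * q ^ m) n := by
  unfold thetaPoch
  rw [Finset.prod_range_add]
  congr 1
  exact Finset.prod_congr rfl fun j _ => by rw [pow_add, mul_assoc]

theorem thetaPoch_succ' (p q x : ℂ) (n : ℕ) :
    thetaPoch p q x (n + 1) = ellTheta p x * thetaPoch p q (x * q) n := by
  rw [add_comm, thetaPoch_add]; simp [thetaPoch]

theorem thetaPoch_succ (p q x : ℂ) (n : ℕ) :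
    thetaPoch p q x (n + 1) = thetaPoch p q x n * ellTheta p (x * q ^ n) := by
  unfold thetaPoch; rw [Finset.prod_range_succ]

theorem thetaPoch_ne_zero {p q x : ℂ} {n : ℕ} (h : ∀ j < n, ellTheta p (x * q ^ j) ≠ 0) :
    thetaPoch p q x n ≠ 0 :=
  Finset.prod_ne_zero_iff.2 fun j hj => h j (Finset.mem_range.1 hj)

theorem thetaFact_neg {p q : ℂ} (hq : q ≠ 0) (x : ℂ) (n : ℕ) :
    thetaFact p q x (-(n : ℤ)) = (thetaPoch p q (x * q ^ (-(n : ℤ))) n)⁻¹ := by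
  simp only [thetaFact, thetaPoch, neg_neg, Int.toNat_natCast, Int.toNat_neg_natCast,
    Finset.range_zero, Finset.prod_empty, one_div]
  rw [← Finset.prod_range_reflect]
  congr 1
  refine Finset.prod_congr rfl fun j hj => ?_
  have hj' := Finset.mem_range.1 hj
  rw [mul_assoc, ← zpow_natCast, ← zpow_add₀ hq]
  congr 3
  omega

/-- The addition rule of the theta shifted factorials. -/
theorem thetaFact_sub_mul {p q x : ℂ} (hq : q ≠ 0) (k l : ℕ)
    (h : ∀ j : ℕ, k ≤ j → j < l → ellTheta p (x * q ^ ((k : ℤ) - 1 - j)) ≠ 0) :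
    thetaFact p q x ((k : ℤ) - l) * thetaPoch p q (x * q ^ ((k : ℤ) - l)) l = thetaPoch p q x k := by
  rcases le_total l k with hlk | hkl
  · obtain ⟨n, rfl⟩ := Nat.exists_eq_add_of_le hlk
    have e : (((l + n : ℕ) : ℤ) - l) = (n : ℕ) := by push_cast; ring
    rw [e, thetaFact_natCast, add_comm l n, thetaPoch_add, zpow_natCast]
  · obtain ⟨n, rfl⟩ := Nat.exists_eq_add_of_le hkl
    have e : ((k : ℤ) - (k + n : ℕ)) = -(n : ℕ) := by push_cast; ring
    have hne : thetaPoch p q (x * q ^ (-(n : ℤ))) n ≠ 0 := thetaPoch_ne_zero fun j hj => by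
      rw [mul_assoc, ← zpow_natCast, ← zpow_add₀ hq]
      have := h (k + n - 1 - j) (by omega) (by omega)
      rwa [show (k : ℤ) - 1 - (k + n - 1 - j : ℕ) = -(n : ℤ) + j by omega] at this
    rw [e, thetaFact_neg hq, add_comm k n, thetaPoch_add, inv_mul_cancel_left₀ hne, zpow_neg,
      zpow_natCast, inv_mul_cancel_right₀ (pow_ne_zero _ hq)]

theorem prod_telescope {u : ℕ → ℂ} (n : ℕ) (h : ∀ β, u β ≠ 0) :
    ∏ β ∈ Finset.range n, u (β + 1) / u β = u n / u 0 := by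
  induction n with
  | zero => simp [h 0]
  | succ n ih =>
    rw [Finset.prod_range_succ, ih]
    have h0 := h 0
    have hn := h n
    field_simp

/-- Genericity of the parameters of the multivariable series. -/
structure GenericV (p q a b c d : ℂ) {N : ℕ} (t : Fin N → ℂ) : Prop where
  generic : Generic p q b c d (fun i => a * t i) Finset.univ
  ratio : ∀ i j, i ≠ j → ∀ l : ℤ, ellTheta p (q ^ l * (t i / t j)) ≠ 0

namespace GenericV

variable {p q a b c d : ℂ} {N : ℕ} {t : Fin N → ℂ}

theorem t0 (g : GenericV p q a b c d t) (i : Fin N) : t i ≠ 0 :=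
  right_ne_zero_of_mul (g.generic.x0 i (Finset.mem_univ i))

theorem ne_param (g : GenericV p q a b c d t) (l : ℤ) (hl : l ≠ 0) : ellTheta p (q ^ l) ≠ 0 :=
  g.generic.ne0 l 0 0 0 (by simp) (Or.inl hl)

theorem ne_single (g : GenericV p q a b c d t) (i : Fin N) (n : ℕ) (j k l : ℤ) {z : ℂ}
    (hz : z = q ^ n * (b ^ j * c ^ k * d ^ l) * (a * t i)) : ellTheta p z ≠ 0 :=
  g.generic.ne1_nat (Finset.mem_univ i) n j k l hz

theorem ne_ratio (g : GenericV p q a b c d t) (i j : Fin N) (l : ℤ) (h : i = j → l ≠ 0) :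
    ellTheta p (q ^ l * (t i / t j)) ≠ 0 := by
  by_cases hij : i = j
  · subst hij
    rw [div_self (g.t0 i), mul_one]
    exact g.ne_param l (h rfl)
  · exact g.ratio i j hij l

theorem ne_ratio_div (g : GenericV p q a b c d t) (i j : Fin N) (l : ℤ) {z : ℂ}
    (hz : z = q ^ l * (t i / t j) / b) : ellTheta p z ≠ 0 := by
  have ha : a ≠ 0 := left_ne_zero_of_mul (g.generic.x0 i (Finset.mem_univ i))
  refine g.generic.ne2 (Finset.mem_univ i) (Finset.mem_univ j) l (-1) ?_
  rw [hz, zpow_neg, zpow_one, mul_div_mul_left _ _ ha]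
  ring

theorem ne_ratio_mul (g : GenericV p q a b c d t) (i j : Fin N) (l : ℤ) {z : ℂ}
    (hz : z = q ^ l * b * (t i / t j)) : ellTheta p z ≠ 0 := by
  have ha : a ≠ 0 := left_ne_zero_of_mul (g.generic.x0 i (Finset.mem_univ i))
  refine g.generic.ne2 (Finset.mem_univ i) (Finset.mem_univ j) l 1 ?_
  rw [hz, zpow_one, mul_div_mul_left _ _ ha]

/-- After a flip, a run of interactions along a geometric progression is a product of two
telescoping quotients. For i = j the condition e < 0 keeps the arguments away from the zero at 1. -/
theorem pairFac_telescope (hp : ‖p‖ < 1) (g : GenericV p q a b c d t) (i j : Fin N) (e : ℤ) (n : ℕ)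
    (he : i = j → e < 0) :
    ∏ β ∈ Finset.range n, pairFac p q b (q ^ ((β : ℤ) - e) * (t j / t i)) =
      ellTheta p (q ^ (e - n) * (t i / t j)) / ellTheta p (q ^ (1 + e - n) * (t i / t j) / b) *
      (ellTheta p (q ^ (1 + e) * (t i / t j) / b) / ellTheta p (q ^ e * (t i / t j))) := by
  have hq := g.generic.q0
  have hb := g.generic.b0
  have hti := g.t0 i
  have htj := g.t0 j
  have h1 := prod_telescope (u := fun β : ℕ => ellTheta p (q ^ (e - β) * (t i / t j))) n
    (fun β => g.ne_ratio i j _ fun h => by have := he h; omega)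
  have h2 := prod_telescope (u := fun β : ℕ => (ellTheta p (q ^ (1 + e - β) * (t i / t j) / b))⁻¹) n
    (fun β => inv_ne_zero (g.ne_ratio_div i j _ rfl))
  have h3 : ∏ β ∈ Finset.range n, pairFac p q b (q ^ ((β : ℤ) - e) * (t j / t i)) =
      (∏ β ∈ Finset.range n, ellTheta p (q ^ (e - (β + 1 : ℕ)) * (t i / t j)) /
        ellTheta p (q ^ (e - β) * (t i / t j))) *
      ∏ β ∈ Finset.range n, (ellTheta p (q ^ (1 + e - (β + 1 : ℕ)) * (t i / t j) / b))⁻¹ /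
        (ellTheta p (q ^ (1 + e - β) * (t i / t j) / b))⁻¹ := by
    rw [← Finset.prod_mul_distrib]
    refine Finset.prod_congr rfl fun β _ => ?_
    rw [pairFac_flip hp hq hb (z := q ^ (e - β) * (t i / t j) / b) (by
      rw [show (β : ℤ) - e = -(e - β) by ring, zpow_neg]; field_simp)]
    unfold pairFac
    have z1 : q ^ (1 + e - (β : ℤ)) = q * q ^ (e - (β : ℤ)) := by
      rw [show 1 + e - (β : ℤ) = 1 + (e - β) by ring, zpow_add₀ hq, zpow_one]
    have z2 : q ^ (e - ((β + 1 : ℕ) : ℤ)) = q ^ (e - (β : ℤ)) / q := by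
      rw [Nat.cast_succ, show e - ((β : ℤ) + 1) = (e - β) - 1 by ring, zpow_sub_one₀ hq]; rfl
    have z3 : q ^ (1 + e - ((β + 1 : ℕ) : ℤ)) = q ^ (e - (β : ℤ)) := by
      congr 1; push_cast; ring
    rw [z1, z2, z3]
    generalize q ^ (e - (β : ℤ)) = z
    rw [show q * (z * (t i / t j) / b) = q * z * (t i / t j) / b by ring,
      show b * (z * (t i / t j) / b) / q = z / q * (t i / t j) by field_simp,
      show b * (z * (t i / t j) / b) = z * (t i / t j) by field_simp]
    simp only [div_eq_mul_inv, inv_inv, mul_inv]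
    ring
  rw [h3, h1, h2]
  simp only [div_eq_mul_inv, inv_inv, Nat.cast_zero, sub_zero]
  ring

/-- The factor `R_ij(u)` whose product over all `i`, `j` is a monomial. -/
noncomputable def crossFac (p q : ℂ) (t : Fin N → ℂ) (k : Fin N → ℕ) (u : ℂ) (i j : Fin N) : ℂ :=
  thetaPoch p q (q ^ (1 - (k j : ℤ)) * (t i / t j) / u) (k i) *
    thetaFact p q (u * t i / t j) ((k i : ℤ) - k j) / thetaPoch p q (u * t i / t j) (k i)

/-- Termwise inversion turns the first factorial into a monomial times Z j i, and the addition rule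
turns the rest into 1/Z i j. The factors Z cancel in the product over all ordered pairs. -/
theorem prod_crossFac (hp : ‖p‖ < 1) (hq : q ≠ 0) (ht : ∀ i, t i ≠ 0) (k : Fin N → ℕ) {u : ℂ}
    (hu : u ≠ 0) (h : ∀ i j, ∀ l : ℤ, (i = j → 0 ≤ l) → ellTheta p (u * t i / t j * q ^ l) ≠ 0) :
    ∏ i, ∏ j, crossFac p q t k u i j = ∏ i, ∏ j, ∏ α ∈ Finset.range (k i),
      -(q ^ (1 - (k j : ℤ) + α) * (t i / t j) / u) := by
  set Z : Fin N → Fin N → ℂ := fun i j =>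
    thetaPoch p q (u * t i / t j * q ^ ((k i : ℤ) - k j)) (k j) with hZ
  have hZ0 : ∀ i j, Z i j ≠ 0 := fun i j => thetaPoch_ne_zero fun l _ => by
    rw [mul_assoc, ← zpow_natCast, ← zpow_add₀ hq]
    exact h i j _ fun hij => by subst hij; omega
  have h1 : ∀ i j, crossFac p q t k u i j =
      (∏ α ∈ Finset.range (k i), -(q ^ (1 - (k j : ℤ) + α) * (t i / t j) / u)) *
        (Z j i / Z i j) := by
    intro i j
    have e1 : thetaPoch p q (q ^ (1 - (k j : ℤ)) * (t i / t j) / u) (k i) =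
        (∏ α ∈ Finset.range (k i), -(q ^ (1 - (k j : ℤ) + α) * (t i / t j) / u)) * Z j i := by
      simp only [hZ, thetaPoch]
      rw [← Finset.prod_range_reflect (fun l => ellTheta p (u * t j / t i * q ^ ((k j : ℤ) - k i) *
        q ^ l)), ← Finset.prod_mul_distrib]
      refine Finset.prod_congr rfl fun α hα => ?_
      have hα' := Finset.mem_range.1 hα
      have hti := ht i
      have htj := ht j
      have z1 : q ^ (1 - (k j : ℤ)) * (t i / t j) / u * q ^ α =
          q ^ (1 - (k j : ℤ) + α) * (t i / t j) / u := by
        rw [zpow_add₀ hq, zpow_natCast]; ring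
      have z2 : u * t j / t i * q ^ ((k j : ℤ) - k i) * q ^ (k i - 1 - α) =
          u * t j / t i * q ^ (-(1 - (k j : ℤ) + α)) := by
        rw [mul_assoc, ← zpow_natCast, ← zpow_add₀ hq]
        congr 2; omega
      rw [z1, z2]
      refine ellTheta_of_mul_eq_one hp ?_
      rw [zpow_neg]
      have := zpow_ne_zero (1 - (k j : ℤ) + α) hq
      field_simp
    have e2 := thetaFact_sub_mul (p := p) (x := u * t i / t j) hq (k i) (k j) (fun l hl hl' =>
      h i j _ fun hij => by subst hij; omega)
    have e3 : thetaPoch p q (u * t i / t j) (k i) ≠ 0 := thetaPoch_ne_zero fun l _ => by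
      rw [← zpow_natCast]
      exact h i j l fun _ => by omega
    have e4 := hZ0 i j
    change _ * Z i j = _ at e2
    unfold crossFac
    rw [e1, div_eq_iff e3, ← e2, mul_comm _ (Z i j), ← mul_assoc, mul_assoc _ _ (Z i j),
      div_mul_cancel₀ _ e4]
  simp_rw [h1, Finset.prod_mul_distrib, Finset.prod_div_distrib]
  rw [Finset.prod_comm (f := fun i j => Z j i), div_self, mul_one]
  exact Finset.prod_ne_zero_iff.2 fun i _ => Finset.prod_ne_zero_iff.2 fun j _ => hZ0 i j

/-- The interaction factors of the multivariable series. -/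
theorem prod_interaction (hp : ‖p‖ < 1) (g : GenericV p q a b c d t) (m k : Fin N → ℕ)
    (hk : ∀ i, k i ≤ m i) :
    ∏ i, ∏ α ∈ Finset.range (k i), ∏ j, ∏ β ∈ Finset.range (m j - k j),
      pairFac p q b (a * t j * q ^ (k j + β) / (a * t i * q ^ α)) =
    (q / b) ^ (N * ∑ l, k l) * ∏ i, ∏ j,
      ((thetaFact p q (q ^ (-(m j : ℤ)) * t i / t j) (k i) * thetaFact p q (b * t i / t j) (k i)) /
        (thetaFact p q (q ^ (1 - (m j : ℤ)) * t i / (b * t j)) (k i) *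
          thetaFact p q (q * t i / t j) (k i)) *
      (thetaFact p q (q * t i / t j) ((k i : ℤ) - k j) /
        thetaFact p q (b * t i / t j) ((k i : ℤ) - k j))) := by
  have hq := g.generic.q0
  have hb := g.generic.b0
  have ht := g.t0
  have hRb := prod_crossFac hp hq ht k hb (fun i j l _ => g.ne_ratio_mul i j l (by ring))
  have hRq := prod_crossFac hp hq ht k hq (fun i j l hl => by
    have := g.ne_ratio i j (1 + l) fun h => by have := hl h; omega
    rw [zpow_add₀ hq, zpow_one] at this
    convert this using 2; ring)
  -- Comparing u = b with u = q contributes q/b once for each j and each of the k i factors: this is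
  -- the power of q/b with exponent N|k| in the series.
  have hM : ∏ i, ∏ j, crossFac p q t k b i j =
      (q / b) ^ (N * ∑ l, k l) * ∏ i, ∏ j, crossFac p q t k q i j := by
    rw [hRb, hRq]
    have e1 : (q / b) ^ (N * ∑ l, k l) = ∏ i, ∏ _j : Fin N, (q / b) ^ k i := by
      simp only [Finset.prod_const, Finset.card_univ, Fintype.card_fin]
      rw [mul_comm, pow_mul, ← Finset.prod_pow_eq_pow_sum, Finset.prod_pow]
    rw [e1, ← Finset.prod_mul_distrib]
    refine Finset.prod_congr rfl fun i _ => ?_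
    rw [← Finset.prod_mul_distrib]
    refine Finset.prod_congr rfl fun j _ => ?_
    have e2 : (q / b) ^ k i = ∏ _α ∈ Finset.range (k i), q / b := by
      rw [Finset.prod_const, Finset.card_range]
    rw [e2, ← Finset.prod_mul_distrib]
    exact Finset.prod_congr rfl fun α _ => by field_simp
  have hne : ∏ i, ∏ j, crossFac p q t k q i j ≠ 0 := by
    rw [hRq]
    refine Finset.prod_ne_zero_iff.2 fun i _ => Finset.prod_ne_zero_iff.2 fun j _ =>
      Finset.prod_ne_zero_iff.2 fun α _ => ?_
    simp [hq, ht, zpow_ne_zero]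
  refine mul_right_cancel₀ hne ?_
  rw [mul_right_comm, ← hM, ← Finset.prod_mul_distrib, ← Finset.prod_mul_distrib]
  refine Finset.prod_congr rfl fun i _ => ?_
  rw [Finset.prod_comm, ← Finset.prod_mul_distrib, ← Finset.prod_mul_distrib]
  refine Finset.prod_congr rfl fun j _ => ?_
  have hti := ht i
  have htj := ht j
  have ha : a ≠ 0 := left_ne_zero_of_mul (g.generic.x0 i (Finset.mem_univ i))
  -- The product over β telescopes for each α with e = α - k j; for i = j this is negative because α
  -- < k i.
  have h1 : ∏ α ∈ Finset.range (k i), ∏ β ∈ Finset.range (m j - k j),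
      pairFac p q b (a * t j * q ^ (k j + β) / (a * t i * q ^ α)) =
      thetaPoch p q (q ^ (-(m j : ℤ)) * t i / t j) (k i) /
        thetaPoch p q (q ^ (1 - (m j : ℤ)) * t i / (b * t j)) (k i) *
      (thetaPoch p q (q ^ (1 - (k j : ℤ)) * (t i / t j) / b) (k i) /
        thetaPoch p q (q ^ (1 - (k j : ℤ)) * (t i / t j) / q) (k i)) := by
    unfold thetaPoch
    rw [← Finset.prod_div_distrib, ← Finset.prod_div_distrib, ← Finset.prod_mul_distrib]
    refine Finset.prod_congr rfl fun α hα => ?_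
    have hα' := Finset.mem_range.1 hα
    have e := g.pairFac_telescope hp i j ((α : ℤ) - k j) (m j - k j)
      (fun hij => by subst hij; omega)
    have e0 : ∀ β : ℕ, a * t j * q ^ (k j + β) / (a * t i * q ^ α) =
        q ^ ((β : ℤ) - ((α : ℤ) - k j)) * (t j / t i) := fun β => by
      rw [show (β : ℤ) - ((α : ℤ) - k j) = ((k j + β : ℕ) : ℤ) - α by push_cast; ring,
        zpow_sub₀ hq, zpow_natCast, zpow_natCast]
      field_simp
    simp_rw [e0]
    rw [e]
    have hmk : ((m j - k j : ℕ) : ℤ) = m j - k j := by have := hk j; omega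
    have z1 : q ^ ((α : ℤ) - k j - (m j - k j : ℕ)) = q ^ (-(m j : ℤ)) * q ^ α := by
      rw [hmk, ← zpow_natCast, ← zpow_add₀ hq]; congr 1; ring
    have z2 : q ^ (1 + ((α : ℤ) - k j) - (m j - k j : ℕ)) = q ^ (1 - (m j : ℤ)) * q ^ α := by
      rw [hmk, ← zpow_natCast, ← zpow_add₀ hq]; congr 1; ring
    have z3 : q ^ (1 + ((α : ℤ) - k j)) = q ^ (1 - (k j : ℤ)) * q ^ α := by
      rw [← zpow_natCast, ← zpow_add₀ hq]; congr 1; ring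
    have z4 : q ^ ((α : ℤ) - k j) = q ^ (1 - (k j : ℤ)) * q ^ α / q := by
      rw [← zpow_natCast, ← zpow_add₀ hq, eq_div_iff hq, ← zpow_add_one₀ hq]; congr 1; ring
    rw [z1, z2, z3, z4,
      show q ^ (-(m j : ℤ)) * q ^ α * (t i / t j) = q ^ (-(m j : ℤ)) * t i / t j * q ^ α by ring,
      show q ^ (1 - (m j : ℤ)) * q ^ α * (t i / t j) / b =
        q ^ (1 - (m j : ℤ)) * t i / (b * t j) * q ^ α by field_simp,
      show q ^ (1 - (k j : ℤ)) * q ^ α * (t i / t j) / b =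
        q ^ (1 - (k j : ℤ)) * (t i / t j) / b * q ^ α by ring,
      show q ^ (1 - (k j : ℤ)) * q ^ α / q * (t i / t j) =
        q ^ (1 - (k j : ℤ)) * (t i / t j) / q * q ^ α by ring]
  rw [h1]
  simp only [thetaFact_natCast, crossFac]
  have n1 : thetaPoch p q (b * t i / t j) (k i) ≠ 0 := thetaPoch_ne_zero fun l _ =>
    g.ne_ratio_mul i j l (by rw [zpow_natCast]; ring)
  have n2 : thetaPoch p q (q * t i / t j) (k i) ≠ 0 := thetaPoch_ne_zero fun l _ => by
    have := g.ne_ratio i j (l + 1) fun _ => by omega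
    rw [zpow_add_one₀ hq, zpow_natCast] at this
    convert this using 2; ring
  have n3 : thetaPoch p q (q ^ (1 - (k j : ℤ)) * (t i / t j) / q) (k i) ≠ 0 :=
    thetaPoch_ne_zero fun l hl => by
      have := g.ne_ratio i j (l - k j) fun hij => by subst hij; omega
      rw [zpow_sub₀ hq, zpow_natCast] at this
      rw [zpow_sub₀ hq, zpow_one]
      convert this using 2; field_simp
  have n4 : thetaPoch p q (q ^ (1 - (m j : ℤ)) * t i / (b * t j)) (k i) ≠ 0 :=
    thetaPoch_ne_zero fun l _ => g.ne_ratio_div i j (1 - (m j : ℤ) + l) (by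
      rw [zpow_add₀ hq, zpow_natCast]; field_simp)
  have n5 : thetaFact p q (b * t i / t j) ((k i : ℤ) - k j) ≠ 0 := by
    have e2 := thetaFact_sub_mul (p := p) (x := b * t i / t j) hq (k i) (k j) (fun l _ _ =>
      g.ne_ratio_mul i j _ (by ring))
    intro h0
    rw [h0, zero_mul] at e2
    exact n1 e2.symm
  clear h1 hM hRb hRq hne
  generalize thetaPoch p q (b * t i / t j) (k i) = T1 at n1 ⊢
  generalize thetaPoch p q (q * t i / t j) (k i) = T2 at n2 ⊢
  generalize thetaPoch p q (q ^ (1 - (k j : ℤ)) * (t i / t j) / q) (k i) = T3 at n3 ⊢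
  generalize thetaPoch p q (q ^ (1 - (m j : ℤ)) * t i / (b * t j)) (k i) = T4 at n4 ⊢
  generalize thetaFact p q (b * t i / t j) ((k i : ℤ) - k j) = T5 at n5 ⊢
  generalize thetaFact p q (q * t i / t j) ((k i : ℤ) - k j) = T6
  generalize thetaPoch p q (q ^ (1 - (k j : ℤ)) * (t i / t j) / b) (k i) = T7
  generalize thetaPoch p q (q ^ (-(m j : ℤ)) * t i / t j) (k i) = T8
  field_simp

end GenericV

/-! ### Specialisation of the subset sum to geometric progressions. -/

section Specialization

variable {N : ℕ} {m k : Fin N → ℕ}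

/-- The variables of the subset sum that give the multivariable series. -/
noncomputable def specVar (q a : ℂ) (t : Fin N → ℂ) (m : Fin N → ℕ) (s : Σ i, Fin (m i)) : ℂ :=
  a * t s.1 * q ^ (s.2 : ℕ)

theorem GenericV.specVar {p q a b c d : ℂ} {t : Fin N → ℂ} (g : GenericV p q a b c d t)
    (m : Fin N → ℕ) : Generic p q b c d (specVar q a t m) Finset.univ := by
  have hq := g.generic.q0
  refine ⟨hq, g.generic.b0, g.generic.c0, g.generic.d0, fun s _ => ?_, g.generic.params,
    fun s _ i j k l => ?_, fun s _ s' _ i j hj => ?_, fun s _ s' _ hs => ?_⟩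
  · exact mul_ne_zero (g.generic.x0 s.1 (Finset.mem_univ _)) (pow_ne_zero _ hq)
  · refine g.generic.ne1 (Finset.mem_univ s.1) (i + (s.2 : ℕ)) j k l ?_
    rw [zpow_add₀ hq, zpow_natCast, _root_.specVar]; ring
  · refine g.generic.ne2 (Finset.mem_univ s.1) (Finset.mem_univ s'.1) (i + (s.2 : ℕ) - (s'.2 : ℕ)) j
      ?_ hj
    rw [zpow_sub₀ hq, zpow_add₀ hq, zpow_natCast, zpow_natCast, _root_.specVar, _root_.specVar]
    ring
  · have e : _root_.specVar q a t m s / _root_.specVar q a t m s' =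
        q ^ (((s.2 : ℕ) : ℤ) - (s'.2 : ℕ)) * (t s.1 / t s'.1) := by
      have ha : a ≠ 0 := left_ne_zero_of_mul (g.generic.x0 s.1 (Finset.mem_univ _))
      rw [zpow_sub₀ hq, zpow_natCast, zpow_natCast, _root_.specVar, _root_.specVar, mul_assoc,
        mul_assoc, mul_div_mul_left _ _ ha]
      ring
    rw [e]
    refine g.ne_ratio _ _ _ fun h h0 => hs ?_
    obtain ⟨i, α⟩ := s
    obtain ⟨j, β⟩ := s'
    obtain rfl : i = j := h
    have : α = β := Fin.ext (by simpa [sub_eq_zero] using h0)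
    rw [this]

/-- The set of the first `k i` elements in each block. -/
def initSet (m k : Fin N → ℕ) : Finset (Σ i, Fin (m i)) :=
  Finset.univ.filter fun s => (s.2 : ℕ) < k s.1

theorem mem_initSet {s : Σ i, Fin (m i)} : s ∈ initSet m k ↔ (s.2 : ℕ) < k s.1 := by
  simp [initSet]

theorem prod_initSet (hk : ∀ i, k i ≤ m i) (F : Fin N → ℕ → ℂ) :
    ∏ s ∈ initSet m k, F s.1 s.2 = ∏ i, ∏ α ∈ Finset.range (k i), F i α := by
  unfold initSet
  rw [Finset.prod_filter, Fintype.prod_sigma]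
  refine Finset.prod_congr rfl fun i _ => ?_
  rw [Fin.prod_univ_eq_prod_range (fun α => if α < k i then F i α else 1) (m i),
    ← Finset.prod_filter]
  refine Finset.prod_congr ?_ fun _ _ => rfl
  ext α
  have := hk i
  simp only [Finset.mem_filter, Finset.mem_range]
  omega

theorem prod_sdiff_initSet (hk : ∀ i, k i ≤ m i) (F : Fin N → ℕ → ℂ) :
    ∏ s ∈ Finset.univ \ initSet m k, F s.1 s.2 =
      ∏ i, ∏ β ∈ Finset.range (m i - k i), F i (k i + β) := by
  unfold initSet
  rw [← Finset.filter_not, Finset.prod_filter, Fintype.prod_sigma]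
  refine Finset.prod_congr rfl fun i _ => ?_
  rw [Fin.prod_univ_eq_prod_range (fun α => if ¬ α < k i then F i α else 1) (m i)]
  obtain ⟨n, hn⟩ := Nat.exists_eq_add_of_le (hk i)
  rw [hn, Finset.prod_range_add, Nat.add_sub_cancel_left, Finset.prod_eq_one, one_mul]
  · exact Finset.prod_congr rfl fun β _ => by simp
  · exact fun α hα => if_neg (not_not.2 (Finset.mem_range.1 hα))

theorem card_initSet (hk : ∀ i, k i ≤ m i) : (initSet m k).card = ∑ i, k i := by
  unfold initSet
  rw [Finset.card_filter, Fintype.sum_sigma]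
  refine Finset.sum_congr rfl fun i _ => ?_
  rw [Fin.sum_univ_eq_sum_range (fun α => if α < k i then 1 else 0) (m i), ← Finset.card_filter,
    ← Finset.card_range (k i)]
  congr 1
  ext α
  have := hk i
  simp only [Finset.mem_filter, Finset.mem_range, Finset.card_range]
  omega

theorem initSet_injOn : Set.InjOn (initSet m) {k | ∀ i, k i ≤ m i} := by
  intro k hk l hl h
  funext i
  have key : ∀ α (hα : α < m i), α < k i ↔ α < l i := fun α hα => by
    have e1 := mem_initSet (k := k) (s := ⟨i, ⟨α, hα⟩⟩)
    have e2 := mem_initSet (k := l) (s := ⟨i, ⟨α, hα⟩⟩)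
    rw [h] at e1
    exact e1.symm.trans e2
  have h1 := hk i
  have h2 := hl i
  rcases lt_trichotomy (k i) (l i) with h3 | h3 | h3
  · have := key (k i) (by omega); omega
  · exact h3
  · have := key (l i) (by omega); omega

theorem exists_lt_iff_of_succ {P : ℕ → Prop} {n : ℕ} (hn : ∀ α, P α → α < n)
    (h : ∀ α, P (α + 1) → P α) : ∃ k ≤ n, ∀ α, P α ↔ α < k := by
  classical
  have hex : ∃ α, ¬ P α := ⟨n, fun h => lt_irrefl _ (hn n h)⟩
  refine ⟨Nat.find hex, Nat.find_min' hex fun h => lt_irrefl _ (hn n h), fun α => ⟨fun hα => ?_,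
    fun hα => not_not.1 (Nat.find_min hex hα)⟩⟩
  by_contra! hcon
  have : ∀ j, ¬ P (Nat.find hex + j) := fun j => by
    induction j with
    | zero => exact Nat.find_spec hex
    | succ j ih => exact fun hj => ih (h _ hj)
  obtain ⟨j, rfl⟩ := Nat.exists_eq_add_of_le hcon
  exact this j hα

theorem exists_initSet_eq {I : Finset (Σ i, Fin (m i))}
    (h : ∀ i (α : ℕ) (hα : α + 1 < m i), (⟨i, ⟨α + 1, hα⟩⟩ : Σ i, Fin (m i)) ∈ I →
      (⟨i, ⟨α, by omega⟩⟩ : Σ i, Fin (m i)) ∈ I) :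
    ∃ k, (∀ i, k i ≤ m i) ∧ initSet m k = I := by
  have key : ∀ i, ∃ k ≤ m i, ∀ α, (∃ hα : α < m i, (⟨i, ⟨α, hα⟩⟩ : Σ i, Fin (m i)) ∈ I) ↔ α < k :=
    fun i => exists_lt_iff_of_succ (fun α hα => hα.1) fun α ⟨hα, hI⟩ => ⟨by omega, h i α hα hI⟩
  choose k hk hk' using key
  refine ⟨k, hk, ?_⟩
  ext ⟨i, α⟩
  rw [mem_initSet, ← hk']
  exact ⟨fun ⟨_, h⟩ => h, fun h => ⟨α.2, h⟩⟩

/-- Only the initial subsets contribute. -/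
theorem subsetSum_specVar_eq {p q a b c d : ℂ} {t : Fin N → ℂ} (hp : ‖p‖ < 1)
    (g : GenericV p q a b c d t) (m : Fin N → ℕ) :
    subsetSum p q b c d (specVar q a t m) Finset.univ =
      ∑ k ∈ Fintype.piFinset fun i => Finset.range (m i + 1),
        coefA p q b c d (∑ i, k i) * subsetWt p q b (gIn p q b c d (∑ i, k i))
          (gOut p q b c d (∑ i, k i)) (specVar q a t m) Finset.univ (initSet m k) := by
  have hmem : ∀ k : Fin N → ℕ, k ∈ (Fintype.piFinset fun i => Finset.range (m i + 1)) ↔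
      ∀ i, k i ≤ m i := fun k => by simp
  symm
  unfold subsetSum
  refine Finset.sum_of_injOn (initSet m) ?_ ?_ ?_ ?_
  · exact initSet_injOn.mono fun k hk => (hmem k).1 hk
  · exact fun k _ => by simp
  · intro I _ hI
    have hne : ¬ ∀ i (α : ℕ) (hα : α + 1 < m i), (⟨i, ⟨α + 1, hα⟩⟩ : Σ i, Fin (m i)) ∈ I →
        (⟨i, ⟨α, by omega⟩⟩ : Σ i, Fin (m i)) ∈ I := fun h => by
      obtain ⟨k, hk, hkI⟩ := exists_initSet_eq h
      exact hI ⟨k, (hmem k).2 hk, hkI⟩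
    push Not at hne
    obtain ⟨i, α, hα, h1, h2⟩ := hne
    -- If position α + 1 is chosen but α is not, their interaction has the factor θ(q · q⁻¹) = θ(1)
    -- = 0.
    refine mul_eq_zero_of_right _ (mul_eq_zero_of_right _ (Finset.prod_eq_zero h1
      (Finset.prod_eq_zero (Finset.mem_sdiff.2 ⟨Finset.mem_univ _, h2⟩) ?_)))
    have hx := g.generic.x0 i (Finset.mem_univ _)
    have e : q * (specVar q a t m ⟨i, ⟨α, by omega⟩⟩ / specVar q a t m ⟨i, ⟨α + 1, hα⟩⟩) = 1 := by
      simp only [specVar]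
      have := pow_ne_zero α g.generic.q0
      rw [pow_succ, mul_div_assoc', div_eq_one_iff_eq (mul_ne_zero hx (mul_ne_zero this g.generic.q0))]
      ring
    rw [pairFac, e, ellTheta_one hp, zero_mul, zero_div]
  · intro k hk
    rw [card_initSet ((hmem k).1 hk)]

end Specialization

/-! ### The multivariable series as a subset sum. -/

/-- The product of the single-variable weights over one block. -/
theorem prod_gIn_mul_prod_gOut {p q a b c d t : ℂ}
    (h : ∀ (n : ℕ) (j k l : ℤ), ellTheta p (q ^ n * (b ^ j * c ^ k * d ^ l) * (a * t)) ≠ 0)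
    (r : ℕ) {k m : ℕ} (hk : k ≤ m) :
    (∏ α ∈ Finset.range k, gIn p q b c d r (a * t * q ^ α)) *
      (∏ β ∈ Finset.range (m - k), gOut p q b c d r (a * t * q ^ (k + β))) *
      thetaPoch p q (a * q * t) m =
    (ellTheta p (a * t * q ^ (k + r)) / ellTheta p (a * t) *
      ((thetaPoch p q (a * b * t / c) k * thetaPoch p q (a * b * t / d) k) /
        (thetaPoch p q (a * q * t / c) k * thetaPoch p q (a * q * t / d) k)) *
      ((thetaPoch p q (a * t) r * thetaPoch p q (a * b * q ^ m * t) r) /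
        (thetaPoch p q (a * q * t / b) r * thetaPoch p q (a * q ^ (m + 1) * t) r)) *
      (thetaPoch p q (a * q * t / b) (k + r) / thetaPoch p q (a * b * t) (k + r))) *
    (thetaPoch p q (a * b * t) m * thetaPoch p q (a * q * t / c) m *
      thetaPoch p q (a * q * t / d) m) := by
  obtain ⟨n, rfl⟩ := Nat.exists_eq_add_of_le hk
  rw [Nat.add_sub_cancel_left]
  have h' : ∀ (n : ℕ) (j k l : ℤ) {z : ℂ}, z = q ^ n * (b ^ j * c ^ k * d ^ l) * (a * t) →
      ellTheta p z ≠ 0 := fun n j k l z hz => hz ▸ h n j k l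
  have hin : ∏ α ∈ Finset.range k, gIn p q b c d r (a * t * q ^ α) =
      thetaPoch p q (a * b * t / c) k * thetaPoch p q (a * b * t / d) k *
        thetaPoch p q (a * q * t / b * q ^ r) k / thetaPoch p q (a * t * q ^ r) k := by
    simp only [gIn, thetaPoch, ← Finset.prod_mul_distrib, ← Finset.prod_div_distrib]
    refine Finset.prod_congr rfl fun α _ => ?_
    rw [show b * (a * t * q ^ α) / c = a * b * t / c * q ^ α by ring,
      show b * (a * t * q ^ α) / d = a * b * t / d * q ^ α by ring,
      show q ^ (r + 1) * (a * t * q ^ α) / b = a * q * t / b * q ^ r * q ^ α by ring,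
      show q ^ r * (a * t * q ^ α) = a * t * q ^ r * q ^ α by ring]
  have hout : ∏ β ∈ Finset.range n, gOut p q b c d r (a * t * q ^ (k + β)) =
      thetaPoch p q (a * q * t / c * q ^ k) n * thetaPoch p q (a * q * t / d * q ^ k) n *
        thetaPoch p q (a * b * t * q ^ (k + r)) n / thetaPoch p q (a * q * t * q ^ (k + r)) n := by
    simp only [gOut, thetaPoch, ← Finset.prod_mul_distrib, ← Finset.prod_div_distrib]
    refine Finset.prod_congr rfl fun α _ => ?_
    rw [show q * (a * t * q ^ (k + α)) / c = a * q * t / c * q ^ k * q ^ α by ring,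
      show q * (a * t * q ^ (k + α)) / d = a * q * t / d * q ^ k * q ^ α by ring,
      show b * q ^ r * (a * t * q ^ (k + α)) = a * b * t * q ^ (k + r) * q ^ α by ring,
      show q ^ (r + 1) * (a * t * q ^ (k + α)) = a * q * t * q ^ (k + r) * q ^ α by ring]
  -- Both sides split one factorial of length k + n + r in two ways. With the next two relations
  -- this exchanges factorials of length n for the lengths r and k + r of the series.
  have r1 : thetaPoch p q (a * b * t) (k + n) * thetaPoch p q (a * b * q ^ (k + n) * t) r =
      thetaPoch p q (a * b * t) (k + r) * thetaPoch p q (a * b * t * q ^ (k + r)) n := by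
    rw [← thetaPoch_add, show k + r + n = k + n + r by ring, thetaPoch_add p q _ (k + n),
      show a * b * q ^ (k + n) * t = a * b * t * q ^ (k + n) by ring]
  have r2 : thetaPoch p q (a * q * t) (k + n) * thetaPoch p q (a * q ^ (k + n + 1) * t) r =
      thetaPoch p q (a * q * t) (k + r) * thetaPoch p q (a * q * t * q ^ (k + r)) n := by
    rw [← thetaPoch_add, show k + r + n = k + n + r by ring, thetaPoch_add p q _ (k + n),
      show a * q ^ (k + n + 1) * t = a * q * t * q ^ (k + n) by ring]
  have r3 : ellTheta p (a * t) * thetaPoch p q (a * q * t) (k + r) =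
      thetaPoch p q (a * t) r * thetaPoch p q (a * t * q ^ r) k *
        ellTheta p (a * t * q ^ (k + r)) := by
    rw [← thetaPoch_add, add_comm r k, ← thetaPoch_succ, thetaPoch_succ',
      show a * q * t = a * t * q by ring]
  have n1 : thetaPoch p q (a * q * t / c) k ≠ 0 := thetaPoch_ne_zero fun j _ =>
    h' (j + 1) 0 (-1) 0 (by simp; ring)
  have n2 : thetaPoch p q (a * q * t / d) k ≠ 0 := thetaPoch_ne_zero fun j _ =>
    h' (j + 1) 0 0 (-1) (by simp; ring)
  have n3 : thetaPoch p q (a * q * t / b) r ≠ 0 := thetaPoch_ne_zero fun j _ =>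
    h' (j + 1) (-1) 0 0 (by simp; ring)
  have n4 : thetaPoch p q (a * b * t) (k + r) ≠ 0 := thetaPoch_ne_zero fun j _ =>
    h' j 1 0 0 (by simp; ring)
  have n5 : thetaPoch p q (a * q ^ (k + n + 1) * t) r ≠ 0 := thetaPoch_ne_zero fun j _ =>
    h' (k + n + 1 + j) 0 0 0 (by simp; ring)
  have n6 : ellTheta p (a * t) ≠ 0 := h' 0 0 0 0 (by simp)
  have n7 : thetaPoch p q (a * t * q ^ r) k ≠ 0 := thetaPoch_ne_zero fun j _ =>
    h' (r + j) 0 0 0 (by simp; ring)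
  have n8 : thetaPoch p q (a * q * t * q ^ (k + r)) n ≠ 0 := thetaPoch_ne_zero fun j _ =>
    h' (k + r + 1 + j) 0 0 0 (by simp; ring)
  have s1 := thetaPoch_add p q (a * q * t / b) r k
  rw [add_comm r k] at s1
  rw [hin, hout, s1, thetaPoch_add p q (a * q * t / c), thetaPoch_add p q (a * q * t / d)]
  clear hin hout s1 h h'
  generalize thetaPoch p q (a * q * t / c) k = c1 at *
  generalize thetaPoch p q (a * q * t / d) k = d1 at *
  generalize thetaPoch p q (a * q * t / b) r = Q0 at *
  generalize thetaPoch p q (a * b * t) (k + r) = U at *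
  generalize thetaPoch p q (a * q ^ (k + n + 1) * t) r = X at *
  generalize ellTheta p (a * t) = T0 at *
  generalize thetaPoch p q (a * t * q ^ r) k = D at *
  generalize thetaPoch p q (a * q * t * q ^ (k + r)) n = H at *
  generalize thetaPoch p q (a * b * t) (k + n) = Y at *
  generalize thetaPoch p q (a * b * q ^ (k + n) * t) r = W at *
  generalize thetaPoch p q (a * b * t * q ^ (k + r)) n = G at *
  generalize thetaPoch p q (a * q * t) (k + n) = M at *
  generalize thetaPoch p q (a * q * t) (k + r) = V at *
  generalize thetaPoch p q (a * t) r = P0 at *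
  generalize ellTheta p (a * t * q ^ (k + r)) = T1 at *
  generalize thetaPoch p q (a * b * t / c) k = A at *
  generalize thetaPoch p q (a * b * t / d) k = B at *
  generalize thetaPoch p q (a * q * t / b * q ^ r) k = C at *
  generalize thetaPoch p q (a * q * t / c * q ^ k) n = E at *
  generalize thetaPoch p q (a * q * t / d * q ^ k) n = F at *
  obtain rfl : G = Y * W / U := by rw [eq_div_iff n4, r1, mul_comm]
  obtain rfl : V = P0 * D * T1 / T0 := by rw [eq_div_iff n6, ← r3, mul_comm]
  obtain rfl : M = P0 * D * T1 / T0 * H / X := by rw [eq_div_iff n5, r2]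
  field_simp

theorem coefA_eq (p q b c d : ℂ) (r : ℕ) : coefA p q b c d r = (q / b) ^ r *
    ((thetaPoch p q c r * thetaPoch p q d r) /
      (thetaPoch p q (c * q / b) r * thetaPoch p q (d * q / b) r)) := by
  simp only [coefA, thetaPoch, ← Finset.prod_mul_distrib, ← Finset.prod_div_distrib]
  congr 1
  refine Finset.prod_congr rfl fun k _ => ?_
  rw [show c * q / b * q ^ k = c * q ^ (k + 1) / b by ring,
    show d * q / b * q ^ k = d * q ^ (k + 1) / b by ring]

section Series

variable {p q a b c d : ℂ} {N : ℕ} {t : Fin N → ℂ}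

/-- The chosen and unchosen weights are multiplied block by block, the interactions come from
`prod_interaction`, and the factor (q/b)^|k| in `coefA` completes the exponent (N+1)|k|. -/
theorem ellVTerm_mul (hp : ‖p‖ < 1) (g : GenericV p q a b c d t) {m k : Fin N → ℕ}
    (hk : ∀ i, k i ≤ m i) :
    ellVTerm p q m a b c d t k * ∏ i, (thetaPoch p q (a * b * t i) (m i) *
        thetaPoch p q (a * q * t i / c) (m i) * thetaPoch p q (a * q * t i / d) (m i)) =
      coefA p q b c d (∑ i, k i) * subsetWt p q b (gIn p q b c d (∑ i, k i))
        (gOut p q b c d (∑ i, k i)) (specVar q a t m) Finset.univ (initSet m k) *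
      ∏ i, thetaPoch p q (a * q * t i) (m i) := by
  have e1 : ∏ s ∈ initSet m k, gIn p q b c d (∑ i, k i) (specVar q a t m s) =
      ∏ i, ∏ α ∈ Finset.range (k i), gIn p q b c d (∑ i, k i) (a * t i * q ^ α) :=
    prod_initSet hk fun i α => gIn p q b c d (∑ i, k i) (a * t i * q ^ α)
  have e2 : ∏ s ∈ Finset.univ \ initSet m k, gOut p q b c d (∑ i, k i) (specVar q a t m s) =
      ∏ i, ∏ β ∈ Finset.range (m i - k i), gOut p q b c d (∑ i, k i) (a * t i * q ^ (k i + β)) :=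
    prod_sdiff_initSet hk fun i α => gOut p q b c d (∑ i, k i) (a * t i * q ^ α)
  have e3 : ∏ s ∈ initSet m k, ∏ s' ∈ Finset.univ \ initSet m k,
      pairFac p q b (specVar q a t m s' / specVar q a t m s) =
      ∏ i, ∏ α ∈ Finset.range (k i), ∏ j, ∏ β ∈ Finset.range (m j - k j),
        pairFac p q b (a * t j * q ^ (k j + β) / (a * t i * q ^ α)) := by
    rw [← prod_initSet hk fun i α => ∏ j, ∏ β ∈ Finset.range (m j - k j),
        pairFac p q b (a * t j * q ^ (k j + β) / (a * t i * q ^ α))]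
    refine Finset.prod_congr rfl fun s _ => ?_
    exact prod_sdiff_initSet hk fun j β =>
      pairFac p q b (a * t j * q ^ β / (a * t s.1 * q ^ (s.2 : ℕ)))
  have e4 := Finset.prod_congr (rfl : (Finset.univ : Finset (Fin N)) = Finset.univ) fun i _ =>
    prod_gIn_mul_prod_gOut (p := p) (fun n j k l => g.ne_single i n j k l rfl)
      (∑ l, k l) (hk i)
  rw [Finset.prod_mul_distrib, Finset.prod_mul_distrib, Finset.prod_mul_distrib (f := fun i =>
    ellTheta p (a * t i * q ^ (k i + ∑ l, k l)) / ellTheta p (a * t i) * _ * _ * _)] at e4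
  have aux : ∀ {B C x y D P I O M : ℂ}, I * O * M = B * P →
      B * C * (x * y) * D * P = x * C * (I * O * (y * D)) * M := fun {B C x y D P I O M} h => by
    linear_combination (-(C * x * y * D)) * h
  rw [subsetWt, e1, e2, e3, g.prod_interaction hp m k hk, coefA_eq, ellVTerm,
    show (N + 1) * ∑ l, k l = ∑ l, k l + N * ∑ l, k l by ring, pow_add]
  simp only [thetaFact_natCast]
  exact aux e4

/-- The multivariable series as a sum over subsets. -/
theorem ellV_mul (hp : ‖p‖ < 1) (g : GenericV p q a b c d t) (m : Fin N → ℕ) :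
    ellV p q m a b c d t * ∏ i, (thetaPoch p q (a * b * t i) (m i) *
        thetaPoch p q (a * q * t i / c) (m i) * thetaPoch p q (a * q * t i / d) (m i)) =
      subsetSum p q b c d (specVar q a t m) Finset.univ *
        ∏ i, thetaPoch p q (a * q * t i) (m i) := by
  rw [subsetSum_specVar_eq hp g m, ellV, Finset.sum_mul, Finset.sum_mul]
  refine Finset.sum_congr rfl fun k hk => ellVTerm_mul hp g fun i => ?_
  have := Fintype.mem_piFinset.1 hk i
  rw [Finset.mem_range] at this
  omega

theorem subsetWt_comp_equiv {ι κ : Type*} [DecidableEq ι] [DecidableEq κ] [Fintype ι] [Fintype κ]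
    (e : ι ≃ κ) (gi go : ℂ → ℂ) (y : κ → ℂ) (I : Finset ι) :
    subsetWt p q b gi go (fun i => y (e i)) Finset.univ I =
      subsetWt p q b gi go y Finset.univ (I.map e.toEmbedding) := by
  have h : Finset.univ \ I.map e.toEmbedding = (Finset.univ \ I).map e.toEmbedding := by
    ext j
    simp
  unfold subsetWt
  rw [h]
  simp only [Finset.prod_map, Equiv.coe_toEmbedding]

theorem subsetSum_comp_equiv {ι κ : Type*} [DecidableEq ι] [DecidableEq κ] [Fintype ι] [Fintype κ]
    (e : ι ≃ κ) (y : κ → ℂ) :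
    subsetSum p q b c d (fun i => y (e i)) Finset.univ = subsetSum p q b c d y Finset.univ := by
  unfold subsetSum
  refine Finset.sum_bij (fun I _ => I.map e.toEmbedding) (fun I _ => by simp)
    (fun I _ J _ h => Finset.map_injective _ h) (fun J _ => ?_) (fun I _ => ?_)
  · refine ⟨J.map e.symm.toEmbedding, by simp, ?_⟩
    ext j
    simp
  · rw [subsetWt_comp_equiv, Finset.card_map]

variable {s : Fin N → ℂ} {a' : ℂ} {m : Fin N → ℕ}

/-- Genericity survives because the new points are, up to powers of q, the reflections of the old
ones: a' s i = q^(1 - m i) κ/(a t i). -/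
theorem GenericV.dual (hp : ‖p‖ < 1) (g : GenericV p q a b c d t)
    (hs : ∀ i, s i * t i = q ^ (-(m i : ℤ))) (ha' : a' = c * d / (a * b)) :
    GenericV p q a' b c d s := by
  have G := g.generic.dual hp
  obtain ⟨hq, hb, hc, hd, hx, -, -, -, -⟩ := id g.generic
  have ht := g.t0
  have hsv : ∀ i, s i = q ^ (-(m i : ℤ)) / t i := fun i => by rw [eq_div_iff (ht i), hs]
  have ha : ∀ _ : Fin N, a ≠ 0 := fun i => left_ne_zero_of_mul (hx i (Finset.mem_univ i))
  have hv : ∀ i, a' * s i = q ^ (1 - (m i : ℤ)) * (c * d / (q * b) / (a * t i)) := fun i => by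
    have := ht i
    have := ha i
    rw [ha', hsv, sub_eq_add_neg, zpow_add₀ hq, zpow_one]
    field_simp
  have hrat : ∀ i j, i ≠ j → ∀ l : ℤ, ellTheta p (q ^ l * (s i / s j)) ≠ 0 := fun i j hij l => by
    have e : q ^ l * (s i / s j) = q ^ (l - m i + m j) * (t j / t i) := by
      rw [hsv, hsv, zpow_add₀ hq, zpow_sub₀ hq, zpow_neg, zpow_neg, zpow_natCast, zpow_natCast]
      have := ht i
      have := ht j
      field_simp
    rw [e]
    exact g.ratio j i hij.symm _
  refine ⟨⟨hq, hb, hc, hd, fun i hi => ?_, g.generic.params, fun i hi j k l n => ?_,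
    fun i hi j hj l k hk => ?_, fun i _ j _ hij => ?_⟩, hrat⟩
  · rw [hv]
    exact mul_ne_zero (zpow_ne_zero _ hq) (G.x0 i hi)
  · exact G.ne1 hi (j + (1 - m i)) k l n (by rw [hv, zpow_add₀ hq]; ring)
  · refine G.ne2 hi hj (l + (1 - m i) - (1 - m j)) k ?_ hk
    rw [hv, hv]
    generalize 1 - (m i : ℤ) = u
    generalize 1 - (m j : ℤ) = v
    rw [zpow_sub₀ hq, zpow_add₀ hq]
    ring
  · have e : a' * s i / (a' * s j) = q ^ (0 : ℤ) * (s i / s j) := by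
      have : a' ≠ 0 := by rw [ha']; simp [hc, hd, hb, ha i]
      rw [mul_div_mul_left _ _ this, zpow_zero, one_mul]
    rw [e]
    exact hrat i j hij 0

/-- Reflection reverses each progression: position α of the dual block pairs with position m i - 1 -
α of the original one, and the exponents add up to m i - 1. -/
theorem specVar_dual (g : GenericV p q a b c d t)
    (hs : ∀ i, s i * t i = q ^ (-(m i : ℤ))) (ha' : a' = c * d / (a * b)) (x : Σ i, Fin (m i)) :
    specVar q a' s m x = c * d / (q * b) /
      specVar q a t m (Equiv.sigmaCongrRight (fun _ => Fin.revPerm) x) := by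
  obtain ⟨hq, hb, hc, hd, hx, -, -, -, -⟩ := id g.generic
  obtain ⟨i, α⟩ := x
  have ht := g.t0 i
  have ha : a ≠ 0 := left_ne_zero_of_mul (hx i (Finset.mem_univ i))
  have hsv : s i = q ^ (-(m i : ℤ)) / t i := by rw [eq_div_iff ht, hs]
  have hm : q ^ m i = q * q ^ (α : ℕ) * q ^ (m i - (α + 1)) := by
    rw [mul_comm q, ← pow_succ, ← pow_add]
    congr 1
    have := α.2
    omega
  change a' * s i * q ^ (α : ℕ) = c * d / (q * b) / (a * t i * q ^ (α.rev : ℕ))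
  rw [Fin.val_rev, hsv, ha', zpow_neg, zpow_natCast, hm]
  have h1 := pow_ne_zero (α : ℕ) hq
  have h2 := pow_ne_zero (m i - (α + 1)) hq
  field_simp

/-- This converts the monomial prefactor of the reflection formula into shifted factorials: the
theta of index m - 1 - α on the left has the inverse argument of the theta of index α on the right.
-/
theorem prod_sq_mul (hp : ‖p‖ < 1) {t s : ℂ} {m : ℕ} (hq : q ≠ 0) (ha : a ≠ 0) (hb : b ≠ 0)
    (hc : c ≠ 0) (hd : d ≠ 0) (ht : t ≠ 0) (hs : s * t = q ^ (-(m : ℤ)))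
    (ha' : a' = c * d / (a * b)) :
    (∏ α ∈ Finset.range m, (a * t * q ^ α) ^ 2 / (c * d / (q * b))) *
      (thetaPoch p q (a' * b * s) m * thetaPoch p q (a' * q * s / (c * d)) m) =
    thetaPoch p q (a * b * t) m * thetaPoch p q (a * q * t / (c * d)) m := by
  have hsv : s = q ^ (-(m : ℤ)) / t := by rw [eq_div_iff ht, hs]
  simp only [thetaPoch]
  rw [← Finset.prod_range_reflect (fun α => ellTheta p (a' * b * s * q ^ α)),
    ← Finset.prod_range_reflect (fun α => ellTheta p (a' * q * s / (c * d) * q ^ α))]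
  simp only [← Finset.prod_mul_distrib]
  refine Finset.prod_congr rfl fun α hα => ?_
  have hm : q ^ m = q * q ^ (α : ℕ) * q ^ (m - 1 - α) := by
    rw [mul_comm q, ← pow_succ, ← pow_add]
    congr 1
    have := Finset.mem_range.1 hα
    omega
  have h1 := pow_ne_zero α hq
  have h2 := pow_ne_zero (m - 1 - α) hq
  have e1 : a' * b * s * q ^ (m - 1 - α) = c * d / (a * t * q * q ^ α) := by
    rw [hsv, ha', zpow_neg, zpow_natCast, hm]
    field_simp
  have e2 : a' * q * s / (c * d) * q ^ (m - 1 - α) = 1 / (a * b * t * q ^ α) := by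
    rw [hsv, ha', zpow_neg, zpow_natCast, hm]
    field_simp
  rw [e1, e2, ellTheta_of_mul_eq_one hp (x := c * d / (a * t * q * q ^ α))
      (y := a * q * t / (c * d) * q ^ α) (by field_simp),
    ellTheta_of_mul_eq_one hp (x := 1 / (a * b * t * q ^ α))
      (y := a * b * t * q ^ α) (by field_simp)]
  generalize ellTheta p (a * q * t / (c * d) * q ^ α) = T1
  generalize ellTheta p (a * b * t * q ^ α) = T2
  field_simp

/-- The transformation for generic parameters. -/
theorem ellV_transform_of_generic (hp : ‖p‖ < 1) (g : GenericV p q a b c d t)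
    (ha : a ≠ 0) (hs : ∀ i, s i * t i = q ^ (-(m i : ℤ))) (ha' : a' = c * d / (a * b)) :
    ellV p q m a b c d t *
      ∏ i, (thetaPoch p q (a' * q * s i) (m i) * thetaPoch p q (a * q * t i / c) (m i) *
        thetaPoch p q (a * q * t i / d) (m i) * thetaPoch p q (a' * q * s i / (c * d)) (m i)) =
    ellV p q m a' b c d s *
      ∏ i, (thetaPoch p q (a * q * t i) (m i) * thetaPoch p q (a' * q * s i / c) (m i) *
        thetaPoch p q (a' * q * s i / d) (m i) * thetaPoch p q (a * q * t i / (c * d)) (m i)) := by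
  obtain ⟨hq, hb, hc, hd, hx, -, -, -, -⟩ := id g.generic
  have E1 := ellV_mul hp g m
  have E2 := ellV_mul hp (g.dual hp hs ha') m
  have E3 := subsetDual hp (Finset.univ : Finset (Σ i, Fin (m i))) c d (specVar q a t m)
    (fun x => c * d / (q * b) / specVar q a t m x) (g.specVar m) (fun _ _ => rfl)
  rw [← subsetSum_comp_equiv (Equiv.sigmaCongrRight (fun _ => Fin.revPerm)) (fun x => c * d / (q * b) /
    specVar q a t m x), ← subsetSum_congr fun x _ => specVar_dual g hs ha' x] at E3
  have E4 : ∏ x : Σ i, Fin (m i), specVar q a t m x ^ 2 / (c * d / (q * b)) =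
      ∏ i, ∏ α ∈ Finset.range (m i), (a * t i * q ^ α) ^ 2 / (c * d / (q * b)) := by
    rw [Fintype.prod_sigma]
    exact Finset.prod_congr rfl fun i _ =>
      Fin.prod_univ_eq_prod_range (fun α => (a * t i * q ^ α) ^ 2 / (c * d / (q * b))) (m i)
  have E5 := Finset.prod_congr (rfl : (Finset.univ : Finset (Fin N)) = Finset.univ) fun i _ =>
    prod_sq_mul hp hq ha hb hc hd (g.t0 i) (hs i) ha'
  -- The factorials (abt_i) occur only in the conversion to subset sums; they are cancelled at the
  -- end.
  have n1 : ∏ i, thetaPoch p q (a * b * t i) (m i) ≠ 0 := Finset.prod_ne_zero_iff.2 fun i _ =>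
    thetaPoch_ne_zero fun j _ => g.ne_single i j 1 0 0 (by simp; ring)
  rw [E4] at E3
  simp only [Finset.prod_mul_distrib] at E1 E2 E5 ⊢
  rw [E3] at E1
  refine mul_left_cancel₀ n1 ?_
  have aux : ∀ {V V' A Q C D S K A' Q' C' D' R' R : ℂ}, V * (A * C * D) = K * S * Q →
      V' * (A' * C' * D') = S * Q' → K * (A' * R') = A * R →
      A * (V * (Q' * C * D * R')) = A * (V' * (Q * C' * D' * R)) :=
    fun {V V' A Q C D S K A' Q' C' D' R' R} h1 h2 h3 => by
      linear_combination (Q' * R') * h1 - K * Q * R' * h2 + V' * Q * C' * D' * h3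
  exact aux E1 E2 E5

end Series

/-! ### Density of generic parameters. -/

section Density

open Filter Polynomial

/-- The function is a nonzero constant times the exponential with rate given by a polynomial
in `τ`. -/
def IsExp (τ : ℝ) (f : ℂ → ℂ) (P : ℤ[X]) : Prop :=
  ∃ z : ℂ, z ≠ 0 ∧ ∀ ε, f ε = z * Complex.exp (aeval τ P * ε)

namespace IsExp

variable {τ : ℝ} {f g : ℂ → ℂ} {P Q : ℤ[X]}

theorem const {z : ℂ} (hz : z ≠ 0) : IsExp τ (fun _ => z) 0 := ⟨z, hz, fun ε => by simp⟩

theorem mul (hf : IsExp τ f P) (hg : IsExp τ g Q) : IsExp τ (fun ε => f ε * g ε) (P + Q) := by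
  obtain ⟨z, hz, h1⟩ := hf
  obtain ⟨w, hw, h2⟩ := hg
  refine ⟨z * w, mul_ne_zero hz hw, fun ε => ?_⟩
  simp only [h1, h2]
  rw [map_add, Complex.ofReal_add, add_mul, Complex.exp_add]
  ring

theorem zpow (hf : IsExp τ f P) (n : ℤ) : IsExp τ (fun ε => f ε ^ n) (C n * P) := by
  obtain ⟨z, hz, h1⟩ := hf
  refine ⟨z ^ n, zpow_ne_zero _ hz, fun ε => ?_⟩
  simp only [h1]
  rw [mul_zpow, ← Complex.exp_int_mul, map_mul, aeval_C]
  simp [mul_assoc]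

theorem div (hf : IsExp τ f P) (hg : IsExp τ g Q) : IsExp τ (fun ε => f ε / g ε) (P - Q) := by
  obtain ⟨z, hz, h1⟩ := hf
  obtain ⟨w, hw, h2⟩ := hg
  refine ⟨z / w, div_ne_zero hz hw, fun ε => ?_⟩
  simp only [h1, h2]
  rw [map_sub, Complex.ofReal_sub, sub_mul, Complex.exp_sub]
  field_simp

theorem ne_zero (hf : IsExp τ f P) (ε : ℂ) : f ε ≠ 0 := by
  obtain ⟨z, hz, h1⟩ := hf
  rw [h1]
  exact mul_ne_zero hz (Complex.exp_ne_zero _)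

/-- As τ is transcendental, the rate P(τ) is nonzero, so the exponential meets the countable zero
set of θ for only countably many ε. -/
theorem eventually_ne_zero {p : ℂ} (hp : ‖p‖ < 1) (hτ : Transcendental ℤ τ) (hf : IsExp τ f P)
    (hP : P ≠ 0) : ∀ᶠ ε in cocountable, ellTheta p (f ε) ≠ 0 := by
  have h0 := hf.ne_zero
  obtain ⟨z, hz, h1⟩ := hf
  have hw : ((aeval τ P : ℝ) : ℂ) ≠ 0 := Complex.ofReal_ne_zero.2 fun h =>
    hP (transcendental_iff.1 hτ P h)
  refine mem_cocountable.2 ?_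
  have := (((countable_ellTheta_eq_zero hp).preimage (mul_right_injective₀ hz)).preimage_cexp).preimage
    (mul_right_injective₀ hw)
  refine this.mono fun ε hε => ?_
  simp only [Set.mem_preimage, Set.mem_ofPred_eq, ← h1]
  exact ⟨h0 ε, by simpa using hε⟩

end IsExp

theorem eventually_cocountable_forall {α : Type*} {ι : Sort*} [Countable ι] {P : ι → α → Prop}
    (h : ∀ i, ∀ᶠ x in cocountable, P i x) : ∀ᶠ x in cocountable, ∀ i, P i x := by
  refine mem_cocountable.2 ((Set.countable_iUnion fun i => mem_cocountable.1 (h i)).mono ?_)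
  intro x hx
  obtain ⟨i, hi⟩ := not_forall.1 hx
  exact Set.mem_iUnion.2 ⟨i, hi⟩

/-- Generic parameters are dense. -/
theorem eventually_genericV {p a : ℂ} {N : ℕ} {τ : ℝ} (hp : ‖p‖ < 1) (hτ : Transcendental ℤ τ)
    (ha : a ≠ 0) {q b c d : ℂ → ℂ} {t : Fin N → ℂ → ℂ} (hq : IsExp τ q 1) (hb : IsExp τ b X)
    (hc : IsExp τ c (X ^ 2)) (hd : IsExp τ d (X ^ 3)) (ht : ∀ i, IsExp τ (t i) (X ^ (4 + (i : ℕ)))) :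
    ∀ᶠ ε in cocountable, GenericV p (q ε) a (b ε) (c ε) (d ε) (fun i => t i ε) := by
  have hmon : ∀ i j k l : ℤ, IsExp τ (fun ε => q ε ^ i * b ε ^ j * c ε ^ k * d ε ^ l)
      (C i * 1 + C j * X + C k * X ^ 2 + C l * X ^ 3) := fun i j k l =>
    (((hq.zpow i).mul (hb.zpow j)).mul (hc.zpow k)).mul (hd.zpow l)
  have hx : ∀ s, IsExp τ (fun ε => a * t s ε) (0 + X ^ (4 + (s : ℕ))) := fun s =>
    (IsExp.const ha).mul (ht s)
  have hr : ∀ s s', IsExp τ (fun ε => t s ε / t s' ε) (X ^ (4 + (s : ℕ)) - X ^ (4 + (s' : ℕ))) :=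
    fun s s' => (ht s).div (ht s')
  have e1 : ∀ᶠ ε in cocountable, ∀ i j k l : ℤ, i ≠ 0 ∨ j ≠ 0 ∨ k ≠ 0 ∨ l ≠ 0 →
      ellTheta p (q ε ^ i * b ε ^ j * c ε ^ k * d ε ^ l) ≠ 0 := by
    refine eventually_cocountable_forall fun i => eventually_cocountable_forall fun j => eventually_cocountable_forall fun k =>
      eventually_cocountable_forall fun l => eventually_cocountable_forall fun h => ?_
    refine (hmon i j k l).eventually_ne_zero hp hτ fun h0 => ?_
    -- The rates 1, τ, τ², τ³ are independent, so all four exponents can be read off as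
    -- coefficients.
    have h0' := fun n => congrArg (fun P : ℤ[X] => P.coeff n) h0
    have c0 := h0' 0
    have c1 := h0' 1
    have c2 := h0' 2
    have c3 := h0' 3
    simp only [coeff_add, coeff_C_mul, coeff_zero, coeff_X, coeff_one, coeff_X_pow] at c0 c1 c2 c3
    norm_num at c0 c1 c2 c3
    tauto
  have e2 : ∀ᶠ ε in cocountable, ∀ s : Fin N, ∀ i j k l : ℤ,
      ellTheta p (q ε ^ i * b ε ^ j * c ε ^ k * d ε ^ l * (a * t s ε)) ≠ 0 := by
    refine eventually_cocountable_forall fun s => eventually_cocountable_forall fun i => eventually_cocountable_forall fun j =>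
      eventually_cocountable_forall fun k => eventually_cocountable_forall fun l => ?_
    refine ((hmon i j k l).mul (hx s)).eventually_ne_zero hp hτ fun h0 => ?_
    -- The rate of the variable t s is a power of degree at least 4, absent from the rates of q, b,
    -- c, d.
    have := congrArg (fun P : ℤ[X] => P.coeff (4 + s)) h0
    simp only [coeff_add, coeff_C_mul, coeff_zero, coeff_X, coeff_one, coeff_X_pow] at this
    grind
  have e3 : ∀ᶠ ε in cocountable, ∀ s s' : Fin N, ∀ i j : ℤ, j ≠ 0 →
      ellTheta p (q ε ^ i * b ε ^ j * (t s ε / t s' ε)) ≠ 0 := by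
    refine eventually_cocountable_forall fun s => eventually_cocountable_forall fun s' => eventually_cocountable_forall fun i =>
      eventually_cocountable_forall fun j => eventually_cocountable_forall fun hj => ?_
    refine (((hq.zpow i).mul (hb.zpow j)).mul (hr s s')).eventually_ne_zero hp hτ fun h0 => ?_
    have := congrArg (fun P : ℤ[X] => P.coeff 1) h0
    simp only [coeff_add, coeff_sub, coeff_C_mul, coeff_zero, coeff_X, coeff_one, coeff_X_pow] at this
    grind
  have e4 : ∀ᶠ ε in cocountable, ∀ s s' : Fin N, s ≠ s' → ∀ l : ℤ,
      ellTheta p (q ε ^ l * (t s ε / t s' ε)) ≠ 0 := by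
    refine eventually_cocountable_forall fun s => eventually_cocountable_forall fun s' => eventually_cocountable_forall fun hs =>
      eventually_cocountable_forall fun l => ?_
    refine ((hq.zpow l).mul (hr s s')).eventually_ne_zero hp hτ fun h0 => ?_
    have := congrArg (fun P : ℤ[X] => P.coeff (4 + s)) h0
    simp only [coeff_add, coeff_sub, coeff_C_mul, coeff_zero, coeff_one, coeff_X_pow] at this
    grind
  filter_upwards [e1, e2, e3, e4] with ε h1 h2 h3 h4
  refine ⟨⟨hq.ne_zero ε, hb.ne_zero ε, hc.ne_zero ε, hd.ne_zero ε, fun s _ => (hx s).ne_zero ε,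
    h1, fun s _ => h2 s, fun s _ s' _ i j hj => ?_, fun s _ s' _ hs => ?_⟩, h4⟩
  · rw [mul_div_mul_left _ _ ha]
    exact h3 s s' i j hj
  · rw [mul_div_mul_left _ _ ha]
    simpa using h4 s s' hs 0

end Density

/-! ### Continuity of the series where it is well defined. -/

section Continuity

variable {X : Type*} [TopologicalSpace X] {x : X}

/-- The function is continuous and does not vanish at `x`. -/
def NonzeroAt (f : X → ℂ) (x : X) : Prop := ContinuousAt f x ∧ f x ≠ 0

namespace NonzeroAt

variable {f g : X → ℂ} {p : ℂ}

theorem mul (hf : NonzeroAt f x) (hg : NonzeroAt g x) : NonzeroAt (fun y => f y * g y) x :=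
  ⟨hf.1.mul hg.1, mul_ne_zero hf.2 hg.2⟩

theorem div (hf : NonzeroAt f x) (hg : NonzeroAt g x) : NonzeroAt (fun y => f y / g y) x :=
  ⟨hf.1.div hg.1 hg.2, div_ne_zero hf.2 hg.2⟩

theorem pow (hf : NonzeroAt f x) (n : ℕ) : NonzeroAt (fun y => f y ^ n) x :=
  ⟨hf.1.pow n, pow_ne_zero n hf.2⟩

theorem zpow (hf : NonzeroAt f x) (n : ℤ) : NonzeroAt (fun y => f y ^ n) x :=
  ⟨hf.1.zpow₀ n (Or.inl hf.2), zpow_ne_zero n hf.2⟩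

theorem ellTheta (hp : ‖p‖ < 1) (hf : NonzeroAt f x) : ContinuousAt (fun y => ellTheta p (f y)) x :=
  ContinuousAt.comp (f := f) (differentiableAt_ellTheta hp hf.2).continuousAt hf.1

theorem prod_ellTheta {g : ℕ → X → ℂ} (hp : ‖p‖ < 1) (hg : ∀ j, NonzeroAt (g j) x) (n : ℕ) :
    ContinuousAt (fun y => ∏ j ∈ Finset.range n, _root_.ellTheta p (g j y)) x :=
  tendsto_finsetProd _ fun j _ => (hg j).ellTheta hp

/-- A nonnegative index gives a finite product of thetas and needs no condition; for a negative
index, nonvanishing in Lean excludes a zero denominator. -/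
theorem thetaFact {q : X → ℂ} (hp : ‖p‖ < 1) (hq : NonzeroAt q x) (hf : NonzeroAt f x) (n : ℤ)
    (h : n < 0 → thetaFact p (q x) (f x) n ≠ 0) :
    ContinuousAt (fun y => thetaFact p (q y) (f y) n) x := by
  refine (prod_ellTheta hp (fun j => hf.mul (hq.pow j)) _).div
    (prod_ellTheta hp (fun j => hf.mul (hq.zpow (-((j : ℤ) + 1)))) _) ?_
  rcases lt_or_ge n 0 with hn | hn
  · exact fun h0 => h hn (by rw [_root_.thetaFact, h0, div_zero])
  · simp [Int.toNat_of_nonpos (neg_nonpos.2 hn)]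

theorem inv_thetaFact {q : X → ℂ} (hp : ‖p‖ < 1) (hq : NonzeroAt q x) (hf : NonzeroAt f x) (n : ℤ)
    (h : 0 ≤ n → _root_.thetaFact p (q x) (f x) n ≠ 0) :
    ContinuousAt (fun y => (_root_.thetaFact p (q y) (f y) n)⁻¹) x := by
  simp only [_root_.thetaFact, inv_div]
  refine (prod_ellTheta hp (fun j => hf.mul (hq.zpow (-((j : ℤ) + 1)))) _).div
    (prod_ellTheta hp (fun j => hf.mul (hq.pow j)) _) ?_
  rcases lt_or_ge n 0 with hn | hn
  · simp [Int.toNat_of_nonpos hn.le]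
  · exact fun h0 => h hn (by rw [_root_.thetaFact, h0, zero_div])

theorem thetaFact_natCast {q : X → ℂ} (hp : ‖p‖ < 1) (hq : NonzeroAt q x) (hf : NonzeroAt f x)
    (n : ℕ) : ContinuousAt (fun y => _root_.thetaFact p (q y) (f y) n) x :=
  hq.thetaFact hp hf n fun h => absurd h (by simp)

end NonzeroAt

theorem continuousAt_ellV {p : ℂ} {N : ℕ} {m : Fin N → ℕ} {q a b c d : X → ℂ} {t : Fin N → X → ℂ}
    (hp : ‖p‖ < 1) (hq : NonzeroAt q x) (ha : NonzeroAt a x) (hb : NonzeroAt b x)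
    (hc : NonzeroAt c x) (hd : NonzeroAt d x) (ht : ∀ i, NonzeroAt (t i) x)
    (h : EllVWellDefined p (q x) m (a x) (b x) (c x) (d x) (fun i => t i x)) :
    ContinuousAt (fun y => ellV p (q y) m (a y) (b y) (c y) (d y) (fun i => t i y)) x := by
  refine tendsto_finsetSum _ fun k hk => ?_
  have hk' : ∀ i, k i ≤ m i := fun i => by
    have := Fintype.mem_piFinset.1 hk i
    rw [Finset.mem_range] at this
    omega
  obtain ⟨h1, h2, h3, h4⟩ := h k hk'
  have F : ∀ {f : X → ℂ} (n : ℕ), NonzeroAt f x →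
    ContinuousAt (fun y => thetaFact p (q y) (f y) n) x := fun n hf => hq.thetaFact_natCast hp hf n
  refine ContinuousAt.mul (ContinuousAt.mul (ContinuousAt.mul ?_ ?_) ?_) ?_
  · refine tendsto_finsetProd _ fun i _ => ?_
    obtain ⟨n1, n2, n3, n4, n5, n6⟩ := h1 i
    have hi := ht i
    refine ContinuousAt.mul (ContinuousAt.mul (ContinuousAt.mul ?_ ?_) ?_) ?_
    · exact (((ha.mul hi).mul (hq.pow _)).ellTheta hp).div ((ha.mul hi).ellTheta hp) n1
    · exact ((F _ (((ha.mul hb).mul hi).div hc)).mul (F _ (((ha.mul hb).mul hi).div hd))).div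
        ((F _ (((ha.mul hq).mul hi).div hc)).mul (F _ (((ha.mul hq).mul hi).div hd)))
        (mul_ne_zero n2 n3)
    · exact ((F _ (ha.mul hi)).mul (F _ (((ha.mul hb).mul (hq.pow _)).mul hi))).div
        ((F _ (((ha.mul hq).mul hi).div hb)).mul (F _ ((ha.mul (hq.pow _)).mul hi)))
        (mul_ne_zero n4 n5)
    · exact (F _ (((ha.mul hq).mul hi).div hb)).div (F _ ((ha.mul hb).mul hi)) n6
  · exact ((F _ hc).mul (F _ hd)).div ((F _ ((hc.mul hq).div hb)).mul (F _ ((hd.mul hq).div hb)))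
      (mul_ne_zero h2 h3)
  · exact ((hq.div hb).pow _).1
  · refine tendsto_finsetProd _ fun i _ => tendsto_finsetProd _ fun j _ => ?_
    obtain ⟨n1, n2, n3, n4⟩ := h4 i j
    have hi := ht i
    have hj := ht j
    refine ContinuousAt.mul ?_ ?_
    · exact ((F _ (((hq.zpow _).mul hi).div hj)).mul (F _ ((hb.mul hi).div hj))).div
        ((F _ (((hq.zpow _).mul hi).div (hb.mul hj))).mul (F _ ((hq.mul hi).div hj)))
        (mul_ne_zero n1 n2)
    · simp only [div_eq_mul_inv (thetaFact _ _ _ _)]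
      exact (hq.thetaFact hp ((hq.mul hi).div hj) _ fun h => n3 (by omega)).mul
        (hq.inv_thetaFact hp ((hb.mul hi).div hj) _ fun h => n4 (by omega))

/-- Cross-multiplying keeps the prefactor free of denominators, so only the series has to be well
defined. -/
theorem continuousAt_ellV_mul_prod {p : ℂ} {N : ℕ} {m : Fin N → ℕ} {q a b c d : X → ℂ}
    {t u₁ u₂ u₃ u₄ : Fin N → X → ℂ} (hp : ‖p‖ < 1) (hq : NonzeroAt q x) (ha : NonzeroAt a x)
    (hb : NonzeroAt b x) (hc : NonzeroAt c x) (hd : NonzeroAt d x) (ht : ∀ i, NonzeroAt (t i) x)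
    (h₁ : ∀ i, NonzeroAt (u₁ i) x) (h₂ : ∀ i, NonzeroAt (u₂ i) x) (h₃ : ∀ i, NonzeroAt (u₃ i) x)
    (h₄ : ∀ i, NonzeroAt (u₄ i) x)
    (h : EllVWellDefined p (q x) m (a x) (b x) (c x) (d x) (fun i => t i x)) :
    ContinuousAt (fun y => ellV p (q y) m (a y) (b y) (c y) (d y) (fun i => t i y) *
      ∏ i, (thetaFact p (q y) (u₁ i y) (m i) * thetaFact p (q y) (u₂ i y) (m i) *
        thetaFact p (q y) (u₃ i y) (m i) * thetaFact p (q y) (u₄ i y) (m i))) x :=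
  (continuousAt_ellV hp hq ha hb hc hd ht h).mul (tendsto_finsetProd _ fun i _ =>
    (((hq.thetaFact_natCast hp (h₁ i) _).mul (hq.thetaFact_natCast hp (h₂ i) _)).mul
      (hq.thetaFact_natCast hp (h₃ i) _)).mul (hq.thetaFact_natCast hp (h₄ i) _))

end Continuity

/-! ### The transformation for arbitrary parameters. -/

/-- The transformation of the multivariable series. -/
theorem ellV_transform {p q a b c d : ℂ} (hp : ‖p‖ < 1) (hq : q ≠ 0) (ha : a ≠ 0) (hb : b ≠ 0)
    (hc : c ≠ 0) (hd : d ≠ 0) {N : ℕ} {m : Fin N → ℕ} {t s : Fin N → ℂ} {a' : ℂ}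
    (ht : ∀ i, t i ≠ 0) (hs : ∀ i, s i * t i = q ^ (-(m i : ℤ))) (ha' : a' = c * d / (a * b))
    (h : EllVWellDefined p q m a b c d t) (h' : EllVWellDefined p q m a' b c d s) :
    ellV p q m a b c d t *
      ∏ i, (thetaFact p q (a' * q * s i) (m i) * thetaFact p q (a * q * t i / c) (m i) *
        thetaFact p q (a * q * t i / d) (m i) * thetaFact p q (a' * q * s i / (c * d)) (m i)) =
    ellV p q m a' b c d s *
      ∏ i, (thetaFact p q (a * q * t i) (m i) * thetaFact p q (a' * q * s i / c) (m i) *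
        thetaFact p q (a' * q * s i / d) (m i) * thetaFact p q (a * q * t i / (c * d)) (m i)) := by
  obtain rfl : s = fun i => q ^ (-(m i : ℤ)) / t i := funext fun i => by
    rw [eq_div_iff (ht i), hs]
  subst ha'
  -- Any real transcendental number would do.
  set τ : ℝ := liouvilleNumber (2 : ℕ)
  have hτ : Transcendental ℤ τ := transcendental_liouvilleNumber le_rfl
  -- The deformation curve: at ε = 0 it passes through the given value z. The parameter a stays
  -- fixed, while s and a' follow from the others.
  set Q : (Polynomial ℤ) → ℂ → ℂ → ℂ := fun P z ε => z * Complex.exp (Polynomial.aeval τ P * ε)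
    with hQ
  have hE : ∀ {z : ℂ} (P : Polynomial ℤ), z ≠ 0 → IsExp τ (Q P z) P := fun P hz =>
    ⟨_, hz, fun ε => rfl⟩
  have hQ0 : ∀ P z, Q P z 0 = z := fun P z => by simp [hQ]
  have hN : ∀ {z : ℂ} (P : Polynomial ℤ), z ≠ 0 → NonzeroAt (Q P z) 0 := fun P hz =>
    ⟨by simp only [hQ]; fun_prop, by rwa [hQ0]⟩
  have nq := hN 1 hq
  have nb := hN Polynomial.X hb
  have nc := hN (Polynomial.X ^ 2) hc
  have nd := hN (Polynomial.X ^ 3) hd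
  have nt := fun i : Fin N => hN (Polynomial.X ^ (4 + (i : ℕ))) (ht i)
  have na : NonzeroAt (fun _ : ℂ => a) 0 := ⟨continuousAt_const, ha⟩
  have ns := fun i => (nq.zpow (-(m i : ℤ))).div (nt i)
  have na' := (nc.mul nd).div (na.mul nb)
  have hgen := eventually_genericV hp hτ ha (hE 1 hq) (hE Polynomial.X hb)
    (hE (Polynomial.X ^ 2) hc) (hE (Polynomial.X ^ 3) hd)
    (fun i => hE (Polynomial.X ^ (4 + (i : ℕ))) (ht i))
  have hfreq : ∃ᶠ ε in nhds (0 : ℂ), GenericV p (Q 1 q ε) a (Q Polynomial.X b ε)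
      (Q (Polynomial.X ^ 2) c ε) (Q (Polynomial.X ^ 3) d ε)
      (fun i => Q (Polynomial.X ^ (4 + (i : ℕ))) (t i) ε) := by
    have := (Filter.mem_cocountable.1 hgen).dense_compl ℂ
    rw [compl_compl] at this
    exact mem_closure_iff_frequently.1 (this 0)
  have c1 := continuousAt_ellV_mul_prod (m := m) hp nq na nb nc nd nt
    (fun i => (na'.mul nq).mul (ns i)) (fun i => ((na.mul nq).mul (nt i)).div nc)
    (fun i => ((na.mul nq).mul (nt i)).div nd)
    (fun i => ((na'.mul nq).mul (ns i)).div (nc.mul nd)) (by simpa only [hQ0] using h)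
  have c2 := continuousAt_ellV_mul_prod (m := m) hp nq na' nb nc nd ns
    (fun i => (na.mul nq).mul (nt i)) (fun i => ((na'.mul nq).mul (ns i)).div nc)
    (fun i => ((na'.mul nq).mul (ns i)).div nd)
    (fun i => ((na.mul nq).mul (nt i)).div (nc.mul nd)) (by simpa only [hQ0] using h')
  -- Both sides are continuous at ε = 0 and agree at generic ε arbitrarily close to 0.
  have key := tendsto_nhds_unique_of_frequently_eq c1 c2 (hfreq.mono fun ε g => by
    simpa only [thetaFact_natCast] using ellV_transform_of_generic hp g ha
      (s := fun i => Q 1 q ε ^ (-(m i : ℤ)) / Q (Polynomial.X ^ (4 + (i : ℕ))) (t i) ε)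
      (fun i => div_mul_cancel₀ _ (g.t0 i)) rfl)
  simpa only [hQ0] using key

/-! ### The case N = 1 and the final statement. -/

section OneVariable

variable {p q a b c d t : ℂ} {n : ℕ}

/-- For N = 1 the series depends on a and t only through at, and the factorials of index k_i - k_j =
0 are 1. -/
theorem ellV_const (ht : t ≠ 0) :
    ellV p q (fun _ : Fin 1 => n) a b c d (fun _ => t) = ellV1 p q n (a * t) b c d := by
  unfold ellV ellV1
  refine Finset.sum_nbij' (fun k => k 0) (fun k _ => k) (fun k hk => ?_) (fun k hk => ?_)
    (fun k _ => ?_) (fun k _ => rfl) (fun k _ => ?_)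
  · exact Fintype.mem_piFinset.1 hk 0
  · exact Fintype.mem_piFinset.2 fun _ => hk
  · funext i
    rw [Subsingleton.elim i 0]
  · simp only [ellVTerm, Fin.prod_univ_one, Fin.sum_univ_one, sub_self]
    have e : ∀ z, thetaFact p q z 0 = 1 := fun z => by simp [thetaFact]
    rw [e, e, mul_div_mul_right _ _ ht, mul_div_cancel_right₀ _ ht, mul_div_cancel_right₀ _ ht,
      mul_div_cancel_right₀ _ ht, show a * b * t = a * t * b by ring,
      show a * q * t = a * t * q by ring, show a * b * q ^ n * t = a * t * b * q ^ n by ring,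
      show a * q ^ (n + 1) * t = a * t * q ^ (n + 1) by ring, ← two_mul]
    simp only [div_eq_mul_inv, mul_inv, inv_one, mul_one]
    ring

theorem EllV1WellDefined.ellV_const (ht : t ≠ 0) (h : EllV1WellDefined p q n (a * t) b c d) :
    EllVWellDefined p q (fun _ : Fin 1 => n) a b c d (fun _ => t) := by
  intro k hk
  obtain ⟨h0, h⟩ := h
  obtain ⟨n1, n2, n3, n4, n5, n6, n7, n8, n9⟩ := h (k 0) (hk 0)
  have e : thetaFact p q (b * t / t) 0 = 1 := by simp [thetaFact]
  simp only [Fin.forall_fin_one, Fin.sum_univ_one, sub_self, e, lt_irrefl]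
  rw [mul_div_mul_right _ _ ht, mul_div_cancel_right₀ _ ht, show a * b * t = a * t * b by ring,
      show a * q * t = a * t * q by ring,
      show a * q ^ (n + 1) * t = a * t * q ^ (n + 1) by ring, ← two_mul]
  exact ⟨⟨h0, n3, n4, n2, n8, n9⟩, n5, n6, n7, n1, fun h => h.elim, fun _ => one_ne_zero⟩

end OneVariable

theorem mainTheorem3 (p q a b c d : ℂ) (hp : ‖p‖ < 1) (hq : q ≠ 0)
    (ha : a ≠ 0) (hb : b ≠ 0) (hc : c ≠ 0) (hd : d ≠ 0) :
    (∀ (N : ℕ) (m : Fin N → ℕ) (t s : Fin N → ℂ) (a' : ℂ),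
      (∀ i, t i ≠ 0) → (∀ i, s i * t i = q ^ (-(m i : ℤ))) → a' = c * d / (a * b) →
      EllVWellDefined p q m a b c d t → EllVWellDefined p q m a' b c d s →
      (∀ i, thetaFact p q (a' * q * s i) (m i) ≠ 0 ∧ thetaFact p q (a * q * t i / c) (m i) ≠ 0 ∧
        thetaFact p q (a * q * t i / d) (m i) ≠ 0 ∧
        thetaFact p q (a' * q * s i / (c * d)) (m i) ≠ 0) →
      ellV p q m a b c d t =
        ellV p q m a' b c d s *
          ∏ i, (thetaFact p q (a * q * t i) (m i) * thetaFact p q (a' * q * s i / c) (m i) *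
              thetaFact p q (a' * q * s i / d) (m i) *
              thetaFact p q (a * q * t i / (c * d)) (m i)) /
            (thetaFact p q (a' * q * s i) (m i) * thetaFact p q (a * q * t i / c) (m i) *
              thetaFact p q (a * q * t i / d) (m i) *
              thetaFact p q (a' * q * s i / (c * d)) (m i))) ∧
    (∀ (n : ℕ) (a' : ℂ), a' = q ^ (-(n : ℤ)) * c * d / (a * b) →
      EllV1WellDefined p q n a b c d → EllV1WellDefined p q n a' b c d →
      (thetaFact p q (a' * q) n ≠ 0 ∧ thetaFact p q (a * q / c) n ≠ 0 ∧
        thetaFact p q (a * q / d) n ≠ 0 ∧ thetaFact p q (a' * q / (c * d)) n ≠ 0) →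
      ellV1 p q n a b c d =
        (thetaFact p q (a * q) n * thetaFact p q (a' * q / c) n * thetaFact p q (a' * q / d) n *
            thetaFact p q (a * q / (c * d)) n) /
          (thetaFact p q (a' * q) n * thetaFact p q (a * q / c) n * thetaFact p q (a * q / d) n *
            thetaFact p q (a' * q / (c * d)) n) *
          ellV1 p q n a' b c d) := by
  refine ⟨fun N m t s a' ht hs ha' h h' hne => ?_, fun n a' ha' h h' hne => ?_⟩
  · rw [Finset.prod_div_distrib, mul_div_assoc', eq_div_iff]
    · exact ellV_transform hp hq ha hb hc hd ht hs ha' h h'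
    · refine Finset.prod_ne_zero_iff.2 fun i _ => ?_
      obtain ⟨n1, n2, n3, n4⟩ := hne i
      exact mul_ne_zero (mul_ne_zero (mul_ne_zero n1 n2) n3) n4
  · obtain ⟨n1, n2, n3, n4⟩ := hne
    have hs : q ^ (-(n : ℤ)) ≠ 0 := zpow_ne_zero _ hq
    -- The one-variable parameter is the product of the multivariable cd/(ab) with s = q^(-n), for t
    -- = 1.
    obtain rfl : a' = c * d / (a * b) * q ^ (-(n : ℤ)) := by rw [ha']; ring
    rw [← mul_one a] at h
    have key := ellV_transform (m := fun _ : Fin 1 => n) (t := fun _ => 1)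
      (s := fun _ => q ^ (-(n : ℤ))) hp hq ha hb hc hd (fun _ => one_ne_zero)
      (fun _ => mul_one _) rfl (h.ellV_const one_ne_zero) (h'.ellV_const hs)
    rw [ellV_const one_ne_zero, ellV_const hs] at key
    simp only [Fin.prod_univ_one, mul_one, mul_right_comm _ q (q ^ (-(n : ℤ)))] at key
    rw [div_mul_eq_mul_div, eq_div_iff (mul_ne_zero (mul_ne_zero (mul_ne_zero n1 n2) n3) n4), key,
      mul_comm]
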